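/- **Setting.** A database $D$ over a finite relational schema has a finite domain, identified with $\{0,\dots,n-1\}$, and for every relation symbol $R$ of arity $r$ a set $R^D$ of $r$-tuples over the domain (facts); $\|D\|$ denotes the number of facts of $D$. A conjunctive query $q$ is a non-empty finite conjunction of atoms $R(\bar x)$, some of whose variables are existentially quantified; the others are free, every variable occurs in an atom, and the same relation symbol may occur in several atoms (self-joins). The query is Boolean (unary) if it has no (exactly one) free variable. Its set of solutions $q(D)$ consists of the restrictions to the free variables of those assignments of all variables to domain elements that make every atom a fact of $D$. The query is *minimal* if every map $\nu$ from its variables to its variables that preserves the atoms and is the identity on the free variables is injective. It is *acyclic* if it has a join tree: a tree whose nodes are the atoms of $q$ such that, for each variable $x$, the atoms containing $x$ form a connected subtree. **Computation.** Algorithms are programs of a random access machine with addition, truncated subtraction, multiplication, indirect reads and writes, and tests for zero, each at unit cost, with memory initialised to $0$ outside the input. As usual, machine words have logarithmic length: all numbers used are bounded by a polynomial in the length plus the largest entry of the input. Databases, relations and hypergraphs are given as lists, in arbitrary order without repetition, of their facts, tuples and hyperedges, preceded by their number; a database or hypergraph is preceded by the number of its domain elements or nodes. *The solutions of $q$ can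 be computed in linear time* if there are a program and a constant $c$, depending only on $q$ and the schema, such that for every database $D$ the program, given any listing of $D$, halts within $c(\|D\|+1)$ steps and outputs a listing of $q(D)$. **sHyperclique conjecture.** For every $k\ge 3$, no program of this kind decides, given a $(k-1)$-uniform hypergraph with $m$ hyperedges, in time $O(m)$ (at most $c(m+1)$ steps for a constant $c$) whether there is a set of $k$ nodes all of whose $(k-1)$-element subsets are hyperedges. **Theorem.** Let $q$ be a minimal conjunctive query that is Boolean or unary, possibly with self-joins. Assuming the sHyperclique conjecture, the solutions of $q$ can be computed in linear time if and only if $q$ is acyclic. -/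

import Mathlib

/-! ## Random access machines with unit cost addition and multiplication -/

/-- Basic instructions. Operands are names of registers; `load` and `store` address the memory
indirectly, through the content of a register. -/
inductive Instr where
  | const (r n : ℕ)
  | add (r a b : ℕ)
  | sub (r a b : ℕ)
  | mul (r a b : ℕ)
  | load (r a : ℕ)
  | store (a b : ℕ)
  | out (a : ℕ)

/-- Programs. Control flow is structured; this is the same as having jumps, up to a constant factor
in the running time (a jump program is one loop over its program counter). -/
inductive Prog where
  | skip
  | instr (i : Instr)
  | seq (p₁ p₂ : Prog)
  | ite (a : ℕ) (p₁ p₂ : Prog)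
  | loop (a : ℕ) (p : Prog)

/-- A configuration: registers (a program uses finitely many), memory, and the output so far. -/
structure RamState where
  reg : ℕ → ℕ
  mem : ℕ → ℕ
  out : List ℕ

/-- The value that an instruction writes. Subtraction is truncated at `0`. -/
def Instr.value (s : RamState) : Instr → ℕ
  | .const _ n => n
  | .add _ a b => s.reg a + s.reg b
  | .sub _ a b => s.reg a - s.reg b
  | .mul _ a b => s.reg a * s.reg b
  | .load _ a => s.mem (s.reg a)
  | .store _ b => s.reg b
  | .out a => s.reg a

/-- The effect of an instruction. -/
def Instr.run (s : RamState) (i : Instr) : RamState :=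
  match i with
  | .const r _ | .add r _ _ | .sub r _ _ | .mul r _ _ | .load r _ =>
      { s with reg := Function.update s.reg r (i.value s) }
  | .store a _ => { s with mem := Function.update s.mem (s.reg a) (i.value s) }
  | .out _ => { s with out := s.out ++ [i.value s] }

/-- `Exec W p s t s'`: started in `s`, the program `p` halts in `s'` after exactly `t` steps, and
all values written on the way are at most `W` (a machine word holds the numbers `0, …, W`).
Every instruction and every test of a register against `0` takes one step. -/
inductive Exec (W : ℕ) : Prog → RamState → ℕ → RamState → Prop where
  | skip (s) : Exec W .skip s 1 s
  | instr (i : Instr) (s) (h : i.value s ≤ W) : Exec W (.instr i) s 1 (i.run s)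
  | seq {p₁ p₂ s s₁ s₂ t₁ t₂} (h₁ : Exec W p₁ s t₁ s₁) (h₂ : Exec W p₂ s₁ t₂ s₂) :
      Exec W (.seq p₁ p₂) s (t₁ + t₂) s₂
  | ite_true {a p₁ p₂ s s' t} (ha : s.reg a ≠ 0) (h : Exec W p₁ s t s') :
      Exec W (.ite a p₁ p₂) s (t + 1) s'
  | ite_false {a p₁ p₂ s s' t} (ha : s.reg a = 0) (h : Exec W p₂ s t s') :
      Exec W (.ite a p₁ p₂) s (t + 1) s'
  | loop_stop {a p s} (ha : s.reg a = 0) : Exec W (.loop a p) s 1 s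
  | loop_step {a p s s₁ s₂ t₁ t₂} (ha : s.reg a ≠ 0) (h₁ : Exec W p s t₁ s₁)
      (h₂ : Exec W (.loop a p) s₁ t₂ s₂) : Exec W (.loop a p) s (t₁ + t₂ + 1) s₂

/-- The initial configuration: the input in the memory cells `0, 1, 2, …`, everything else `0`. -/
def RamState.init (input : List ℕ) : RamState where
  reg := fun _ => 0
  mem := fun i => input.getD i 0
  out := []

/-- The magnitude of an input: its length plus its largest entry. -/
def inputMagnitude (input : List ℕ) : ℕ := input.length + input.foldr max 0

/-- On `input`, the program `p` halts within `c * (m + 1)` steps with an output satisfying `good`,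
using only words of logarithmic length, that is, numbers that are polynomial in the magnitude of
the input. -/
def Prog.Runs (p : Prog) (c m : ℕ) (input : List ℕ) (good : List ℕ → Prop) : Prop :=
  ∃ t s, Exec (c * (inputMagnitude input + 1) ^ c) p (RamState.init input) t s ∧
    t ≤ c * (m + 1) ∧ good s.out

/-! ## The sparse hyperclique conjecture -/

/-- `input` lists the hypergraph on the nodes `0, …, n - 1` with set of hyperedges `E`: the number
of nodes, the number of hyperedges, then the hyperedges in some order, each as a list of its nodes
in some order. -/
def EncodesHypergraph {n : ℕ} (E : Finset (Finset (Fin n))) (input : List ℕ) : Prop :=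
  ∃ es : List (List (Fin n)),
    (∀ e ∈ es, e.Nodup) ∧ (es.map List.toFinset).Nodup ∧
    (∀ e, e ∈ es.map List.toFinset ↔ e ∈ E) ∧
    input = n :: es.length :: es.flatten.map Fin.val

/-- There are `k` nodes such that any `k - 1` of them form a hyperedge. -/
def HasHyperclique {n : ℕ} (k : ℕ) (E : Finset (Finset (Fin n))) : Prop :=
  ∃ S : Finset (Fin n), S.card = k ∧ ∀ e ⊆ S, e.card = k - 1 → e ∈ E

/-- The existence of a `k`-hyperclique in a `(k - 1)`-uniform hypergraph with `m` hyperedges can be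
decided in time `O(m)`. -/
def HypercliqueInLinearTime (k : ℕ) : Prop :=
  ∃ (p : Prog) (c : ℕ), ∀ (n : ℕ) (E : Finset (Finset (Fin n))), (∀ e ∈ E, e.card = k - 1) →
    ∀ input, EncodesHypergraph E input →
      p.Runs c E.card input fun o =>
        (HasHyperclique k E ∧ o = [1]) ∨ (¬ HasHyperclique k E ∧ o = [0])

/-- The sHyperclique conjecture. -/
def SHyperclique : Prop := ∀ k, 3 ≤ k → ¬ HypercliqueInLinearTime k

/-! ## Databases and conjunctive queries -/

/-- A finite relational schema. -/
structure Schema where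
  numRels : ℕ
  arity : Fin numRels → ℕ

/-- A database over `σ`, with domain `{0, …, dom - 1}`. -/
structure Database (σ : Schema) where
  dom : ℕ
  rel : (R : Fin σ.numRels) → Finset (Fin (σ.arity R) → Fin dom)

/-- The size of a database: the number of its facts. -/
def Database.size {σ : Schema} (D : Database σ) : ℕ := ∑ R, (D.rel R).card

/-- `l` lists the relation `S`: the number of tuples, then the tuples in some order, each once. -/
def EncodesRelation {n r : ℕ} (S : Set (Fin r → Fin n)) (l : List ℕ) : Prop :=
  ∃ ts : List (Fin r → Fin n), ts.Nodup ∧ (∀ a, a ∈ ts ↔ a ∈ S) ∧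
    l = ts.length :: ts.flatMap fun a => List.ofFn fun i => (a i : ℕ)

/-- `input` lists the database: the size of the domain, then the relations one after another. -/
def Database.Encodes {σ : Schema} (D : Database σ) (input : List ℕ) : Prop :=
  ∃ f : Fin σ.numRels → List ℕ, (∀ R, EncodesRelation {a | a ∈ D.rel R} (f R)) ∧
    input = D.dom :: (List.ofFn f).flatten

/-- An atom `R(x₁, …, xᵣ)` with variables from `V`. -/
abbrev Atom (σ : Schema) (V : Type*) := (R : Fin σ.numRels) × (Fin (σ.arity R) → V)

/-- Apply a map of variables to an atom. -/
def Atom.map {σ : Schema} {V W : Type*} (f : V → W) (a : Atom σ V) : Atom σ W := ⟨a.1, f ∘ a.2⟩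

/-- A conjunctive query: a non-empty finite conjunction of atoms in which exactly the variables in
`V` occur, with a tuple of pairwise distinct free variables; the other variables are existentially
quantified. The same relation symbol may occur in several atoms. -/
structure ConjunctiveQuery (σ : Schema) (V : Type*) where
  atoms : Finset (Atom σ V)
  atoms_nonempty : atoms.Nonempty
  occurs : ∀ x, ∃ a ∈ atoms, x ∈ Set.range a.2
  arity : ℕ
  free : Fin arity → V
  free_injective : Function.Injective free

namespace ConjunctiveQuery

variable {σ : Schema} {V : Type*}

/-- The set `q(D)` of solutions. -/
def solutions (q : ConjunctiveQuery σ V) (D : Database σ) : Set (Fin q.arity → Fin D.dom) :=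
  {b | ∃ μ : V → Fin D.dom, (∀ a ∈ q.atoms, μ ∘ a.2 ∈ D.rel a.1) ∧ b = μ ∘ q.free}

/-- Endomorphisms: maps of the variables that preserve the atoms. -/
def IsEndomorphism (q : ConjunctiveQuery σ V) (ν : V → V) : Prop :=
  ∀ a ∈ q.atoms, Atom.map ν a ∈ q.atoms

/-- Every endomorphism that is the identity on the free variables is injective. -/
def IsMinimal (q : ConjunctiveQuery σ V) : Prop :=
  ∀ ν : V → V, q.IsEndomorphism ν → (∀ i, ν (q.free i) = q.free i) → Function.Injective ν

/-- `q` has a join tree: a tree on the atoms of `q` such that, for each variable, the atoms that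
contain it are connected in the tree. -/
def IsAcyclic (q : ConjunctiveQuery σ V) : Prop :=
  ∃ T : SimpleGraph {a // a ∈ q.atoms}, T.IsTree ∧
    ∀ x : V, (T.induce {a | x ∈ Set.range a.1.2}).Connected

/-- The evaluation problem of `q` (data complexity): some program computes, from any listing of any
database `D`, a listing of `q(D)` in time linear in the size of `D`. -/
def EvaluableInLinearTime (q : ConjunctiveQuery σ V) : Prop :=
  ∃ (p : Prog) (c : ℕ), ∀ (D : Database σ) (input : List ℕ), D.Encodes input →
    p.Runs c D.size input (EncodesRelation (q.solutions D))

end ConjunctiveQuery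

/-! Upper bound. The algorithm is Yannakakis' bottom-up evaluation. Since there is at most one free
variable, some atom contains all free variables, and the join tree is rooted there. A tuple of an
atom extends to the subtree below it if and only if, for each child, its projection to the variables
shared with that child is the projection of a tuple of the child that extends to the child's subtree
(`Plan.codes_eq`). These projections are coded as numbers and marked in memory that is initially
zero, so a lookup takes constant time and one scan per atom suffices. Extensions chosen
independently in different subtrees fit together because the tree is a join tree
(`Plan.Good.exists_forall_sat`); hence the marks of the root are exactly the solutions.

Lower bound, combinatorial part. A cyclic query carries an obstruction, a role map with `k ≥ 3`
roles. If there is none, then every clique of pairwise co-occurring variables lies in one atom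
(`exists_superset_of_clique`: a smallest uncovered clique would be an obstruction with one variable
per role), and every set of variables has a simplicial member (`exists_simplicial`: where Dirac's
argument for chordal graphs fails, there is an obstruction with three roles). Eliminating simplicial
variables one at a time then yields a join tree (`hasJoinTree_of_not_hasRoleMap`).

Lower bound, reduction. Given a role map, the search for a `k`-hyperclique becomes a query
evaluation. Domain elements are pairs of a variable, the tag, and a node. Every atom and every
hyperedge contribute boundedly many facts, in which variables of one role get the same node of the
hyperedge and different roles get different nodes. A hyperclique gives a solution since every atom
misses a role. Conversely, connectedness of the roles makes the node of a variable depend on its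
role only, and since any `k - 1` roles meet in an atom, the `k` nodes form a hyperclique. Self-joins
are handled by minimality: the tags of a solution define an endomorphism, which is an automorphism
once it fixes the free variables, and composing with its inverse makes all tags correct
(`RoleData.exists_assignment_of_tagged`). The database has linear size, so in linear time it can be
written, the assumed program run on it inside a region of the memory, and the output searched for a
solution with the right tags.

Both algorithms are written in a small language with expressions, whose compilation (`Steps.exec`)
costs a constant factor in time and a polynomial in the word size. -/

/-! ## Join trees -/

section JoinTree

variable {ι V : Type*}

/-- A tree on the hyperedges such that, for each vertex in `W`, the hyperedges that contain it are
connected. -/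
def HasJoinTree (vars : ι → Set V) (W : Set V) : Prop :=
  ∃ T : SimpleGraph ι, T.IsTree ∧ ∀ x ∈ W, (T.induce {a | x ∈ vars a}).Preconnected

/-- A join tree with root `r`, given by a parent map and an ordering in which parents come first. -/
structure IsRooted (vars : ι → Set V) (W : Set V) (r : ι) (rank : ι → ℕ) (p : ι → ι) : Prop where
  inj : Function.Injective rank
  lt : ∀ a, a ≠ r → rank (p a) < rank a
  inter : ∀ a, a ≠ r → ∀ b, rank b < rank a → ∀ x ∈ W, x ∈ vars a → x ∈ vars b → x ∈ vars (p a)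

theorem IsRooted.root_le {vars : ι → Set V} {W : Set V} {r : ι} {rank : ι → ℕ} {p : ι → ι}
    (h : IsRooted vars W r rank p) (a : ι) : rank r ≤ rank a := by
  induction hn : rank a using Nat.strong_induction_on generalizing a with
  | _ n ih =>
    by_cases ha : a = r
    · subst ha; omega
    · have := ih _ (hn ▸ h.lt a ha) (p a) rfl
      have := h.lt a ha
      omega

/-- Parents are neighbours closer to `r`, and the rank orders by distance, with ties broken by a
numbering. If `x` occurred in `a` and in an earlier `b` but not in `p a`, the atoms containing `x`
would connect `a` to `b` without the edge between `a` and `p a`, although this edge is a bridge. -/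
theorem HasJoinTree.exists_isRooted [Finite ι] {vars : ι → Set V} {W : Set V}
    (h : HasJoinTree vars W) (r : ι) : ∃ rank p, IsRooted vars W r rank p := by
  classical
  obtain ⟨T, hT, hW⟩ := h
  have hpar : ∀ a, ∃ b, a ≠ r → T.Adj a b ∧ T.dist b r < T.dist a r := by
    intro a
    by_cases ha : a = r
    · exact ⟨a, fun h => absurd ha h⟩
    obtain ⟨w, hw⟩ := (hT.1.preconnected a r).exists_walk_length_eq_dist
    cases w with
    | nil => exact absurd rfl ha
    | @cons _ b _ hab w =>
      refine ⟨b, fun _ => ⟨hab, ?_⟩⟩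
      have := SimpleGraph.dist_le w
      simp only [SimpleGraph.Walk.length_cons] at hw
      omega
  choose p hp using hpar
  obtain ⟨N, ⟨e⟩⟩ := Finite.exists_equiv_fin ι
  -- The number `T.dist a r * N + e a` encodes a lexicographic pair, as `e a < N`.
  have hdist : ∀ a b, T.dist a r * N + e a < T.dist b r * N + e b → T.dist a r ≤ T.dist b r := by
    intro a b hlt
    by_contra! hcon
    have h1 : (T.dist b r + 1) * N ≤ T.dist a r * N := Nat.mul_le_mul_right _ hcon
    have := (e b).2
    rw [add_mul, one_mul] at h1
    omega
  refine ⟨fun a => T.dist a r * N + e a, p, ⟨?_, ?_, ?_⟩⟩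
  · intro a b hab
    simp only at hab
    have ha := (e a).2
    have hb := (e b).2
    have : (e a : ℕ) = e b := by
      have := congrArg (· % N) hab
      simpa [Nat.mul_add_mod', Nat.mod_eq_of_lt ha, Nat.mod_eq_of_lt hb] using this
    exact e.injective (Fin.ext this)
  · intro a ha
    have h1 : (T.dist (p a) r + 1) * N ≤ T.dist a r * N := Nat.mul_le_mul_right _ (hp a ha).2
    have := (e (p a)).2
    simp only [add_mul, one_mul] at h1 ⊢
    omega
  · intro a ha b hb x hx hxa hxb
    have hba : b ≠ a := by rintro rfl; exact lt_irrefl _ hb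
    have hd := hdist b a hb
    by_contra hxp
    set G := T.deleteEdges {s(a, p a)} with hG
    -- Following parents from a vertex other than `a` that is no further from `r` than `a` never
    -- meets `a`, so the path avoids the deleted edge.
    have hreach : ∀ n b, T.dist b r = n → b ≠ a → T.dist b r ≤ T.dist a r → G.Reachable b r := by
      intro n
      induction n using Nat.strong_induction_on with
      | _ n ih =>
        intro b hn hba hd
        by_cases hbr : b = r
        · subst hbr; exact .rfl
        obtain ⟨hadj, hlt⟩ := hp b hbr
        have hpa : p b ≠ a := by rintro h; rw [h] at hlt; omega
        have hstep : G.Adj b (p b) := by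
          rw [hG, SimpleGraph.deleteEdges_adj]
          refine ⟨hadj, ?_⟩
          rw [Set.mem_singleton_iff, Sym2.eq_iff]
          rintro (⟨h, -⟩ | ⟨-, h⟩)
          · exact hba h
          · exact hpa h
        exact hstep.reachable.trans (ih _ (hn ▸ hlt) _ rfl hpa (by omega))
    let f : T.induce {a | x ∈ vars a} →g G :=
      { toFun := Subtype.val
        map_rel' := by
          rintro ⟨u, hu⟩ ⟨v, hv⟩ huv
          rw [hG, SimpleGraph.deleteEdges_adj]
          refine ⟨huv, ?_⟩
          rw [Set.mem_singleton_iff, Sym2.eq_iff]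
          rintro (⟨-, h⟩ | ⟨h, -⟩)
          · exact hxp (h ▸ hv)
          · exact hxp (h ▸ hu) }
    have hab : G.Reachable a b := (hW x hx ⟨a, hxa⟩ ⟨b, hxb⟩).map f
    have h1 := hreach _ b rfl hba hd
    have hpa : p a ≠ a := (hp a ha).1.ne'
    have h2 := hreach _ (p a) rfl hpa (hp a ha).2.le
    have := SimpleGraph.isAcyclic_iff_forall_adj_isBridge.1 hT.2 (hp a ha).1
    exact SimpleGraph.isBridge_iff.1 this ((hab.trans h1).trans h2.symm)

/-- The edges join each atom to its parent. The graph is connected and has at most one edge per atom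
other than the root, so it is a tree. For connectedness at `x`, parents lead from any atom
containing `x` to the one of least rank, without leaving the atoms that contain `x`. -/
theorem IsRooted.hasJoinTree [Finite ι] {vars : ι → Set V} {W : Set V} {r : ι} {rank : ι → ℕ}
    {p : ι → ι} (h : IsRooted vars W r rank p) : HasJoinTree vars W := by
  classical
  have := Fintype.ofFinite ι
  let T : SimpleGraph ι := SimpleGraph.fromRel fun a b => a ≠ r ∧ p a = b
  have hpne : ∀ a, a ≠ r → a ≠ p a := fun a ha he => by have := h.lt a ha; rw [← he] at this; omega
  have hadj : ∀ a, a ≠ r → T.Adj a (p a) := fun a ha => by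
    rw [SimpleGraph.fromRel_adj]
    exact ⟨hpne a ha, .inl ⟨ha, rfl⟩⟩
  have hconn : T.Connected := by
    have : Nonempty ι := ⟨r⟩
    have key : ∀ n a, rank a = n → T.Reachable a r := by
      intro n
      induction n using Nat.strong_induction_on with
      | _ n ih =>
        intro a hn
        by_cases ha : a = r
        · subst ha; exact .rfl
        · exact (hadj a ha).reachable.trans (ih _ (hn ▸ h.lt a ha) _ rfl)
    exact ⟨fun a b => (key _ a rfl).trans (key _ b rfl).symm⟩
  refine ⟨T, ?_, ?_⟩
  · rw [SimpleGraph.isTree_iff_connected_and_card]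
    refine ⟨hconn, le_antisymm ?_ hconn.card_vert_le_card_edgeSet_add_one⟩
    have hsub : T.edgeSet ⊆ ((Finset.univ.erase r).image fun a => s(a, p a) : Finset (Sym2 ι)) := by
      intro e
      induction e using Sym2.ind with
      | _ a b =>
        rw [SimpleGraph.mem_edgeSet, SimpleGraph.fromRel_adj]
        simp only [Finset.coe_image, Set.mem_image, Finset.mem_coe, Finset.mem_erase,
          Finset.mem_univ, and_true]
        rintro ⟨-, ⟨ha, rfl⟩ | ⟨hb, rfl⟩⟩
        · exact ⟨a, ha, rfl⟩
        · exact ⟨b, hb, Sym2.eq_swap⟩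
    have h1 := Set.ncard_le_ncard hsub (Finset.finite_toSet _)
    rw [Set.ncard_coe_finset] at h1
    have h2 := h1.trans Finset.card_image_le
    rw [Finset.card_erase_of_mem (Finset.mem_univ r), Finset.card_univ] at h2
    have h3 : 0 < Fintype.card ι := Fintype.card_pos_iff.2 ⟨r⟩
    rw [Nat.card_coe_set_eq, Nat.card_eq_fintype_card]
    omega
  · intro x hx
    rintro ⟨a, ha⟩ ⟨b, hb⟩
    have hne : ({a | x ∈ vars a} : Set ι).Nonempty := ⟨a, ha⟩
    obtain ⟨c, hc, hmin⟩ := Set.exists_min_image _ rank (Set.toFinite _) hne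
    have key : ∀ n a (ha : x ∈ vars a), rank a = n →
        (T.induce {a | x ∈ vars a}).Reachable ⟨a, ha⟩ ⟨c, hc⟩ := by
      intro n
      induction n using Nat.strong_induction_on with
      | _ n ih =>
        intro a ha hn
        by_cases hac : a = c
        · subst hac; exact .rfl
        have hlt : rank c < rank a := lt_of_le_of_ne (hmin a ha) fun he => hac (h.inj he).symm
        have har : a ≠ r := by rintro rfl; exact absurd (h.root_le c) (by omega)
        have hpa := h.inter a har c hlt x hx ha hc
        have hstep : (T.induce {a | x ∈ vars a}).Adj ⟨a, ha⟩ ⟨p a, hpa⟩ := hadj a har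
        exact hstep.reachable.trans (ih _ (hn ▸ h.lt a har) _ hpa rfl)
    exact (key _ a ha rfl).trans (key _ b hb rfl).symm

theorem hasJoinTree_empty [Finite ι] [Nonempty ι] (vars : ι → Set V) : HasJoinTree vars ∅ := by
  classical
  obtain ⟨N, ⟨e⟩⟩ := Finite.exists_equiv_fin ι
  obtain ⟨r⟩ := ‹Nonempty ι›
  refine IsRooted.hasJoinTree (r := r) (rank := fun a => if a = r then 0 else e a + 1)
    (p := fun _ => r) ⟨?_, ?_, ?_⟩
  · intro a b
    simp only
    split_ifs with ha hb hb
    · intro; rw [ha, hb]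
    · simp
    · simp
    · intro h; exact e.injective (Fin.ext (by omega))
  · intro a ha; simp [ha]
  · intro a _ b _ x hx; exact absurd hx (Set.notMem_empty x)

/-- With the tree rooted at `e`, all atoms containing `x` can be hung directly below `e`, since `e`
contains everything in `W` that they contain. -/
theorem HasJoinTree.insert [Finite ι] {vars : ι → Set V} {W : Set V} (h : HasJoinTree vars W)
    (x : V) (e : ι) (hxe : x ∈ vars e)
    (he : ∀ a, x ∈ vars a → ∀ y ∈ W, y ∈ vars a → y ∈ vars e) :
    HasJoinTree vars (insert x W) := by
  classical
  have := Fintype.ofFinite ι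
  obtain ⟨rank, p, hr⟩ := h.exists_isRooted e
  set M := (∑ a, rank a) + 1 with hM
  have hlt : ∀ a, rank a < M := fun a =>
    Nat.lt_succ_of_le (Finset.single_le_sum (f := rank) (fun _ _ => Nat.zero_le _)
      (Finset.mem_univ a))
  -- The shift by `M` moves the atoms containing `x`, except `e`, to the end of the order. An atom
  -- whose old parent contains `x` is also hung below `e`: its parent may now come later, and `e`
  -- contains all that the parent contributes from `W`.
  refine IsRooted.hasJoinTree (r := e)
    (rank := fun a => if x ∈ vars a ∧ a ≠ e then M + rank a else rank a)
    (p := fun a => if x ∈ vars a ∨ x ∈ vars (p a) then e else p a) ⟨?_, ?_, ?_⟩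
  · intro a b hab
    have ha := hlt a
    have hb := hlt b
    apply hr.inj
    beta_reduce at hab
    split_ifs at hab <;> omega
  · intro a ha
    have h1 := hr.root_le a
    have h2 : rank e ≠ rank a := fun h => ha (hr.inj h).symm
    have h3 := hr.lt a ha
    have ha' := hlt a
    split_ifs <;> first | omega | simp_all
  · intro a ha b hb y hy hya hyb
    beta_reduce at hb
    by_cases hxa : x ∈ vars a
    · rw [if_pos (.inl hxa)]
      rcases hy with rfl | hy
      · exact hxe
      · exact he a hxa y hy hya
    · rw [if_neg (c := x ∈ vars a ∧ a ≠ e) (by tauto)] at hb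
      have hb' : rank b < rank a := by
        split_ifs at hb
        · have := hlt a; omega
        · exact hb
      have hyW : y ∈ W := by
        rcases hy with rfl | hy
        · exact absurd hya hxa
        · exact hy
      have hyp := hr.inter a ha b hb' y hyW hya hyb
      split_ifs with hc
      · exact he (p a) (hc.resolve_left hxa) y hyW hyp
      · exact hyp

/-! ## Obstructions to acyclicity -/

/-- A partial map from the vertices to `k` roles: no hyperedge sees all roles, for each role some
hyperedge sees all others, and vertices of the same role are connected through vertices of that
role. -/
structure IsRoleMap (vars : ι → Set V) (k : ℕ) (ρ : V → Option (Fin k)) : Prop where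
  miss : ∀ a, ∃ i, ∀ x ∈ vars a, ρ x ≠ some i
  cover : ∀ i, ∃ a, ∀ j, j ≠ i → ∃ x ∈ vars a, ρ x = some j
  connected : ∀ f : V → ℕ,
    (∀ a, ∀ x ∈ vars a, ∀ y ∈ vars a, ∀ i, ρ x = some i → ρ y = some i → f x = f y) →
    ∀ x y i, ρ x = some i → ρ y = some i → f x = f y

def HasRoleMap (vars : ι → Set V) : Prop := ∃ k, 3 ≤ k ∧ ∃ ρ, IsRoleMap vars k ρ

/-- Two vertices occur together in a hyperedge. -/
def CoOccur (vars : ι → Set V) (x y : V) : Prop := ∃ a, x ∈ vars a ∧ y ∈ vars a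

theorem CoOccur.symm {vars : ι → Set V} {x y : V} (h : CoOccur vars x y) : CoOccur vars y x :=
  h.imp fun _ h => h.symm

/-- In a smallest counterexample `K` every proper subset is covered, and `K` has at least three
elements because a single vertex or a co-occurring pair is covered. Giving each vertex of `K` its
own role is then a role map. -/
theorem exists_superset_of_clique [Nonempty ι] {vars : ι → Set V} (hR : ¬ HasRoleMap vars)
    (K : Finset V) (hK : ∀ x ∈ K, ∀ y ∈ K, CoOccur vars x y) : ∃ a, (K : Set V) ⊆ vars a := by
  classical
  induction hn : K.card using Nat.strong_induction_on generalizing K with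
  | _ n ih =>
    by_contra hcon
    have hsub : ∀ x ∈ K, ∃ a, ∀ y ∈ K, y ≠ x → y ∈ vars a := by
      intro x hx
      obtain ⟨a, ha⟩ := ih (K.erase x).card (hn ▸ Finset.card_erase_lt_of_mem hx) (K.erase x)
        (fun y hy z hz => hK y (Finset.mem_of_mem_erase hy) z (Finset.mem_of_mem_erase hz)) rfl
      exact ⟨a, fun y hy hyx => ha (by simp [hy, hyx])⟩
    have hcard : 3 ≤ K.card := by
      by_contra! hlt
      have : K.card = 0 ∨ K.card = 1 ∨ K.card = 2 := by omega
      rcases this with h | h | h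
      · rw [Finset.card_eq_zero] at h
        exact hcon ⟨Classical.arbitrary ι, by simp [h]⟩
      · obtain ⟨x, rfl⟩ := Finset.card_eq_one.1 h
        obtain ⟨a, ha, -⟩ := hK x (by simp) x (by simp)
        exact hcon ⟨a, by simpa using ha⟩
      · obtain ⟨x, y, -, rfl⟩ := Finset.card_eq_two.1 h
        obtain ⟨a, ha, ha'⟩ := hK x (by simp) y (by simp)
        exact hcon ⟨a, by simp [Set.insert_subset_iff, ha, ha']⟩
    refine hR ⟨K.card, hcard, fun x => if h : x ∈ K then some (K.equivFin ⟨x, h⟩) else none, ?_⟩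
    have hinj : ∀ x y i, (if h : x ∈ K then some (K.equivFin ⟨x, h⟩) else none) = some i →
        (if h : y ∈ K then some (K.equivFin ⟨y, h⟩) else none) = some i → x = y := by
      intro x y i hx hy
      split_ifs at hx hy with h1 h2
      rw [← hy, Option.some.injEq, K.equivFin.apply_eq_iff_eq] at hx
      exact congrArg Subtype.val hx
    refine ⟨?_, ?_, ?_⟩
    · intro a
      by_contra! hall
      refine hcon ⟨a, fun x hx => ?_⟩
      obtain ⟨y, hy, he⟩ := hall (K.equivFin ⟨x, hx⟩)
      have : x = y := hinj x y _ (by simp only [Finset.mem_coe] at hx; simp [hx]) he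
      exact this ▸ hy
    · intro i
      obtain ⟨a, ha⟩ := hsub (K.equivFin.symm i) (K.equivFin.symm i).2
      refine ⟨a, fun j hj => ⟨K.equivFin.symm j, ha _ (K.equivFin.symm j).2 ?_, ?_⟩⟩
      · intro h
        exact hj (K.equivFin.symm.injective (Subtype.ext h))
      · simp
    · intro f _ x y i hx hy
      rw [hinj x y i hx hy]

/-- Every nonempty set of vertices has a simplicial vertex. -/
theorem exists_simplicial {vars : ι → Set V} (hR : ¬ HasRoleMap vars)
    (hocc : ∀ x, ∃ a, x ∈ vars a) (W : Finset V)
    (hW : W.Nonempty) : ∃ v ∈ W, ∀ x ∈ W, ∀ y ∈ W, CoOccur vars v x → CoOccur vars v y →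
      CoOccur vars x y := by
  classical
  induction hn : W.card using Nat.strong_induction_on generalizing W with
  | _ n ih =>
    have hrefl : ∀ x, CoOccur vars x x := fun x => (hocc x).imp fun _ h => ⟨h, h⟩
    -- Connectedness is expressed by labellings: one that is constant along co-occurrence is
    -- constant. The field `connected` of a role map has the same form.
    let Conn : Finset V → Prop := fun C => ∀ f : V → ℕ,
      (∀ x ∈ C, ∀ y ∈ C, CoOccur vars x y → f x = f y) → ∀ x ∈ C, ∀ y ∈ C, f x = f y
    let far : Finset V → Finset V := fun C => W.filter fun b => ∀ c ∈ C, ¬ CoOccur vars b c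
    let S := W.powerset.filter fun C => C.Nonempty ∧ Conn C ∧ (far C).Nonempty
    -- Dirac's argument: take a largest connected `C` that leaves some vertex of `W` without
    -- neighbours in `C`, and use a simplicial vertex `v` of the set `far C` of those vertices. A
    -- neighbour of `v` in `W` lies in `far C` or in the boundary of `C`.
    by_cases hS : S.Nonempty
    · obtain ⟨C, hC, hmax⟩ := Finset.exists_max_image S Finset.card hS
      simp only [S, Finset.mem_filter, Finset.mem_powerset] at hC hmax
      obtain ⟨hCW, hCne, hCc, hfar⟩ := hC
      have hcard : (far C).card < n := by
        rw [← hn]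
        refine Finset.card_lt_card ((Finset.filter_subset _ _).ssubset_of_ne fun he => ?_)
        obtain ⟨c, hc⟩ := hCne
        have : c ∈ far C := by simp only [far]; rw [he]; exact hCW hc
        exact (Finset.mem_filter.1 this).2 c hc (hrefl c)
      obtain ⟨v, hv, hsimp⟩ := ih _ hcard (far C) hfar rfl
      have hdich : ∀ x ∈ W, CoOccur vars v x → x ∈ far C ∨ (x ∉ C ∧ ∃ c ∈ C, CoOccur vars x c) := by
        intro x hx hvx
        by_cases h : x ∈ far C
        · exact .inl h
        · simp only [far, Finset.mem_filter, hx, true_and, not_forall, not_not] at h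
          obtain ⟨c, hc, hxc⟩ := h
          exact .inr ⟨fun hxC => (Finset.mem_filter.1 hv).2 x hxC hvx, c, hc, hxc⟩
      -- By maximality of `C`: adding a boundary vertex `s` that misses some `b` in `far C` would
      -- keep `b` far.
      have hfull : ∀ s ∈ W, s ∉ C → (∃ c ∈ C, CoOccur vars s c) → ∀ b ∈ far C,
          CoOccur vars s b := by
        rintro s hs hsC ⟨c, hc, hsc⟩ b hb
        by_contra hsb
        have := hmax (insert s C) ⟨Finset.insert_subset hs hCW, Finset.insert_nonempty _ _, ?_, ?_⟩
        · rw [Finset.card_insert_of_notMem hsC] at this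
          omega
        · intro f hf
          have hfC := hCc f fun x hx y hy => hf x (Finset.mem_insert_of_mem hx) y
            (Finset.mem_insert_of_mem hy)
          have key : ∀ x ∈ insert s C, f x = f c := by
            intro x hx
            rcases Finset.mem_insert.1 hx with rfl | hx
            · exact hf _ (Finset.mem_insert_self _ _) _ (Finset.mem_insert_of_mem hc) hsc
            · exact hfC x hx c hc
          intro x hx y hy
          rw [key x hx, key y hy]
        · refine ⟨b, Finset.mem_filter.2 ⟨(Finset.mem_filter.1 hb).1, fun c hc => ?_⟩⟩
          rcases Finset.mem_insert.1 hc with rfl | hc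
          · exact fun h => hsb h.symm
          · exact (Finset.mem_filter.1 hb).2 c hc
      -- If two boundary vertices `s` and `t` did not co-occur, the roles `{s}`, `C` and `{t, v}`
      -- would form an obstruction: `s` misses `t` and `v` misses `C`, while any two of the roles
      -- meet in a hyperedge.
      have hclique : ∀ s ∈ W, s ∉ C → (∃ c ∈ C, CoOccur vars s c) → ∀ t ∈ W, t ∉ C →
          (∃ c ∈ C, CoOccur vars t c) → CoOccur vars s t := by
        intro s hs hsC hsc t ht htC htc
        by_contra hst
        have hsb := hfull s hs hsC hsc v hv
        have htb := hfull t ht htC htc v hv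
        have hvC : v ∉ C := fun h => (Finset.mem_filter.1 hv).2 v h (hrefl v)
        have hvfar := (Finset.mem_filter.1 hv).2
        have hne : s ≠ t := by rintro rfl; exact hst (hrefl s)
        have hsv : s ≠ v := by
          rintro rfl
          obtain ⟨c, hc, h⟩ := hsc
          exact hvfar c hc h
        have htv : t ≠ v := by
          rintro rfl
          obtain ⟨c, hc, h⟩ := htc
          exact hvfar c hc h
        let ρ : V → Option (Fin 3) := fun x =>
          if x = s then some 0 else if x ∈ C then some 1 else if x = t ∨ x = v then some 2 else none
        have h0 : ∀ x, ρ x = some 0 ↔ x = s := by intro x; simp only [ρ]; split_ifs <;> simp_all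
        have h1 : ∀ x, ρ x = some 1 ↔ x ∈ C := by
          intro x; simp only [ρ]; split_ifs <;> simp_all
        have h2 : ∀ x, ρ x = some 2 ↔ x = t ∨ x = v := by
          intro x
          simp only [ρ]
          split_ifs with ha hb hc
          · subst ha; simp [hne, hsv]
          · simp only [Option.some.injEq, Fin.reduceEq, false_iff]
            rintro (rfl | rfl)
            · exact htC hb
            · exact hvC hb
          · simp [hc]
          · simp [hc]
        refine hR ⟨3, le_rfl, ρ, ?_, ?_, ?_⟩
        · intro a
          by_contra! hall
          obtain ⟨x, hx, hx0⟩ := hall 0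
          obtain ⟨y, hy, hy1⟩ := hall 1
          obtain ⟨z, hz, hz2⟩ := hall 2
          rw [h0] at hx0
          rw [h1] at hy1
          rw [h2] at hz2
          subst hx0
          rcases hz2 with rfl | rfl
          · exact hst ⟨a, hx, hz⟩
          · exact hvfar y hy1 ⟨a, hz, hy⟩
        · intro i
          obtain ⟨c, hc, a, hsa, hca⟩ := hsc
          obtain ⟨d, hd, b, htb', hdb⟩ := htc
          obtain ⟨e, hse, hve⟩ := hsb
          fin_cases i
          · refine ⟨b, fun j hj => ?_⟩
            fin_cases j
            · exact absurd rfl hj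
            · exact ⟨d, hdb, (h1 d).2 hd⟩
            · exact ⟨t, htb', (h2 t).2 (.inl rfl)⟩
          · refine ⟨e, fun j hj => ?_⟩
            fin_cases j
            · exact ⟨s, hse, (h0 s).2 rfl⟩
            · exact absurd rfl hj
            · exact ⟨v, hve, (h2 v).2 (.inr rfl)⟩
          · refine ⟨a, fun j hj => ?_⟩
            fin_cases j
            · exact ⟨s, hsa, (h0 s).2 rfl⟩
            · exact ⟨c, hca, (h1 c).2 hc⟩
            · exact absurd rfl hj
        · intro f hf x y i hx hy
          fin_cases i
          · rw [(h0 x).1 hx, (h0 y).1 hy]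
          · refine hCc f (fun x hx y hy ⟨a, hxa, hya⟩ => ?_) x ((h1 x).1 hx) y ((h1 y).1 hy)
            exact hf a x hxa y hya 1 ((h1 x).2 hx) ((h1 y).2 hy)
          · obtain ⟨a, hta, hva⟩ := htb
            have htv' : f t = f v := hf a t hta v hva 2 ((h2 t).2 (.inl rfl)) ((h2 v).2 (.inr rfl))
            rcases (h2 x).1 hx with rfl | rfl <;> rcases (h2 y).1 hy with rfl | rfl <;> simp [htv']
      refine ⟨v, (Finset.mem_filter.1 hv).1, fun x hx y hy hvx hvy => ?_⟩
      rcases hdich x hx hvx with hx' | ⟨hxC, hx'⟩ <;> rcases hdich y hy hvy with hy' | ⟨hyC, hy'⟩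
      · exact hsimp x hx' y hy' hvx hvy
      · exact (hfull y hy hyC hy' x hx').symm
      · exact hfull x hx hxC hx' y hy'
      · exact hclique x hx hxC hx' y hy hyC hy'
    -- Otherwise `W` is a clique, since for a pair that does not co-occur a singleton would belong
    -- to `S`; then every vertex is simplicial.
    · obtain ⟨v, hv⟩ := hW
      refine ⟨v, hv, fun x hx y hy _ _ => ?_⟩
      by_contra hxy
      refine hS ⟨{x}, ?_⟩
      simp only [S, Finset.mem_filter, Finset.mem_powerset, Finset.singleton_subset_iff]
      refine ⟨hx, Finset.singleton_nonempty x, ?_, y, ?_⟩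
      · intro f _ a ha b hb
        rw [Finset.mem_singleton.1 ha, Finset.mem_singleton.1 hb]
      · simp only [far, Finset.mem_filter, Finset.mem_singleton, forall_eq]
        exact ⟨hy, fun h => hxy h.symm⟩

/-- A simplicial vertex `v` of `W` and its neighbours in `W` form a clique, hence lie in one
hyperedge `e`. A join tree for `W` without `v` then extends to `v` by regrouping around `e`. -/
theorem hasJoinTree_of_not_hasRoleMap [Finite ι] [Nonempty ι] {vars : ι → Set V}
    (hR : ¬ HasRoleMap vars) (hocc : ∀ x, ∃ a, x ∈ vars a) (W : Finset V) :
    HasJoinTree vars W := by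
  classical
  induction hn : W.card using Nat.strong_induction_on generalizing W with
  | _ n ih =>
    rcases W.eq_empty_or_nonempty with rfl | hne
    · simpa using hasJoinTree_empty vars
    obtain ⟨v, hv, hs⟩ := exists_simplicial hR hocc W hne
    obtain ⟨e, he⟩ := exists_superset_of_clique hR (W.filter fun x => CoOccur vars v x) (by
      intro x hx y hy
      rw [Finset.mem_filter] at hx hy
      exact hs x hx.1 y hy.1 hx.2 hy.2)
    have hW : (W : Set V) = insert v ((W.erase v : Finset V) : Set V) := by
      rw [← Finset.coe_insert, Finset.insert_erase hv]
    rw [hW]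
    refine (ih _ (hn ▸ Finset.card_erase_lt_of_mem hv) _ rfl).insert v e (he ?_) ?_
    · obtain ⟨a, ha⟩ := hocc v
      simpa [hv] using ⟨a, ha, ha⟩
    · intro a hva y hy hya
      refine he ?_
      simp only [Finset.coe_erase, Set.mem_sdiff, Finset.mem_coe] at hy
      simpa [hy.1] using ⟨a, hva, hya⟩

end JoinTree

/-! ### Acyclic queries and their hypergraphs -/

namespace ConjunctiveQuery

variable {σ : Schema} {V : Type*}

/-- Every variable occurs in an atom, so for the induced subgraphs being preconnected is the same as
being connected. -/
theorem isAcyclic_iff_hasJoinTree (q : ConjunctiveQuery σ V) :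
    q.IsAcyclic ↔ HasJoinTree (fun a : {a // a ∈ q.atoms} => Set.range a.1.2) Set.univ := by
  refine exists_congr fun T => and_congr_right fun _ => forall_congr' fun x => ?_
  refine ⟨fun h _ => h.preconnected, fun h => ?_⟩
  obtain ⟨a, ha, hx⟩ := q.occurs x
  exact { preconnected := h trivial, nonempty := ⟨⟨⟨a, ha⟩, hx⟩⟩ }

theorem hasRoleMap_of_not_isAcyclic [Finite V] (q : ConjunctiveQuery σ V) (h : ¬ q.IsAcyclic) :
    HasRoleMap fun a : {a // a ∈ q.atoms} => Set.range a.1.2 := by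
  by_contra hR
  have := Fintype.ofFinite V
  have : Nonempty {a // a ∈ q.atoms} := q.atoms_nonempty.to_subtype
  refine h (q.isAcyclic_iff_hasJoinTree.2 ?_)
  rw [← Finset.coe_univ]
  refine hasJoinTree_of_not_hasRoleMap hR (fun x => ?_) _
  obtain ⟨a, ha, hx⟩ := q.occurs x
  exact ⟨⟨a, ha⟩, hx⟩

end ConjunctiveQuery

/-! ## A small imperative language on top of random access machines -/

/-- Expressions over variables and memory. -/
inductive Expr where
  | const (n : ℕ)
  | var (x : ℕ)
  | add (e₁ e₂ : Expr)
  | sub (e₁ e₂ : Expr)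
  | mul (e₁ e₂ : Expr)
  | load (e : Expr)

namespace Expr

instance : Add Expr := ⟨.add⟩
instance : Sub Expr := ⟨.sub⟩
instance : Mul Expr := ⟨.mul⟩
instance (n : ℕ) : OfNat Expr n := ⟨.const n⟩

/-- The value of an expression; variables are read from the registers. -/
def eval (s : RamState) : Expr → ℕ
  | const n => n
  | var x => s.reg x
  | add e₁ e₂ => e₁.eval s + e₂.eval s
  | sub e₁ e₂ => e₁.eval s - e₂.eval s
  | mul e₁ e₂ => e₁.eval s * e₂.eval s
  | load e => s.mem (e.eval s)

variable (s : RamState) (e₁ e₂ : Expr)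

@[simp] theorem eval_const (n : ℕ) : (const n).eval s = n := rfl
@[simp] theorem eval_two : (2 : Expr).eval s = 2 := rfl
@[simp] theorem eval_zero : (0 : Expr).eval s = 0 := rfl
@[simp] theorem eval_one : (1 : Expr).eval s = 1 := rfl
@[simp] theorem eval_var (x : ℕ) : (var x).eval s = s.reg x := rfl
@[simp] theorem eval_add : (e₁ + e₂).eval s = e₁.eval s + e₂.eval s := rfl
@[simp] theorem eval_sub : (e₁ - e₂).eval s = e₁.eval s - e₂.eval s := rfl
@[simp] theorem eval_mul : (e₁ * e₂).eval s = e₁.eval s * e₂.eval s := rfl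
@[simp] theorem eval_load (e : Expr) : (load e).eval s = s.mem (e.eval s) := rfl

/-- The degree of a polynomial that bounds the value. -/
def deg : Expr → ℕ
  | const n => n
  | var _ => 1
  | add e₁ e₂ | sub e₁ e₂ | mul e₁ e₂ => e₁.deg + e₂.deg + 1
  | load e => e.deg + 1

/-- The number of instructions that compute the value. -/
def cost : Expr → ℕ
  | const _ => 1
  | var _ => 2
  | add e₁ e₂ | sub e₁ e₂ | mul e₁ e₂ => e₁.cost + e₂.cost + 1
  | load e => e.cost + 1

/-- Code that puts the value into register `2 * i + 1`, changing only odd registers from there on.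
Variable `x` lives in register `2 * x`. -/
def code : Expr → ℕ → Prog
  | const n, i => .instr (.const (2 * i + 1) n)
  | var x, i => .seq (.instr (.const (2 * i + 1) 0)) (.instr (.add (2 * i + 1) (2 * i + 1) (2 * x)))
  | add e₁ e₂, i => .seq (.seq (e₁.code i) (e₂.code (i + 1)))
      (.instr (.add (2 * i + 1) (2 * i + 1) (2 * (i + 1) + 1)))
  | sub e₁ e₂, i => .seq (.seq (e₁.code i) (e₂.code (i + 1)))
      (.instr (.sub (2 * i + 1) (2 * i + 1) (2 * (i + 1) + 1)))
  | mul e₁ e₂, i => .seq (.seq (e₁.code i) (e₂.code (i + 1)))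
      (.instr (.mul (2 * i + 1) (2 * i + 1) (2 * (i + 1) + 1)))
  | load e, i => .seq (e.code i) (.instr (.load (2 * i + 1) (2 * i + 1)))

end Expr

/-- All registers and memory cells hold numbers up to `B`. -/
structure RamState.Bounded (B : ℕ) (s : RamState) : Prop where
  reg : ∀ x, s.reg x ≤ B
  mem : ∀ i, s.mem i ≤ B

/-- `r` implements `s`: the registers of `s` are the even registers of `r`. -/
structure Implements (s r : RamState) : Prop where
  reg : ∀ x, r.reg (2 * x) = s.reg x
  mem : r.mem = s.mem
  out : r.out = s.out

namespace Expr

/-- Degrees add up under the operations, since a sum or product of powers of `B + 2` is bounded by a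
higher power. The base is at least `2`, so that a constant `n` is at most its `n`-th power. -/
theorem eval_le {B : ℕ} {s : RamState} (hs : s.Bounded B) (e : Expr) :
    e.eval s ≤ (B + 2) ^ e.deg := by
  have h1 : ∀ n, 1 ≤ (B + 2) ^ n := fun n => Nat.one_le_pow _ _ (by omega)
  have hB : ∀ n, B ≤ (B + 2) ^ (n + 1) := fun n => by
    rw [pow_succ]
    nlinarith [h1 n]
  induction e with
  | const n => exact Nat.lt_two_pow_self.le.trans (Nat.pow_le_pow_left (by omega) n)
  | var x => exact (hs.reg x).trans (hB 0)
  | add e₁ e₂ ih₁ ih₂ =>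
    have h₁ := h1 e₁.deg
    have h₂ := h1 e₂.deg
    simp only [eval, deg, pow_succ, pow_add]
    nlinarith [Nat.mul_le_mul h₁ h₂, Nat.mul_le_mul_left ((B + 2) ^ e₁.deg) h₂,
      Nat.mul_le_mul_right ((B + 2) ^ e₂.deg) h₁,
      Nat.zero_le ((B + 2) ^ e₁.deg * (B + 2) ^ e₂.deg * B)]
  | sub e₁ e₂ ih₁ ih₂ =>
    refine (Nat.sub_le _ _).trans (ih₁.trans (Nat.pow_le_pow_right (by omega) ?_))
    simp only [deg]; omega
  | mul e₁ e₂ ih₁ ih₂ =>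
    refine (Nat.mul_le_mul ih₁ ih₂).trans ?_
    rw [← pow_add]
    exact Nat.pow_le_pow_right (by omega) (by simp only [deg]; omega)
  | load e => exact (hs.mem _).trans (hB _)

/-- The code of `e` computes the value of `e` in every implementation of `s`. -/
def Correct (W : ℕ) (s : RamState) (e : Expr) : Prop :=
  ∀ i r, Implements s r → ∃ r', Exec W (e.code i) r e.cost r' ∧ Implements s r' ∧
    r'.reg (2 * i + 1) = e.eval s ∧ ∀ j < i, r'.reg (2 * j + 1) = r.reg (2 * j + 1)

theorem exec_write {W : ℕ} {s r r' : RamState} {p : Prog} {i t v : ℕ} (ins : Instr)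
    (hrun : ins.run r' = { r' with reg := Function.update r'.reg (2 * i + 1) (ins.value r') })
    (hv : ins.value r' = v) (hW : v ≤ W) (hp : Exec W p r t r') (hi : Implements s r')
    (hf : ∀ j < i, r'.reg (2 * j + 1) = r.reg (2 * j + 1)) :
    ∃ r'', Exec W (.seq p (.instr ins)) r (t + 1) r'' ∧ Implements s r'' ∧
      r''.reg (2 * i + 1) = v ∧ ∀ j < i, r''.reg (2 * j + 1) = r.reg (2 * j + 1) := by
  refine ⟨_, .seq hp (.instr ins r' (hv ▸ hW)), ?_, ?_, ?_⟩
  · rw [hrun]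
    exact ⟨fun x => by rw [← hi.reg x]; exact Function.update_of_ne (by omega) _ _, hi.mem, hi.out⟩
  · rw [hrun, hv]
    exact Function.update_self _ _ _
  · intro j hj
    rw [hrun, ← hf j hj]
    exact Function.update_of_ne (by omega) _ _

/-- The second operand is evaluated one temporary register higher, so the value of the first
survives. -/
theorem Correct.pair {W : ℕ} {s : RamState} {e₁ e₂ : Expr} (h₁ : e₁.Correct W s)
    (h₂ : e₂.Correct W s) (i : ℕ) (r : RamState) (hr : Implements s r) :
    ∃ r', Exec W (.seq (e₁.code i) (e₂.code (i + 1))) r (e₁.cost + e₂.cost) r' ∧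
      Implements s r' ∧ r'.reg (2 * i + 1) = e₁.eval s ∧
      r'.reg (2 * (i + 1) + 1) = e₂.eval s ∧
      ∀ j < i, r'.reg (2 * j + 1) = r.reg (2 * j + 1) := by
  obtain ⟨r₁, h₁, hi₁, hv₁, hf₁⟩ := h₁ i r hr
  obtain ⟨r₂, h₂, hi₂, hv₂, hf₂⟩ := h₂ (i + 1) r₁ hi₁
  exact ⟨r₂, .seq h₁ h₂, hi₂, by rw [hf₂ i (by omega), hv₁], hv₂, fun j hj => by
    rw [hf₂ j (by omega), hf₁ j hj]⟩

theorem correct {B W : ℕ} {s : RamState} (hs : s.Bounded B) (e : Expr)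
    (hW : (B + 2) ^ e.deg ≤ W) : e.Correct W s := by
  have hle : ∀ e' : Expr, (B + 2) ^ e'.deg ≤ W → e'.eval s ≤ W := fun e' h' =>
    (eval_le hs e').trans h'
  have hpow : ∀ {d d'}, (B + 2) ^ d ≤ W → d' ≤ d → (B + 2) ^ d' ≤ W := fun h h' =>
      (Nat.pow_le_pow_right (by omega) h').trans h
  induction e with
  | const n =>
    intro i r hr
    refine ⟨_, .instr _ _ (hle _ hW), ?_, Function.update_self _ _ _, fun j hj =>
      Function.update_of_ne (by omega) _ _⟩
    exact ⟨fun x => by rw [← hr.reg x]; exact Function.update_of_ne (by omega) _ _, hr.mem, hr.out⟩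
  | var x =>
    intro i r hr
    refine exec_write (.add (2 * i + 1) (2 * i + 1) (2 * x)) rfl ?_ (hle _ hW)
      (.instr (.const (2 * i + 1) 0) r (Nat.zero_le _)) ?_ ?_
    · have : 2 * x ≠ 2 * i + 1 := by omega
      simp [Instr.value, Instr.run, hr.reg, this]
    · exact ⟨fun x => by rw [← hr.reg x]; exact Function.update_of_ne (by omega) _ _, hr.mem,
        hr.out⟩
    · exact fun j hj => Function.update_of_ne (by omega) _ _
  | add e₁ e₂ ih₁ ih₂ =>
    intro i r hr
    obtain ⟨r', h', hi', hv₁, hv₂, hf'⟩ := (ih₁ (hpow hW (by simp only [deg]; omega))).pair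
      (ih₂ (hpow hW (by simp only [deg]; omega))) i r hr
    exact exec_write (.add _ _ _) rfl (by simp only [Instr.value, hv₁, hv₂, eval]) (hle _ hW) h' hi'
      hf'
  | sub e₁ e₂ ih₁ ih₂ =>
    intro i r hr
    obtain ⟨r', h', hi', hv₁, hv₂, hf'⟩ := (ih₁ (hpow hW (by simp only [deg]; omega))).pair
      (ih₂ (hpow hW (by simp only [deg]; omega))) i r hr
    exact exec_write (.sub _ _ _) rfl (by simp only [Instr.value, hv₁, hv₂, eval]) (hle _ hW) h' hi'
      hf'
  | mul e₁ e₂ ih₁ ih₂ =>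
    intro i r hr
    obtain ⟨r', h', hi', hv₁, hv₂, hf'⟩ := (ih₁ (hpow hW (by simp only [deg]; omega))).pair
      (ih₂ (hpow hW (by simp only [deg]; omega))) i r hr
    exact exec_write (.mul _ _ _) rfl (by simp only [Instr.value, hv₁, hv₂, eval]) (hle _ hW) h' hi'
      hf'
  | load e ih =>
    intro i r hr
    obtain ⟨r', h', hi', hv, hf'⟩ := ih (hpow hW (by simp only [deg]; omega)) i r hr
    exact exec_write (.load _ _) rfl (by simp only [Instr.value, hv, hi'.mem, eval]) (hle _ hW) h'
      hi' hf'

end Expr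

/-- Programs over expressions. -/
inductive Stmt where
  | skip
  | assign (x : ℕ) (e : Expr)
  | store (e₁ e₂ : Expr)
  | out (e : Expr)
  | seq (p₁ p₂ : Stmt)
  | ite (e : Expr) (p₁ p₂ : Stmt)
  | loop (x : ℕ) (p : Stmt)

/-- `Steps B p s t s'`: started in `s`, the program `p` halts in `s'` after `t` steps, and all
values assigned or stored on the way are at most `B`. -/
inductive Steps (B : ℕ) : Stmt → RamState → ℕ → RamState → Prop where
  | skip (s) : Steps B .skip s 1 s
  | assign (x e) (s : RamState) (h : e.eval s ≤ B) :
      Steps B (.assign x e) s 1 { s with reg := Function.update s.reg x (e.eval s) }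
  | store (e₁ e₂) (s : RamState) (h : e₂.eval s ≤ B) :
      Steps B (.store e₁ e₂) s 1 { s with mem := Function.update s.mem (e₁.eval s) (e₂.eval s) }
  | out (e) (s : RamState) : Steps B (.out e) s 1 { s with out := s.out ++ [e.eval s] }
  | seq {p₁ p₂ s s₁ s₂ t₁ t₂} (h₁ : Steps B p₁ s t₁ s₁) (h₂ : Steps B p₂ s₁ t₂ s₂) :
      Steps B (.seq p₁ p₂) s (t₁ + t₂) s₂
  | ite_true {e : Expr} {p₁ p₂ s s' t} (ha : e.eval s ≠ 0) (h : Steps B p₁ s t s') :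
      Steps B (.ite e p₁ p₂) s (t + 1) s'
  | ite_false {e : Expr} {p₁ p₂ s s' t} (ha : e.eval s = 0) (h : Steps B p₂ s t s') :
      Steps B (.ite e p₁ p₂) s (t + 1) s'
  | loop_halt {x p s} (ha : s.reg x = 0) : Steps B (.loop x p) s 1 s
  | loop_step {x p s s₁ s₂ t₁ t₂} (ha : s.reg x ≠ 0) (h₁ : Steps B p s t₁ s₁)
      (h₂ : Steps B (.loop x p) s₁ t₂ s₂) : Steps B (.loop x p) s (t₁ + t₂ + 1) s₂

namespace Stmt

/-- An exponent that bounds the degrees of all expressions. -/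
def deg : Stmt → ℕ
  | skip => 1
  | assign _ e => e.deg + 1
  | store e₁ e₂ => e₁.deg + e₂.deg + 1
  | out e => e.deg + 1
  | seq p₁ p₂ => p₁.deg + p₂.deg
  | ite e p₁ p₂ => e.deg + p₁.deg + p₂.deg
  | loop _ p => p.deg

/-- The largest number of instructions that a single step takes. -/
def cost : Stmt → ℕ
  | skip => 1
  | assign _ e => e.cost + 2
  | store e₁ e₂ => e₁.cost + e₂.cost + 1
  | out e => e.cost + 1
  | seq p₁ p₂ => p₁.cost + p₂.cost
  | ite e p₁ p₂ => e.cost + 1 + p₁.cost + p₂.cost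
  | loop _ p => p.cost + 1

/-- The random access machine program. -/
def code : Stmt → Prog
  | skip => .skip
  -- Copying a register is done by adding register `3`, which holds zero.
  | assign x e => .seq (.seq (e.code 0) (.instr (.const 3 0))) (.instr (.add (2 * x) 1 3))
  | store e₁ e₂ => .seq (.seq (e₁.code 0) (e₂.code 1)) (.instr (.store 1 3))
  | out e => .seq (e.code 0) (.instr (.out 1))
  | seq p₁ p₂ => .seq p₁.code p₂.code
  | ite e p₁ p₂ => .seq (e.code 0) (.ite 1 p₁.code p₂.code)
  | loop x p => .loop (2 * x) p.code

end Stmt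

theorem Steps.bounded {B : ℕ} {p : Stmt} {s s' : RamState} {t : ℕ} (h : Steps B p s t s')
    (hs : s.Bounded B) : s'.Bounded B := by
  induction h with
  | skip => exact hs
  | assign x e s h =>
    refine ⟨fun y => ?_, hs.mem⟩
    by_cases hy : y = x
    · subst hy; simpa using h
    · simpa [hy] using hs.reg y
  | store e₁ e₂ s h =>
    refine ⟨hs.reg, fun i => ?_⟩
    by_cases hi : i = e₁.eval s
    · subst hi; simpa using h
    · simpa [hi] using hs.mem i
  | out => exact ⟨hs.reg, hs.mem⟩
  | seq _ _ ih₁ ih₂ => exact ih₂ (ih₁ hs)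
  | ite_true _ _ ih => exact ih hs
  | ite_false _ _ ih => exact ih hs
  | loop_halt => exact hs
  | loop_step _ _ _ ih₁ ih₂ => exact ih₂ (ih₁ hs)

/-- Variables and memory stay below `B` throughout, and temporaries hold values of subexpressions,
so all words stay below a fixed power of `B + 2`. -/
theorem Steps.exec {B W : ℕ} {p : Stmt} {s s' : RamState} {t : ℕ} (h : Steps B p s t s')
    (hs : s.Bounded B) (hW : (B + 2) ^ p.deg ≤ W) (r : RamState) (hr : Implements s r) :
    ∃ t' r', Exec W p.code r t' r' ∧ t' ≤ p.cost * t ∧ Implements s' r' := by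
  have hpow : ∀ {d d'}, (B + 2) ^ d ≤ W → d' ≤ d → (B + 2) ^ d' ≤ W := fun h h' =>
      (Nat.pow_le_pow_right (by omega) h').trans h
  induction h generalizing r with
  | skip => exact ⟨1, r, .skip r, by simp [Stmt.cost], hr⟩
  | assign x e s h =>
    obtain ⟨r₁, h₁, hi₁, hv₁, -⟩ := e.correct hs (hpow hW (by simp [Stmt.deg])) 0 r hr
    have hW' : e.eval s ≤ W := (e.eval_le hs).trans (hpow hW (by simp [Stmt.deg]))
    have hv : (Instr.add (2 * x) 1 3).value (Instr.run r₁ (.const 3 0)) = e.eval s := by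
      simpa [Instr.value, Instr.run] using hv₁
    refine ⟨_, _, .seq (.seq h₁ (.instr _ _ (Nat.zero_le _))) (.instr _ _ (hv ▸ hW')),
      by simp [Stmt.cost], ⟨fun y => ?_, hi₁.mem, hi₁.out⟩⟩
    by_cases hy : y = x
    · subst hy
      exact (Function.update_self _ _ _).trans (hv.trans (by simp))
    · refine (Function.update_of_ne (by omega) _ _).trans ?_
      refine (Function.update_of_ne (by omega) _ _).trans ?_
      exact (hi₁.reg y).trans (Function.update_of_ne hy _ _).symm
  | store e₁ e₂ s h =>
    obtain ⟨r₁, h₁, hi₁, hv₁, hv₂, -⟩ := (e₁.correct hs (hpow hW (by simp [Stmt.deg]; omega))).pair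
      (e₂.correct hs (hpow hW (by simp [Stmt.deg]; omega))) 0 r hr
    have hW' : e₂.eval s ≤ W := (e₂.eval_le hs).trans (hpow hW (by simp [Stmt.deg]; omega))
    norm_num at hv₁ hv₂
    refine ⟨_, _, .seq h₁ (.instr (.store 1 3) _ (hv₂.trans_le hW')),
      by simp [Stmt.cost], ⟨hi₁.reg, ?_, hi₁.out⟩⟩
    simp [Instr.run, Instr.value, hv₁, hv₂, hi₁.mem]
  | out e s =>
    obtain ⟨r₁, h₁, hi₁, hv₁, -⟩ := e.correct hs (hpow hW (by simp [Stmt.deg])) 0 r hr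
    have hW' : e.eval s ≤ W := (e.eval_le hs).trans (hpow hW (by simp [Stmt.deg]))
    norm_num at hv₁
    refine ⟨_, _, .seq h₁ (.instr (.out 1) _ (hv₁.trans_le hW')),
      by simp [Stmt.cost], ⟨hi₁.reg, hi₁.mem, ?_⟩⟩
    simp [Instr.run, Instr.value, hv₁, hi₁.out]
  | @seq p₁ p₂ s s₁ s₂ t₁ t₂ h₁ h₂ ih₁ ih₂ =>
    obtain ⟨u₁, r₁, hx₁, hu₁, hi₁⟩ := ih₁ hs (hpow hW (by simp [Stmt.deg])) r hr
    obtain ⟨u₂, r₂, hx₂, hu₂, hi₂⟩ := ih₂ (h₁.bounded hs) (hpow hW (by simp [Stmt.deg])) r₁ hi₁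
    refine ⟨_, _, .seq hx₁ hx₂, ?_, hi₂⟩
    simp only [Stmt.cost]
    nlinarith [Nat.zero_le (p₁.cost * t₂), Nat.zero_le (p₂.cost * t₁)]
  | @ite_true e p₁ p₂ s s' t ha h ih =>
    obtain ⟨r₁, h₁, hi₁, hv₁, -⟩ := e.correct hs (hpow hW (by simp [Stmt.deg]; omega)) 0 r hr
    obtain ⟨u, r₂, hx, hu, hi₂⟩ := ih hs (hpow hW (by simp [Stmt.deg]; omega)) r₁ hi₁
    refine ⟨_, _, .seq h₁ (.ite_true (by norm_num at hv₁; rwa [hv₁]) hx), ?_, hi₂⟩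
    simp only [Stmt.cost]
    nlinarith [Nat.zero_le (e.cost * t), Nat.zero_le (p₂.cost * t)]
  | @ite_false e p₁ p₂ s s' t ha h ih =>
    obtain ⟨r₁, h₁, hi₁, hv₁, -⟩ := e.correct hs (hpow hW (by simp [Stmt.deg]; omega)) 0 r hr
    obtain ⟨u, r₂, hx, hu, hi₂⟩ := ih hs (hpow hW (by simp [Stmt.deg])) r₁ hi₁
    refine ⟨_, _, .seq h₁ (.ite_false (by norm_num at hv₁; rwa [hv₁]) hx), ?_, hi₂⟩
    simp only [Stmt.cost]
    nlinarith [Nat.zero_le (e.cost * t), Nat.zero_le (p₁.cost * t)]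
  | loop_halt ha => exact ⟨1, r, Exec.loop_stop ((hr.reg _).trans ha), by simp [Stmt.cost], hr⟩
  | @loop_step x p s s₁ s₂ t₁ t₂ ha h₁ h₂ ih₁ ih₂ =>
    obtain ⟨u₁, r₁, hx₁, hu₁, hi₁⟩ := ih₁ hs (hpow hW (by simp [Stmt.deg])) r hr
    obtain ⟨u₂, r₂, hx₂, hu₂, hi₂⟩ := ih₂ (h₁.bounded hs) hW r₁ hi₁
    refine ⟨_, _, .loop_step (by rwa [hr.reg]) hx₁ hx₂, ?_, hi₂⟩
    simp only [Stmt.cost] at hu₂ ⊢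
    nlinarith

/-- From `s`, the program `p` reaches a state satisfying `Q` in at most `T` steps. -/
def Reaches (B : ℕ) (p : Stmt) (s : RamState) (T : ℕ) (Q : RamState → Prop) : Prop :=
  ∃ t s', Steps B p s t s' ∧ t ≤ T ∧ Q s'

/-! ### Rules for reasoning about programs with time bounds -/

namespace Reaches

variable {B : ℕ} {s : RamState} {Q : RamState → Prop}

theorem mono {p : Stmt} {T T' : ℕ} {Q' : RamState → Prop} (h : Reaches B p s T Q) (hT : T ≤ T')
    (hQ : ∀ s, Q s → Q' s) : Reaches B p s T' Q' := by
  obtain ⟨t, s', h, ht, hq⟩ := h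
  exact ⟨t, s', h, ht.trans hT, hQ _ hq⟩

theorem skip (h : Q s) : Reaches B .skip s 1 Q := ⟨1, s, .skip s, le_rfl, h⟩

theorem assign {x : ℕ} {e : Expr} (he : e.eval s ≤ B)
    (h : Q { s with reg := Function.update s.reg x (e.eval s) }) :
    Reaches B (.assign x e) s 1 Q := ⟨1, _, .assign x e s he, le_rfl, h⟩

theorem store {e₁ e₂ : Expr} (he : e₂.eval s ≤ B)
    (h : Q { s with mem := Function.update s.mem (e₁.eval s) (e₂.eval s) }) :
    Reaches B (.store e₁ e₂) s 1 Q := ⟨1, _, .store e₁ e₂ s he, le_rfl, h⟩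

theorem out {e : Expr} (h : Q { s with out := s.out ++ [e.eval s] }) :
    Reaches B (.out e) s 1 Q := ⟨1, _, .out e s, le_rfl, h⟩

theorem seq {p₁ p₂ : Stmt} {T₁ T₂ : ℕ} {Q₁ : RamState → Prop} (h₁ : Reaches B p₁ s T₁ Q₁)
    (h₂ : ∀ s₁, Q₁ s₁ → Reaches B p₂ s₁ T₂ Q) : Reaches B (.seq p₁ p₂) s (T₁ + T₂) Q := by
  obtain ⟨t₁, s₁, h₁, ht₁, hq₁⟩ := h₁
  obtain ⟨t₂, s₂, h₂, ht₂, hq₂⟩ := h₂ s₁ hq₁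
  exact ⟨_, _, .seq h₁ h₂, by omega, hq₂⟩

theorem ite {e : Expr} {p₁ p₂ : Stmt} {T : ℕ} (h₁ : e.eval s ≠ 0 → Reaches B p₁ s T Q)
    (h₂ : e.eval s = 0 → Reaches B p₂ s T Q) : Reaches B (.ite e p₁ p₂) s (T + 1) Q := by
  by_cases h : e.eval s = 0
  · obtain ⟨t, s', h', ht, hq⟩ := h₂ h
    exact ⟨_, _, .ite_false h h', by omega, hq⟩
  · obtain ⟨t, s', h', ht, hq⟩ := h₁ h
    exact ⟨_, _, .ite_true h h', by omega, hq⟩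

/-- The invariant `I i` after `i` rounds forces the loop register to hold the number of remaining
rounds. Each round costs `T` steps plus one test, and there is a final test. -/
theorem loop {x : ℕ} {p : Stmt} {T N : ℕ} (I : ℕ → RamState → Prop)
    (hx : ∀ i s, i ≤ N → I i s → s.reg x = N - i)
    (hstep : ∀ i s, i < N → I i s → Reaches B p s T (I (i + 1))) (h0 : I 0 s) :
    Reaches B (.loop x p) s (N * (T + 1) + 1) (I N) := by
  have key : ∀ n i s, n + i = N → I i s → Reaches B (.loop x p) s (n * (T + 1) + 1) (I N) := by
    intro n
    induction n with
    | zero =>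
      intro i s hi hI
      obtain rfl : i = N := by omega
      exact ⟨1, s, .loop_halt (by rw [hx i s le_rfl hI]; omega), by omega, hI⟩
    | succ n ih =>
      intro i s hi hI
      obtain ⟨t₁, s₁, h₁, ht₁, hq₁⟩ := hstep i s (by omega) hI
      obtain ⟨t₂, s₂, h₂, ht₂, hq₂⟩ := ih (i + 1) s₁ (by omega) hq₁
      refine ⟨_, _, .loop_step (by rw [hx i s (by omega) hI]; omega) h₁ h₂, ?_, hq₂⟩
      rw [add_mul]
      omega
  exact key N 0 s (by omega) h0

end Reaches

/-- A bound that is polynomial in the magnitude of the input yields programs with words of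
logarithmic length. -/
theorem Reaches.runs {p : Stmt} {C T m : ℕ} {input : List ℕ} {good : List ℕ → Prop} {B : ℕ}
    (hB : B ≤ C * (inputMagnitude input + 1) ^ C) (hin : ∀ i, input.getD i 0 ≤ B)
    (h : Reaches B p (.init input) (T * (m + 1)) fun s => good s.out) :
    p.code.Runs ((C + 2) ^ p.deg + C * p.deg + p.cost * T) m input good := by
  obtain ⟨t, s, h, ht, hg⟩ := h
  set X := inputMagnitude input + 1 with hX
  -- The first two summands come from raising `B + 2 ≤ (C + 2) * X ^ C` to the power `p.deg`; the
  -- last one bounds the time.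
  set c := (C + 2) ^ p.deg + C * p.deg + p.cost * T
  have h1 : 1 ≤ X ^ C := Nat.one_le_pow _ _ (by omega)
  have hW : (B + 2) ^ p.deg ≤ c * X ^ c := by
    calc (B + 2) ^ p.deg ≤ ((C + 2) * X ^ C) ^ p.deg := Nat.pow_le_pow_left (by nlinarith) _
      _ = (C + 2) ^ p.deg * X ^ (C * p.deg) := by rw [mul_pow, ← pow_mul]
      _ ≤ c * X ^ c := Nat.mul_le_mul (by omega) (Nat.pow_le_pow_right (by omega) (by omega))
  obtain ⟨t', r', hx, ht', hi⟩ := h.exec (B := B) ⟨fun _ => Nat.zero_le _, hin⟩ hW (.init input)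
    ⟨fun _ => rfl, rfl, rfl⟩
  refine ⟨t', r', hx, ?_, hi.out ▸ hg⟩
  calc t' ≤ p.cost * (T * (m + 1)) := ht'.trans (Nat.mul_le_mul_left _ ht)
    _ = p.cost * T * (m + 1) := by ring
    _ ≤ c * (m + 1) := Nat.mul_le_mul_right _ (by omega)

theorem getD_le_inputMagnitude (input : List ℕ) (i : ℕ) :
    input.getD i 0 ≤ inputMagnitude input := by
  have key : ∀ l : List ℕ, ∀ i, l.getD i 0 ≤ l.foldr max 0 := by
    intro l
    induction l with
    | nil => simp
    | cons a l ih =>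
      intro i
      cases i with
      | zero => simp
      | succ i => simpa using .inr (ih i)
  exact (key input i).trans (Nat.le_add_left _ _)

/-! ## Memory layout: the input, followed by interleaved regions -/

/-- The memory that holds the input, and after it `K` interleaved regions with contents `m`. -/
def layout (K : ℕ) (input : List ℕ) (m : ℕ → ℕ → ℕ) (i : ℕ) : ℕ :=
  if i < input.length then input.getD i 0
  else m ((i - input.length) % K) ((i - input.length) / K)

section layout

variable {K : ℕ} {input : List ℕ} {m : ℕ → ℕ → ℕ}

theorem layout_of_lt {i : ℕ} (hi : i < input.length) : layout K input m i = input.getD i 0 :=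
  if_pos hi

/-- Interleaving gives every region unboundedly many cells, each addressed by a constant number of
arithmetic operations, so no region needs a size limit. -/
theorem layout_region {j : ℕ} (hj : j < K) (x : ℕ) :
    layout K input m (input.length + (j + K * x)) = m j x := by
  rw [layout, if_neg (by omega), Nat.add_sub_cancel_left, Nat.add_mul_mod_self_left,
    Nat.mod_eq_of_lt hj, Nat.add_mul_div_left _ _ (by omega), Nat.div_eq_of_lt hj, zero_add]

theorem update_layout {j : ℕ} (hj : j < K) (x v : ℕ) :
    Function.update (layout K input m) (input.length + (j + K * x)) v =
      layout K input (Function.update m j (Function.update (m j) x v)) := by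
  funext i
  by_cases hi : i < input.length
  · rw [Function.update_of_ne (by omega), layout_of_lt hi, layout_of_lt hi]
  obtain ⟨y, rfl⟩ := Nat.exists_eq_add_of_le (not_lt.1 hi)
  have hy := Nat.mod_add_div y K
  have hlt := Nat.mod_lt y (by omega : K > 0)
  set j' := y % K
  set x' := y / K
  rw [← hy, layout_region hlt]
  by_cases h : j' = j
  · rw [h]
    by_cases hx : x' = x
    · rw [hx]; simp
    · rw [Function.update_of_ne, layout_region hj, Function.update_self, Function.update_of_ne hx]
      intro he
      exact hx (Nat.eq_of_mul_eq_mul_left (by omega : 0 < K) (by omega))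
  · rw [Function.update_of_ne, layout_region hlt, Function.update_of_ne h]
    intro he
    apply h
    have := congrArg (· % K) (Nat.add_left_cancel he)
    simpa [Nat.mod_eq_of_lt hlt, Nat.mod_eq_of_lt hj] using this

theorem layout_zero : layout K input (fun _ _ => 0) = (RamState.init input).mem := by
  funext i
  unfold layout RamState.init
  split_ifs with h
  · rfl
  · exact (List.getD_eq_default _ _ (by omega)).symm

end layout

/-! ## Encodings of databases -/

theorem List.getD_append_add {l₁ l₂ : List ℕ} {i : ℕ} :
    (l₁ ++ l₂).getD (l₁.length + i) 0 = l₂.getD i 0 := by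
  rw [List.getD_append_right _ _ _ _ (by omega), Nat.add_sub_cancel_left]

theorem List.getD_flatMap {α : Type*} {r : ℕ} (g : α → List ℕ) (l : List α)
    (hg : ∀ a ∈ l, (g a).length = r) {i : ℕ} (hi : i < l.length) {j : ℕ} (hj : j < r) :
    (l.flatMap g).getD (r * i + j) 0 = (g l[i]).getD j 0 := by
  induction l generalizing i with
  | nil => simp at hi
  | cons a l ih =>
    rw [List.flatMap_cons]
    cases i with
    | zero => rw [Nat.mul_zero, zero_add, List.getD_append _ _ _ _ (by
        rw [hg a List.mem_cons_self]; exact hj)]; rfl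
    | succ i =>
      have hr := hg a List.mem_cons_self
      have : r * (i + 1) + j = (g a).length + (r * i + j) := by rw [hr]; ring
      rw [this, List.getD_append_add, ih (fun b hb => hg b (List.mem_cons_of_mem _ hb))]
      · rfl

theorem List.length_flatMap_const {α : Type*} {r : ℕ} (g : α → List ℕ) (l : List α)
    (hg : ∀ a ∈ l, (g a).length = r) : (l.flatMap g).length = r * l.length := by
  induction l with
  | nil => simp
  | cons a l ih =>
    rw [List.flatMap_cons, List.length_append, ih fun b hb => hg b (List.mem_cons_of_mem _ hb),
      hg a List.mem_cons_self, List.length_cons]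
    ring

/-- The arity of the relation symbol with number `j`. -/
def Schema.ar (σ : Schema) (j : ℕ) : ℕ := if h : j < σ.numRels then σ.arity ⟨j, h⟩ else 0

/-- Where the listing of relation `j` starts. -/
def relStart (σ : Schema) (mem : ℕ → ℕ) : ℕ → ℕ
  | 0 => 1
  | j + 1 => relStart σ mem j + 1 + σ.ar j * mem (relStart σ mem j)

def relStartE (σ : Schema) : ℕ → Expr
  | 0 => 1
  | j + 1 => relStartE σ j + 1 + .const (σ.ar j) * .load (relStartE σ j)

@[simp] theorem eval_relStartE (σ : Schema) (s : RamState) (j : ℕ) :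
    (relStartE σ j).eval s = relStart σ s.mem j := by
  induction j with
  | zero => rfl
  | succ j ih => simp [relStartE, relStart, ih]

/-- The number of tuples followed by the tuples. -/
def listing {n r : ℕ} (ts : List (Fin r → Fin n)) : List ℕ :=
  ts.length :: ts.flatMap fun a => List.ofFn fun i => (a i : ℕ)

theorem length_listing {n r : ℕ} (ts : List (Fin r → Fin n)) :
    (listing ts).length = 1 + r * ts.length := by
  rw [listing, List.length_cons, List.length_flatMap_const _ _ fun a _ => List.length_ofFn]
  omega

theorem getD_listing {n r : ℕ} (ts : List (Fin r → Fin n)) {i : ℕ} (hi : i < ts.length)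
    (j : Fin r) : (listing ts).getD (1 + (r * i + j)) 0 = ts[i] j := by
  rw [listing, add_comm 1, List.getD_cons_succ,
    List.getD_flatMap _ _ (fun a _ => List.length_ofFn) hi j.2]
  simp

/-- Access to a database through its encoding. -/
structure Database.Listing {σ : Schema} (D : Database σ) (input : List ℕ)
    (ts : ∀ R, List (Fin (σ.arity R) → Fin D.dom)) : Prop where
  nodup : ∀ R, (ts R).Nodup
  mem_iff : ∀ R a, a ∈ ts R ↔ a ∈ D.rel R
  eq : input = D.dom :: (List.ofFn fun R => listing (ts R)).flatten

theorem Database.Encodes.exists_listing {σ : Schema} {D : Database σ} {input : List ℕ}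
    (h : D.Encodes input) : ∃ ts, D.Listing input ts := by
  obtain ⟨f, hf, rfl⟩ := h
  choose ts h1 h2 h3 using hf
  exact ⟨ts, h1, h2, by rw [show f = _ from funext h3]; rfl⟩

namespace Database.Listing

variable {σ : Schema} {D : Database σ} {input : List ℕ}
  {ts : ∀ R, List (Fin (σ.arity R) → Fin D.dom)}

theorem length_le_size (h : D.Listing input ts) (R : Fin σ.numRels) :
    (ts R).length ≤ D.size := by
  classical
  have : (ts R).length = (D.rel R).card := by
    rw [← List.toFinset_card_of_nodup (h.nodup R)]
    congr 1
    ext a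
    simp [h.mem_iff]
  rw [this]
  exact Finset.single_le_sum (f := fun R => (D.rel R).card) (fun _ _ => Nat.zero_le _)
    (Finset.mem_univ R)

theorem length_pos (h : D.Listing input ts) : 0 < input.length := by
  rw [h.eq]; simp

theorem getD_zero (h : D.Listing input ts) : input.getD 0 0 = D.dom := by rw [h.eq]; simp

theorem relStart_spec (h : D.Listing input ts) {mem : ℕ → ℕ}
    (hm : ∀ i < input.length, mem i = input.getD i 0) (j : ℕ) (hj : j ≤ σ.numRels) :
    ∃ l₁ l₂, input = l₁ ++ l₂ ∧ l₁.length = relStart σ mem j ∧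
      l₂ = ((List.ofFn fun R => listing (ts R)).drop j).flatten := by
  induction j with
  | zero => exact ⟨[D.dom], _, h.eq, rfl, by simp⟩
  | succ j ih =>
    obtain ⟨l₁, l₂, h1, h2, h3⟩ := ih (by omega)
    have hd : (List.ofFn fun R => listing (ts R)).drop j =
        listing (ts ⟨j, hj⟩) :: (List.ofFn fun R => listing (ts R)).drop (j + 1) := by
      rw [List.drop_eq_getElem_cons (by simpa using hj)]
      simp
    rw [hd, List.flatten_cons] at h3
    refine ⟨l₁ ++ listing (ts ⟨j, hj⟩), _, by rw [h1, h3, List.append_assoc], ?_, rfl⟩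
    have hpos := length_listing (ts ⟨j, hj⟩)
    have hlt : relStart σ mem j < input.length := by
      rw [h1, ← h2, h3]
      simp only [List.length_append]
      omega
    have hval : mem (relStart σ mem j) = (ts ⟨j, hj⟩).length := by
      rw [hm _ hlt, h1, ← h2]
      have := List.getD_append_add (l₁ := l₁) (l₂ := l₂) (i := 0)
      rw [add_zero] at this
      rw [this, h3]
      rfl
    rw [List.length_append, h2, hpos, relStart, hval, Schema.ar, dif_pos (show j < σ.numRels from hj)]
    omega

theorem relStart_numRels (h : D.Listing input ts) {mem : ℕ → ℕ}
    (hm : ∀ i < input.length, mem i = input.getD i 0) :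
    relStart σ mem σ.numRels = input.length := by
  obtain ⟨l₁, l₂, h1, h2, h3⟩ := h.relStart_spec hm _ le_rfl
  rw [List.drop_eq_nil_of_le (by simp)] at h3
  rw [h1, h3, ← h2]
  simp

theorem relStart_add_le (h : D.Listing input ts) {mem : ℕ → ℕ}
    (hm : ∀ i < input.length, mem i = input.getD i 0) (R : Fin σ.numRels) :
    relStart σ mem R + (1 + σ.arity R * (ts R).length) ≤ input.length := by
  obtain ⟨l₁, l₂, h1, h2, h3⟩ := h.relStart_spec hm R R.2.le
  rw [List.drop_eq_getElem_cons (by simp)] at h3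
  rw [h1, h3, ← h2]
  simp [length_listing]

theorem getD_relStart_add (h : D.Listing input ts) {mem : ℕ → ℕ}
    (hm : ∀ i < input.length, mem i = input.getD i 0) (R : Fin σ.numRels) {i : ℕ}
    (hi : i < (listing (ts R)).length) :
    mem (relStart σ mem R + i) = (listing (ts R)).getD i 0 := by
  have hle := h.relStart_add_le hm R
  rw [← length_listing] at hle
  obtain ⟨l₁, l₂, h1, h2, h3⟩ := h.relStart_spec hm R R.2.le
  rw [List.drop_eq_getElem_cons (by simp)] at h3
  rw [hm _ (by omega), h1, ← h2, List.getD_append_add, h3, List.flatten_cons]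
  simp only [List.getElem_ofFn]
  rw [List.getD_append _ _ _ _ (by simpa using hi)]

theorem mem_relStart (h : D.Listing input ts) {mem : ℕ → ℕ}
    (hm : ∀ i < input.length, mem i = input.getD i 0) (R : Fin σ.numRels) :
    mem (relStart σ mem R) = (ts R).length := by
  have := h.getD_relStart_add hm R (i := 0) (by rw [length_listing]; omega)
  rw [add_zero] at this
  rw [this]
  rfl

theorem mem_tuple (h : D.Listing input ts) {mem : ℕ → ℕ}
    (hm : ∀ i < input.length, mem i = input.getD i 0) (R : Fin σ.numRels) {i : ℕ}
    (hi : i < (ts R).length) (j : Fin (σ.arity R)) :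
    mem (relStart σ mem R + 1 + σ.arity R * i + j) = (ts R)[i] j := by
  rw [← getD_listing (ts R) hi j, ← h.getD_relStart_add hm R]
  · congr 1; omega
  · rw [length_listing]
    have : σ.arity R * (i + 1) ≤ σ.arity R * (ts R).length := Nat.mul_le_mul_left _ hi
    rw [mul_add, mul_one] at this
    have := j.2
    omega

end Database.Listing

/-! ## Evaluation along a join tree -/

namespace ConjunctiveQuery

variable {σ : Schema} {V : Type*} {q : ConjunctiveQuery σ V}

/-- A rooted join tree whose root contains the free variables. Each atom other than the root comes
with a list `key` of the variables that it shares with its parent. -/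
structure Plan (q : ConjunctiveQuery σ V) where
  root : {a // a ∈ q.atoms}
  rank : {a // a ∈ q.atoms} → ℕ
  parent : {a // a ∈ q.atoms} → {a // a ∈ q.atoms}
  key : {a // a ∈ q.atoms} → List V
  bound : ℕ
  rooted : IsRooted (fun a : {a // a ∈ q.atoms} => Set.range a.1.2) Set.univ root rank parent
  rank_lt : ∀ a, rank a < bound
  key_root : key root = List.ofFn q.free
  mem_of_mem_key : ∀ a, ∀ x ∈ key a, x ∈ Set.range a.1.2
  mem_parent_of_mem_key : ∀ a, a ≠ root → ∀ x ∈ key a, x ∈ Set.range (parent a).1.2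
  mem_key : ∀ a, a ≠ root → ∀ x, x ∈ Set.range a.1.2 → x ∈ Set.range (parent a).1.2 → x ∈ key a

/-- The restriction to at most one free variable enters here: some atom contains all free variables
and can serve as the root. -/
theorem IsAcyclic.exists_plan [Finite V] (h : q.IsAcyclic) (hq : q.arity = 0 ∨ q.arity = 1) :
    Nonempty q.Plan := by
  classical
  have := Fintype.ofFinite V
  have hroot : ∃ r : {a // a ∈ q.atoms}, ∀ i, q.free i ∈ Set.range r.1.2 := by
    rcases hq with hq | hq
    · obtain ⟨a, ha⟩ := q.atoms_nonempty
      exact ⟨⟨a, ha⟩, fun i => absurd i.2 (by omega)⟩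
    · obtain ⟨a, ha, hx⟩ := q.occurs (q.free ⟨0, by omega⟩)
      refine ⟨⟨a, ha⟩, fun i => ?_⟩
      obtain rfl : i = ⟨0, by omega⟩ := Fin.ext (by have := i.2; simp only; omega)
      exact hx
  obtain ⟨r, hr⟩ := hroot
  obtain ⟨rank, p, hp⟩ := (q.isAcyclic_iff_hasJoinTree.1 h).exists_isRooted r
  refine ⟨⟨r, rank, p, fun a => if a = r then List.ofFn q.free else
    (Finset.univ.filter fun x => x ∈ Set.range a.1.2 ∧ x ∈ Set.range (p a).1.2).toList,
    ∑ a, rank a + 1, hp, fun a => Nat.lt_succ_of_le (Finset.single_le_sum (f := rank)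
      (fun _ _ => Nat.zero_le _) (Finset.mem_univ a)), if_pos rfl, ?_, ?_, ?_⟩⟩
  · intro a x
    beta_reduce
    split_ifs with ha
    · rw [List.mem_ofFn, ha]
      rintro ⟨i, rfl⟩
      exact hr i
    · simp only [Finset.mem_toList, Finset.mem_filter]
      exact fun h => h.2.1
  · intro a ha x
    simp only [if_neg ha, Finset.mem_toList, Finset.mem_filter]
    exact fun h => h.2.2
  · intro a ha x h1 h2
    simp only [if_neg ha, Finset.mem_toList, Finset.mem_filter]
    exact ⟨Finset.mem_univ x, h1, h2⟩

/-- The assignment satisfies the atom. -/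
def Sat (D : Database σ) (a : {a // a ∈ q.atoms}) (μ : V → ℕ) : Prop :=
  ∃ t ∈ D.rel a.1.1, ∀ i, μ (a.1.2 i) = t i

namespace Plan

variable (P : q.Plan) (D : Database σ)

/-- The assignment satisfies the atom and extends to the subtree below it. -/
inductive Good : {a // a ∈ q.atoms} → (V → ℕ) → Prop where
  | mk (a : {a // a ∈ q.atoms}) (μ : V → ℕ) (w : {a // a ∈ q.atoms} → V → ℕ) (hs : Sat D a μ)
    (hw : ∀ c, c ≠ P.root → P.parent c = a → Good c (w c))
    (hk : ∀ c, c ≠ P.root → P.parent c = a → ∀ x ∈ P.key c, w c x = μ x) : Good a μ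

variable {P D}

theorem _root_.ConjunctiveQuery.Sat.congr {a : {a // a ∈ q.atoms}} {μ ν : V → ℕ} (h : Sat D a μ)
    (hν : ∀ x ∈ Set.range a.1.2, ν x = μ x) : Sat D a ν := by
  obtain ⟨t, ht, h⟩ := h
  exact ⟨t, ht, fun i => (hν _ ⟨i, rfl⟩).trans (h i)⟩

theorem _root_.ConjunctiveQuery.Sat.lt {a : {a // a ∈ q.atoms}} {μ : V → ℕ} (h : Sat D a μ) {x : V}
    (hx : x ∈ Set.range a.1.2) : μ x < D.dom := by
  obtain ⟨t, -, h⟩ := h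
  obtain ⟨i, rfl⟩ := hx
  rw [h]
  exact (t i).2

theorem Good.sat {a : {a // a ∈ q.atoms}} {μ : V → ℕ} (h : P.Good D a μ) : Sat D a μ := by
  cases h with | mk a μ w hs hw hk => exact hs

theorem Good.congr {a : {a // a ∈ q.atoms}} {μ ν : V → ℕ} (h : P.Good D a μ)
    (hν : ∀ x ∈ Set.range a.1.2, ν x = μ x) : P.Good D a ν := by
  cases h with
  | mk a μ w hs hw hk =>
    refine .mk a ν w (hs.congr hν) hw fun c hc hca x hx => ?_
    rw [hk c hc hca x hx, hν x]
    rw [← hca]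
    exact P.mem_parent_of_mem_key c hc x hx

theorem good_of_forall_sat {μ : V → ℕ} (h : ∀ a : {a // a ∈ q.atoms}, Sat D a μ) (a : {a // a ∈ q.atoms}) :
    P.Good D a μ := by
  induction hn : P.bound - P.rank a using Nat.strong_induction_on generalizing a with
  | _ n ih =>
    refine .mk a μ (fun _ => μ) (h a) (fun c hc hca => ih _ ?_ c rfl) fun _ _ _ _ _ => rfl
    have := P.rooted.lt c hc
    have := P.rank_lt c
    rw [hca] at *
    omega

/-- The separate witnesses are glued in order of increasing rank: when atom `a` is reached, the
assignment is overwritten on the variables of `a` by a witness that agrees with it on `P.key a`. -/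
theorem Good.exists_forall_sat {μ : V → ℕ} (h : P.Good D P.root μ) :
    ∃ ν : V → ℕ, (∀ a : {a // a ∈ q.atoms}, Sat D a ν) ∧ ∀ x ∈ Set.range P.root.1.2, ν x = μ x := by
  classical
  have key : ∀ n, ∃ ν : V → ℕ, (∀ a, P.rank a < P.rank P.root + 1 + n → P.Good D a ν) ∧
      ∀ x ∈ Set.range P.root.1.2, ν x = μ x := by
    intro n
    induction n with
    | zero =>
      refine ⟨μ, fun a ha => ?_, fun _ _ => rfl⟩
      have := P.rooted.root_le a
      obtain rfl : a = P.root := P.rooted.inj (by omega)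
      exact h
    | succ n ih =>
      obtain ⟨ν, hν, hr⟩ := ih
      by_cases ha : ∃ a, P.rank a = P.rank P.root + 1 + n
      · obtain ⟨a, ha⟩ := ha
        have har : a ≠ P.root := by rintro rfl; omega
        have hp := hν (P.parent a) (by have := P.rooted.lt a har; omega)
        obtain ⟨w, hw, hk⟩ : ∃ w, P.Good D a w ∧ ∀ x ∈ P.key a, w x = ν x := by
          generalize hb : P.parent a = b at hp
          cases hp with
          | mk b ν w hs hw hk => exact ⟨w a, hw a har hb, hk a har hb⟩
        -- Overwriting does no harm: a variable that `a` shares with an earlier atom lies in the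
        -- parent of `a`, hence in the key.
        have hagree : ∀ b, P.rank b < P.rank a → ∀ x ∈ Set.range b.1.2,
            x ∈ Set.range a.1.2 → w x = ν x := fun b hb x hxb hxa =>
          hk x (P.mem_key a har x hxa (P.rooted.inter a har b hb x trivial hxa hxb))
        refine ⟨fun x => if x ∈ Set.range a.1.2 then w x else ν x, fun b hb => ?_, fun x hx => ?_⟩
        · by_cases hba : b = a
          · rw [hba]
            exact hw.congr fun x hx => if_pos hx
          · have hlt : P.rank b < P.rank a := by
              have : P.rank b ≠ P.rank a := fun h => hba (P.rooted.inj h)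
              omega
            refine (hν b (by omega)).congr fun x hx => ?_
            split_ifs with hxa
            · exact hagree b hlt x hx hxa
            · rfl
        · rw [← hr x hx]
          beta_reduce
          split_ifs with hxa
          · exact hagree P.root (by omega) x hx hxa
          · rfl
      · refine ⟨ν, fun b hb => hν b ?_, hr⟩
        have : P.rank b ≠ P.rank P.root + 1 + n := fun h => ha ⟨b, h⟩
        omega
  obtain ⟨ν, hν, hr⟩ := key P.bound
  exact ⟨ν, fun a => (hν a (by have := P.rank_lt a; omega)).sat, hr⟩

variable (P D)

/-- The number that represents the values of a list of variables. -/
def keyCode (D : Database σ) (l : List V) (μ : V → ℕ) : ℕ := Nat.ofDigits (D.dom + 2) (l.map μ)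

/-- The codes of the good assignments, projected to the key of the atom. -/
def codes (a : {a // a ∈ q.atoms}) : Set ℕ := {c | ∃ μ, P.Good D a μ ∧ c = keyCode D (P.key a) μ}

/-- A position of the variable in the atom. -/
noncomputable def pos (a : {a // a ∈ q.atoms}) (x : V) : ℕ :=
  open Classical in if h : ∃ i, a.1.2 i = x then ((Classical.choose h : Fin _) : ℕ) else 0

/-- The value that a tuple gives to a variable. -/
noncomputable def val {n : ℕ} (a : {a // a ∈ q.atoms}) (t : Fin (σ.arity a.1.1) → Fin n)
    (x : V) : ℕ :=
  open Classical in if h : ∃ i, a.1.2 i = x then t (Classical.choose h) else 0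

theorem exists_pos (a : {a // a ∈ q.atoms}) {x : V} (hx : x ∈ Set.range a.1.2) :
    ∃ i, a.1.2 i = x ∧ pos a x = i ∧ ∀ {n} (t : Fin (σ.arity a.1.1) → Fin n), val a t x = t i := by
  refine ⟨Classical.choose hx, Classical.choose_spec hx, dif_pos (c := ∃ i, a.1.2 i = x) hx,
    fun t => dif_pos (c := ∃ i, a.1.2 i = x) hx⟩

/-- The tuple is an instance of the atom and has extensions to the subtrees below it. -/
def GoodTuple (a : {a // a ∈ q.atoms}) (t : Fin (σ.arity a.1.1) → Fin D.dom) : Prop :=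
  -- This matters for repeated variables: `val` reads one chosen position, and the other positions
  -- of the variable must agree with it.
  (∀ i, (t i : ℕ) = val a t (a.1.2 i)) ∧
    ∀ c, c ≠ P.root → P.parent c = a → keyCode D (P.key c) (val a t) ∈ P.codes D c

variable {P D}

/-- Digit expansions are unique. The base `D.dom + 2` exceeds all digits, and exceeds `1` even over
an empty domain. -/
theorem eq_of_keyCode_eq {l : List V} {μ ν : V → ℕ} (hμ : ∀ x ∈ l, μ x < D.dom)
    (hν : ∀ x ∈ l, ν x < D.dom) (h : keyCode D l μ = keyCode D l ν) : ∀ x ∈ l, μ x = ν x := by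
  have := Nat.ofDigits_inj_of_len_eq (b := D.dom + 2) (by omega) (by simp) (by
    simp only [List.mem_map, forall_exists_index, and_imp, forall_apply_eq_imp_iff₂]
    exact fun x hx => (hμ x hx).trans (by omega)) (by
    simp only [List.mem_map, forall_exists_index, and_imp, forall_apply_eq_imp_iff₂]
    exact fun x hx => (hν x hx).trans (by omega)) h
  exact List.map_inj_left.1 this

theorem keyCode_congr {l : List V} {μ ν : V → ℕ} (h : ∀ x ∈ l, μ x = ν x) :
    keyCode D l μ = keyCode D l ν := by
  rw [keyCode, keyCode, List.map_congr_left h]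

/-- The recursion behind the algorithm: the codes of an atom are found by scanning its relation and
looking up the codes of its children. The key of a child lies in both atoms, so agreement on it can
be tested by comparing codes. -/
theorem codes_eq (a : {a // a ∈ q.atoms}) :
    P.codes D a = {c | ∃ t ∈ D.rel a.1.1, P.GoodTuple D a t ∧ c = keyCode D (P.key a) (val a t)} := by
  ext c
  constructor
  · rintro ⟨μ, hμ, rfl⟩
    obtain ⟨t, ht, hμt⟩ := hμ.sat
    have hval : ∀ x ∈ Set.range a.1.2, val a t x = μ x := by
      intro x hx
      obtain ⟨i, rfl, -, hi⟩ := exists_pos a hx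
      rw [hi, hμt]
    refine ⟨t, ht, ⟨fun i => by rw [hval _ ⟨i, rfl⟩, hμt], fun c hc hca => ?_⟩,
      keyCode_congr fun x hx => (hval x (P.mem_of_mem_key a x hx)).symm⟩
    cases hμ with
    | mk a μ w hs hw hk =>
      refine ⟨w c, hw c hc hca, keyCode_congr fun x hx => ?_⟩
      rw [hk c hc hca x hx, hval]
      rw [← hca]
      exact P.mem_parent_of_mem_key c hc x hx
  · rintro ⟨t, ht, ⟨h1, h2⟩, rfl⟩
    have hs : Sat D a (val a t) := ⟨t, ht, fun i => (h1 i).symm⟩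
    choose! w hw hk using h2
    refine ⟨val a t, .mk a _ w hs hw fun c hc hca x hx => ?_, rfl⟩
    refine (eq_of_keyCode_eq (fun y hy => hs.lt ?_) (fun y hy => ?_) (hk c hc hca) x hx).symm
    · rw [← hca]
      exact P.mem_parent_of_mem_key c hc y hy
    · exact (hw c hc hca).sat.lt (P.mem_of_mem_key c y hy)

/-- The key of the root consists of the free variables, and a good assignment at the root extends to
all atoms. -/
theorem mem_codes_root {b : Fin q.arity → Fin D.dom} :
    Nat.ofDigits (D.dom + 2) (List.ofFn fun i => (b i : ℕ)) ∈ P.codes D P.root ↔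
      b ∈ q.solutions D := by
  constructor
  · rintro ⟨μ, hμ, hb⟩
    obtain ⟨ν, hν, hr⟩ := hμ.exists_forall_sat
    have hlt : ∀ x, ν x < D.dom := fun x => by
      obtain ⟨a, ha, hx⟩ := q.occurs x
      exact (hν ⟨a, ha⟩).lt hx
    refine ⟨fun x => ⟨ν x, hlt x⟩, fun a ha => ?_, funext fun i => Fin.ext ?_⟩
    · obtain ⟨t, ht, h⟩ := hν ⟨a, ha⟩
      convert ht using 1
      exact funext fun i => Fin.ext (h i)
    · rw [keyCode, P.key_root, List.map_ofFn] at hb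
      have := Nat.ofDigits_inj_of_len_eq (b := D.dom + 2) (by omega) (by simp) (by
        simp only [List.mem_ofFn, forall_exists_index, forall_apply_eq_imp_iff]
        exact fun i => (b i).2.trans (by omega)) (by
        simp only [List.mem_ofFn, forall_exists_index, forall_apply_eq_imp_iff]
        intro i
        refine (hμ.sat.lt (P.mem_of_mem_key _ _ ?_)).trans (by omega)
        rw [P.key_root, List.mem_ofFn]
        exact ⟨i, rfl⟩) hb
      have hi := congrFun (List.ofFn_injective this) i
      simp only [Function.comp_apply] at hi ⊢
      rw [hi, hr]
      refine P.mem_of_mem_key _ _ ?_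
      rw [P.key_root, List.mem_ofFn]
      exact ⟨i, rfl⟩
  · rintro ⟨μ, hμ, rfl⟩
    refine ⟨fun x => μ x, good_of_forall_sat (fun a => ⟨_, hμ a.1 a.2, fun i => rfl⟩) _, ?_⟩
    rw [keyCode, P.key_root, List.map_ofFn]
    rfl

end Plan

end ConjunctiveQuery

/-! ## The evaluation program -/

namespace Expr

/-- Horner's scheme. -/
def ofDigits (b : Expr) : List Expr → Expr
  | [] => 0
  | e :: l => e + b * ofDigits b l

@[simp] theorem eval_ofDigits (s : RamState) (b : Expr) (l : List Expr) :
    (ofDigits b l).eval s = Nat.ofDigits (b.eval s) (l.map (eval s)) := by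
  induction l with
  | nil => rfl
  | cons e l ih => simp [ofDigits, ih, Nat.ofDigits_cons]

/-- The conjunction of conditions, each of which holds if the value is not zero. -/
def all : List Expr → Expr
  | [] => 1
  | e :: l => e * all l

theorem eval_all_ne_zero {s : RamState} {l : List Expr} :
    (all l).eval s ≠ 0 ↔ ∀ e ∈ l, e.eval s ≠ 0 := by
  induction l with
  | nil => simp [all]
  | cons e l ih => simp [all, ← ih]

/-- The condition that two values are equal. -/
def eq (e₁ e₂ : Expr) : Expr := 1 - ((e₁ - e₂) + (e₂ - e₁))

theorem eval_eq_ne_zero {s : RamState} {e₁ e₂ : Expr} :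
    (e₁.eq e₂).eval s ≠ 0 ↔ e₁.eval s = e₂.eval s := by
  simp only [eq, eval_sub, eval_one, eval_add]
  omega

end Expr

/-! ### Sets represented by marked memory cells -/

/-- The indicator function of a set. -/
noncomputable def ind (S : Set ℕ) : ℕ → ℕ := S.indicator 1

theorem ind_ne_zero {S : Set ℕ} {x : ℕ} : ind S x ≠ 0 ↔ x ∈ S := by
  simp [ind]

theorem ind_le (S : Set ℕ) (x : ℕ) : ind S x ≤ 1 := by
  classical
  rw [ind, Set.indicator_apply]
  split_ifs <;> simp

theorem update_ind_one (S : Set ℕ) (x : ℕ) : Function.update (ind S) x 1 = ind (insert x S) := by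
  classical
  funext y
  by_cases h : y = x
  · subst h; simp [ind]
  · simp [ind, Set.indicator_apply, h]

theorem update_ind_zero (S : Set ℕ) (x : ℕ) : Function.update (ind S) x 0 = ind (S \ {x}) := by
  classical
  funext y
  by_cases h : y = x
  · subst h; simp [ind]
  · simp [ind, Set.indicator_apply, h]

theorem ind_empty : ind ∅ = fun _ => 0 := by funext x; simp [ind]

namespace Database.Listing

variable {σ : Schema} {D : Database σ} {input : List ℕ}
  {ts : ∀ R, List (Fin (σ.arity R) → Fin D.dom)}

/-- The positions depend only on the counts in the input, so writing into the regions behind it does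
not move them. -/
theorem relStart_congr (h : D.Listing input ts) {mem : ℕ → ℕ}
    (hm : ∀ i < input.length, mem i = input.getD i 0) (j : ℕ) (hj : j ≤ σ.numRels) :
    relStart σ mem j = relStart σ (fun i => input.getD i 0) j := by
  induction j with
  | zero => rfl
  | succ j ih =>
    rw [relStart, relStart, h.mem_relStart hm ⟨j, hj⟩,
      h.mem_relStart (mem := fun i => input.getD i 0) (fun _ _ => rfl) ⟨j, hj⟩, ih (by omega)]

theorem length_le_magnitude (h : D.Listing input ts) (R : Fin σ.numRels) :
    (ts R).length ≤ inputMagnitude input := by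
  rw [← h.mem_relStart (mem := fun i => input.getD i 0) (fun _ _ => rfl) R]
  exact getD_le_inputMagnitude input _

end Database.Listing

/-- Run `body` once for each tuple of relation `R`, with register `0` pointing to the tuple. -/
def scan (σ : Schema) (R : Fin σ.numRels) (body : Stmt) : Stmt :=
  .seq (.seq (.assign 0 (relStartE σ R + 1))
    (.seq (.assign 1 (.load (relStartE σ R))) (.assign 2 0)))
    (.loop 1 (.seq body (.seq (.assign 0 (.var 0 + .const (σ.arity R))) (.assign 1 (.var 1 - 1)))))

/-- `J` is an invariant in terms of the number of tuples read, the memory, the output and register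
`2`, which the body may use as an accumulator. The body has to preserve the pointer and the counter
in registers `0` and `1`, and `hmem` keeps the input intact. The constant `7` absorbs the set-up and
the administration of the loop. -/
theorem reaches_scan {σ : Schema} {D : Database σ} {input : List ℕ}
    {ts : ∀ R, List (Fin (σ.arity R) → Fin D.dom)} (hL : D.Listing input ts) {R : Fin σ.numRels}
    {body : Stmt} {B T : ℕ} (hB : inputMagnitude input ≤ B) {s : RamState}
    (J : ℕ → (ℕ → ℕ) → List ℕ → ℕ → Prop)
    (hmem : ∀ i mem out n, J i mem out n → ∀ x < input.length, mem x = input.getD x 0)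
    (h0 : J 0 s.mem s.out 0)
    (hbody : ∀ i s, i < (ts R).length → J i s.mem s.out (s.reg 2) →
      s.reg 0 = relStart σ s.mem R + 1 + σ.arity R * i →
      Reaches B body s T fun s' => J (i + 1) s'.mem s'.out (s'.reg 2) ∧ s'.reg 0 = s.reg 0 ∧
        s'.reg 1 = s.reg 1) :
    Reaches B (scan σ R body) s ((T + 7) * (D.size + 1))
      fun s' => J (ts R).length s'.mem s'.out (s'.reg 2) := by
  have hlen : input.length ≤ inputMagnitude input := Nat.le_add_right _ _
  have hm := hmem _ _ _ _ h0
  have hle := hL.relStart_add_le hm R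
  have hval := hL.mem_relStart hm R
  have hlm := hL.length_le_magnitude R
  let I : ℕ → RamState → Prop := fun i s => J i s.mem s.out (s.reg 2) ∧
    s.reg 0 = relStart σ s.mem R + 1 + σ.arity R * i ∧ s.reg 1 = (ts R).length - i
  have hloop : ∀ s, I 0 s → Reaches B (.loop 1 (.seq body (.seq
      (.assign 0 (.var 0 + .const (σ.arity R))) (.assign 1 (.var 1 - 1))))) s
      ((ts R).length * (T + (1 + 1) + 1) + 1) (I (ts R).length) := by
    intro s hs
    refine Reaches.loop I (fun i s _ h => h.2.2) (fun i s hi hI => ?_) hs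
    refine (hbody i s hi hI.1 hI.2.1).seq fun s₁ ⟨hJ, h0, h1⟩ => ?_
    have hm₁ := hmem _ _ _ _ hJ
    have hrs : relStart σ s.mem R = relStart σ s₁.mem R := by
      rw [hL.relStart_congr (hmem _ _ _ _ hI.1) _ R.2.le, hL.relStart_congr hm₁ _ R.2.le]
    have hle := hL.relStart_add_le hm₁ R
    have hmul : σ.arity R * (i + 1) ≤ σ.arity R * (ts R).length := Nat.mul_le_mul_left _ hi
    have h0' : s₁.reg 0 + σ.arity R = relStart σ s₁.mem R + 1 + σ.arity R * (i + 1) := by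
      rw [h0, hI.2.1, hrs, mul_add, mul_one]; ring
    have h1' := hI.2.2
    refine Reaches.seq (T₁ := 1) (T₂ := 1) (Q₁ := fun s₂ => s₂.mem = s₁.mem ∧ s₂.out = s₁.out ∧
      s₂.reg 2 = s₁.reg 2 ∧
      s₂.reg 0 = s₁.reg 0 + σ.arity R ∧ s₂.reg 1 = s₁.reg 1) (Reaches.assign ?_ ?_) ?_
    · simp only [Expr.eval_add, Expr.eval_var, Expr.eval_const]
      omega
    · simp
    · rintro s₂ ⟨e1, e2, e3, e4, e5⟩
      refine Reaches.assign ?_ ⟨?_, ?_, ?_⟩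
      · simp only [Expr.eval_sub, Expr.eval_var, Expr.eval_one]
        omega
      · simpa [e1, e2, e3] using hJ
      · simpa [e1, e4] using h0'
      · simp [e5, h1, h1']; omega
  refine Reaches.mono (Reaches.seq (T₁ := 1 + (1 + 1)) (Q₁ := I 0) ?_ hloop) ?_ fun s hs => hs.1
  · refine Reaches.seq (Q₁ := fun s₂ => s₂.mem = s.mem ∧ s₂.out = s.out ∧
      s₂.reg 0 = relStart σ s.mem R + 1) (Reaches.assign ?_ (by simp)) ?_
    · simp only [Expr.eval_add, Expr.eval_one, eval_relStartE]; omega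
    rintro s₁ ⟨e1, e2, e3⟩
    refine Reaches.seq (Q₁ := fun s₂ => s₂.mem = s.mem ∧ s₂.out = s.out ∧
      s₂.reg 0 = relStart σ s.mem R + 1 ∧ s₂.reg 1 = (ts R).length)
      (Reaches.assign ?_ ?_) ?_
    · simp only [Expr.eval_load, eval_relStartE, e1, hval]; omega
    · simp [e1, e2, e3, hval]
    · rintro s₂ ⟨e1, e2, e3, e4⟩
      refine Reaches.assign (Nat.zero_le _) ⟨?_, ?_, ?_⟩
      · simpa [e1, e2] using h0
      · simp [e3, e1]
      · simp [e4]
  · have := hL.length_le_size R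
    nlinarith [Nat.mul_le_mul_right (T + 3) this]

namespace ConjunctiveQuery

namespace Plan

variable {σ : Schema} {V : Type*} {q : ConjunctiveQuery σ V} (P : q.Plan)

noncomputable def children (a : {a // a ∈ q.atoms}) : List {a // a ∈ q.atoms} :=
  open Classical in q.atoms.attach.toList.filter fun c => c ≠ P.root ∧ P.parent c = a

theorem mem_children {a c : {a // a ∈ q.atoms}} :
    c ∈ P.children a ↔ c ≠ P.root ∧ P.parent c = a := by
  simp [children]

/-- The value of the variable in the current tuple. -/
noncomputable def valE (a : {a // a ∈ q.atoms}) (x : V) : Expr := .load (.var 0 + .const (pos a x))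

/-- The memory cell in the region of atom `c` for the code of the current tuple of atom `a`. -/
noncomputable def cellE (a c : {a // a ∈ q.atoms}) : Expr :=
  relStartE σ σ.numRels +
    (.const (P.rank c) + .const P.bound * .ofDigits (.load 0 + 2) ((P.key c).map (valE a)))

/-- The conjunction decides `GoodTuple`: unmarked cells hold `0`, so a failed lookup in a child's
region makes the product vanish. -/
noncomputable def goodE (a : {a // a ∈ q.atoms}) : Expr :=
  .all (((List.finRange (σ.arity a.1.1)).map fun i =>
    .eq (.load (.var 0 + .const i)) (valE a (a.1.2 i))) ++
    (P.children a).map fun c => .load (P.cellE a c))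

/-- Mark the codes of the atom, and count them in register `2`. -/
noncomputable def markPass (a : {a // a ∈ q.atoms}) : Stmt :=
  -- The factor `1 - .load _` vanishes on marked codes, so no code is counted twice.
  scan σ a.1.1 (.ite (P.goodE a * (1 - .load (P.cellE a a)))
    (.seq (.store (P.cellE a a) 1) (.assign 2 (.var 2 + 1))) .skip)

noncomputable def outAll (a : {a // a ∈ q.atoms}) : List V → Stmt
  | [] => .skip
  | x :: l => .seq (.out (valE a x)) (outAll a l)

/-- Output the marked tuples of the root. -/
noncomputable def outPass : Stmt :=
  -- A mark is erased once its solution has been written, so repeated projections yield no repeated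
  -- output.
  scan σ P.root.1.1 (.ite (.load (P.cellE P.root P.root))
    (.seq (.store (P.cellE P.root P.root) 0) (outAll P.root (P.key P.root))) .skip)

/-- Process the atoms other than the root by decreasing rank. -/
noncomputable def markPasses : ℕ → Stmt
  | 0 => .skip
  | k + 1 => .seq (markPasses k) (open Classical in
      if h : ∃ a, a ≠ P.root ∧ P.rank a + k + 1 = P.bound then P.markPass (Classical.choose h)
      else .skip)

/-- A listing starts with the number of tuples, so the marks of the root are counted before any
solution is written. -/
noncomputable def program : Stmt :=
  .seq (P.markPasses P.bound) (.seq (P.markPass P.root) (.seq (.out (.var 2)) P.outPass))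

/-! ### Correctness of the evaluation program -/

variable {P} {D : Database σ} {input : List ℕ} {ts : ∀ R, List (Fin (σ.arity R) → Fin D.dom)}

section

variable (hL : D.Listing input ts) {a : {a // a ∈ q.atoms}} {s : RamState} {m : ℕ → ℕ → ℕ}
  (hs : s.mem = layout P.bound input m) {i : ℕ} (hi : i < (ts a.1.1).length)
  (h0 : s.reg 0 = relStart σ s.mem a.1.1 + 1 + σ.arity a.1.1 * i)

include hL hs hi h0

theorem eval_valE {x : V} (hx : x ∈ Set.range a.1.2) :
    (valE a x).eval s = val a (ts a.1.1)[i] x := by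
  obtain ⟨j, -, hj, hv⟩ := exists_pos a hx
  have hm : ∀ i < input.length, s.mem i = input.getD i 0 := fun i hi => by rw [hs, layout_of_lt hi]
  simp only [valE, Expr.eval_load, Expr.eval_add, Expr.eval_var, Expr.eval_const, h0, hj, hv,
    hL.mem_tuple hm _ hi]

theorem eval_cellE {c : {a // a ∈ q.atoms}} (hc : ∀ x ∈ P.key c, x ∈ Set.range a.1.2) :
    (P.cellE a c).eval s =
      input.length + (P.rank c + P.bound * keyCode D (P.key c) (val a (ts a.1.1)[i])) := by
  have hm : ∀ i < input.length, s.mem i = input.getD i 0 := fun i hi => by rw [hs, layout_of_lt hi]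
  have hmap : (P.key c).map (Expr.eval s ∘ valE a) = (P.key c).map (val a (ts a.1.1)[i]) :=
    List.map_congr_left fun x hx => eval_valE hL hs hi h0 (hc x hx)
  simp only [cellE, Expr.eval_add, eval_relStartE, hL.relStart_numRels hm, Expr.eval_const,
    Expr.eval_mul, Expr.eval_ofDigits, Expr.eval_load, Expr.eval_zero, Expr.eval_two,
    hm 0 hL.length_pos, hL.getD_zero, List.map_map, keyCode, hmap]

theorem eval_load_cellE {c : {a // a ∈ q.atoms}} (hc : ∀ x ∈ P.key c, x ∈ Set.range a.1.2) :
    (Expr.load (P.cellE a c)).eval s =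
      m (P.rank c) (keyCode D (P.key c) (val a (ts a.1.1)[i])) := by
  rw [Expr.eval_load, eval_cellE hL hs hi h0 hc, hs, layout_region (P.rank_lt c)]

theorem eval_goodE (hch : ∀ c, c ≠ P.root → P.parent c = a → m (P.rank c) = ind (P.codes D c)) :
    (P.goodE a).eval s ≠ 0 ↔ P.GoodTuple D a (ts a.1.1)[i] := by
  have hm : ∀ i < input.length, s.mem i = input.getD i 0 := fun i hi => by rw [hs, layout_of_lt hi]
  rw [goodE, Expr.eval_all_ne_zero, GoodTuple]
  simp only [List.mem_append, or_imp, forall_and, List.mem_map, List.mem_finRange, true_and,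
    forall_exists_index, forall_apply_eq_imp_iff, mem_children, and_imp]
  refine and_congr (forall_congr' fun j => ?_) ⟨fun h c hc hca => ?_, ?_⟩
  · rw [Expr.eval_eq_ne_zero, eval_valE hL hs hi h0 ⟨j, rfl⟩]
    simp only [Expr.eval_load, Expr.eval_add, Expr.eval_var, Expr.eval_const, h0,
      hL.mem_tuple hm _ hi]
  · have := h _ c hc hca rfl
    rwa [eval_load_cellE hL hs hi h0 fun x hx => hca ▸ P.mem_parent_of_mem_key c hc x hx,
      hch c hc hca, ind_ne_zero] at this
  · rintro h _ c hc hca rfl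
    rw [eval_load_cellE hL hs hi h0 fun x hx => hca ▸ P.mem_parent_of_mem_key c hc x hx,
      hch c hc hca, ind_ne_zero]
    exact h c hc hca

theorem eval_goodE_mul (hch : ∀ c, c ≠ P.root → P.parent c = a → m (P.rank c) = ind (P.codes D c))
    {S : Set ℕ} (hS : m (P.rank a) = ind S) :
    (P.goodE a * (1 - .load (P.cellE a a))).eval s ≠ 0 ↔ P.GoodTuple D a (ts a.1.1)[i] ∧
      keyCode D (P.key a) (val a (ts a.1.1)[i]) ∉ S := by
  rw [Expr.eval_mul, Nat.mul_ne_zero_iff, eval_goodE hL hs hi h0 hch, Expr.eval_sub, Expr.eval_one,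
    eval_load_cellE hL hs hi h0 (P.mem_of_mem_key a), hS, ← not_iff_not.2 ind_ne_zero]
  have := ind_le S (keyCode D (P.key a) (val a (ts a.1.1)[i]))
  refine and_congr_right fun _ => ?_
  omega

end

/-- The codes found among the first `i` tuples. -/
noncomputable def found (P : q.Plan) (D : Database σ) (a : {a // a ∈ q.atoms})
    (l : List (Fin (σ.arity a.1.1) → Fin D.dom)) : Finset ℕ :=
  open Classical in ((l.filter fun t => P.GoodTuple D a t).map fun t =>
    keyCode D (P.key a) (val a t)).toFinset

theorem found_append (a : {a // a ∈ q.atoms}) (l : List (Fin (σ.arity a.1.1) → Fin D.dom)) (t) :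
    P.found D a (l ++ [t]) = open Classical in if P.GoodTuple D a t then
      insert (keyCode D (P.key a) (val a t)) (P.found D a l) else P.found D a l := by
  classical
  unfold found
  split_ifs with h
  · ext x
    simp [h]
  · ext x
    simp [h]

theorem coe_found (hL : D.Listing input ts) (a : {a // a ∈ q.atoms}) :
    (P.found D a (ts a.1.1) : Set ℕ) = P.codes D a := by
  classical
  rw [codes_eq]
  ext x
  simp [found, hL.mem_iff, and_assoc, eq_comm]

theorem card_found_le (a : {a // a ∈ q.atoms}) (l : List (Fin (σ.arity a.1.1) → Fin D.dom)) :
    (P.found D a l).card ≤ l.length := by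
  classical
  unfold found
  refine (List.toFinset_card_le _).trans ?_
  rw [List.length_map]
  exact List.length_filter_le _ _

/-- After `i` tuples the region of `a` marks the codes found among them and register `2` holds their
number; the regions of the children already contain their codes. -/
theorem reaches_markPass (hL : D.Listing input ts) (a : {a // a ∈ q.atoms}) {s : RamState}
    {m : ℕ → ℕ → ℕ} (hs : s.mem = layout P.bound input m)
    (hch : ∀ c, c ≠ P.root → P.parent c = a → m (P.rank c) = ind (P.codes D c))
    (ha : m (P.rank a) = fun _ => 0) :
    Reaches (inputMagnitude input + 1) (P.markPass a) s (10 * (D.size + 1)) fun s' =>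
      s'.mem = layout P.bound input (Function.update m (P.rank a) (ind (P.codes D a))) ∧
      s'.reg 2 = (P.codes D a).ncard ∧ s'.out = s.out := by
  have key := reaches_scan hL (R := a.1.1) (B := inputMagnitude input + 1) (T := 3) (s := s)
    (body := .ite (P.goodE a * (1 - .load (P.cellE a a)))
      (.seq (.store (P.cellE a a) 1) (.assign 2 (.var 2 + 1))) .skip) (by omega)
    (fun i mem out n => mem = layout P.bound input (Function.update m (P.rank a)
      (ind (P.found D a ((ts a.1.1).take i)))) ∧ n = (P.found D a ((ts a.1.1).take i)).card ∧
      out = s.out)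
    (fun i mem out n h x hx => by rw [h.1, layout_of_lt hx])
    ⟨by rw [hs]; congr 1; rw [eq_comm, Function.update_eq_self_iff, ha]; simp [found, ind_empty],
      by simp [found], rfl⟩ ?_
  · refine key.mono le_rfl fun s' h => ?_
    rw [List.take_length, coe_found hL] at h
    rw [← coe_found hL, Set.ncard_coe_finset, coe_found hL]
    exact h
  · rintro i s₁ hi ⟨h1, h2, h3⟩ h0
    -- Atoms own disjoint regions, so marking codes of `a` leaves the lookups in the children's
    -- regions intact.
    have hrank : ∀ c, c ≠ P.root → P.parent c = a → P.rank c ≠ P.rank a := fun c hc hca => by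
      have := P.rooted.lt c hc
      rw [hca] at this
      omega
    have hcond := eval_goodE_mul hL h1 hi h0 (fun c hc hca => by
      rw [Function.update_of_ne (hrank c hc hca), hch c hc hca]) (Function.update_self _ _ _)
    have hcell := eval_cellE hL h1 hi h0 (P.mem_of_mem_key a)
    rw [List.take_succ_eq_append_getElem hi, found_append]
    have hcard := P.card_found_le a ((ts a.1.1).take i)
    rw [List.length_take] at hcard
    have hlm := hL.length_le_magnitude a.1.1
    refine Reaches.ite (T := 1 + 1) (fun hne => ?_) fun hz => ?_
    · obtain ⟨hg, hnot⟩ := hcond.1 hne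
      rw [if_pos hg]
      refine Reaches.seq (Q₁ := fun s₂ => s₂.reg = s₁.reg ∧ s₂.out = s₁.out ∧ s₂.mem =
        Function.update s₁.mem ((P.cellE a a).eval s₁) 1) (Reaches.store (by simp) (by simp)) ?_
      rintro s₂ ⟨e1, e2, e3⟩
      refine Reaches.assign ?_ ⟨⟨?_, ?_, ?_⟩, ?_, ?_⟩
      · simp only [Expr.eval_add, Expr.eval_var, Expr.eval_one, e1, h2]; omega
      · simp only [e3]
        rw [hcell, h1, update_layout (P.rank_lt a)]
        simp only [Function.update_self, Function.update_idem, update_ind_one, Finset.coe_insert]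
      · simp only [Function.update_self, Expr.eval_add, Expr.eval_var, Expr.eval_one, e1, h2]
        rw [Finset.card_insert_of_notMem (by simpa using hnot)]
      · simp [e2, h3]
      · simp [e1]
      · simp [e1]
    -- The test fails if the tuple is not good or its code is already marked; in both cases the set
    -- of codes found does not change.
    · refine (Reaches.skip ?_).mono (by omega) fun _ h => h
      refine ⟨⟨?_, ?_, h3⟩, rfl, rfl⟩
      all_goals
        split_ifs with hg
        · have hin : keyCode D (P.key a) (val a (ts a.1.1)[i]) ∈
              P.found D a ((ts a.1.1).take i) := by
            by_contra hnot
            exact hcond.2 ⟨hg, by simpa using hnot⟩ hz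
          rw [Finset.insert_eq_of_mem hin]
          assumption
        · assumption

theorem reaches_outAll (hL : D.Listing input ts) {a : {a // a ∈ q.atoms}} {s : RamState}
    {m : ℕ → ℕ → ℕ} (hs : s.mem = layout P.bound input m) {i : ℕ} (hi : i < (ts a.1.1).length)
    (h0 : s.reg 0 = relStart σ s.mem a.1.1 + 1 + σ.arity a.1.1 * i) {B : ℕ} (l : List V)
    (hl : ∀ x ∈ l, x ∈ Set.range a.1.2) :
    Reaches B (outAll a l) s (l.length + 1) fun s' => s'.mem = s.mem ∧ s'.reg = s.reg ∧
      s'.out = s.out ++ l.map (val a (ts a.1.1)[i]) := by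
  induction l generalizing s with
  | nil => exact Reaches.skip ⟨rfl, rfl, by simp⟩
  | cons x l ih =>
    refine Reaches.mono (T := 1 + (l.length + 1)) (Q := fun s' => s'.mem = s.mem ∧ s'.reg = s.reg ∧
      s'.out = s.out ++ (x :: l).map (val a (ts a.1.1)[i])) ?_ ?_ fun _ h => h
    · refine Reaches.seq (Q₁ := fun s' => s'.mem = s.mem ∧ s'.reg = s.reg ∧
        s'.out = s.out ++ [val a (ts a.1.1)[i] x]) (Reaches.out ⟨rfl, rfl, ?_⟩) ?_
      · rw [eval_valE hL hs hi h0 (hl x List.mem_cons_self)]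
      · rintro s₁ ⟨e1, e2, e3⟩
        refine (ih (s := s₁) (e1 ▸ hs) (by rw [e2, e1]; exact h0)
          fun y hy => hl y (List.mem_cons_of_mem _ hy)).mono le_rfl ?_
        rintro s₂ ⟨f1, f2, f3⟩
        exact ⟨f1.trans e1, f2.trans e2, by rw [f3, e3]; simp⟩
    · rw [List.length_cons]; omega

/-- The code of a solution. -/
def solCode (D : Database σ) (b : Fin q.arity → Fin D.dom) : ℕ :=
  Nat.ofDigits (D.dom + 2) (List.ofFn fun i => (b i : ℕ))

theorem solCode_injective : Function.Injective (solCode (q := q) D) := by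
  intro b b' h
  have := Nat.ofDigits_inj_of_len_eq (b := D.dom + 2) (by omega) (by simp) (by
    simp only [List.mem_ofFn, forall_exists_index, forall_apply_eq_imp_iff]
    exact fun i => (b i).2.trans (by omega)) (by
    simp only [List.mem_ofFn, forall_exists_index, forall_apply_eq_imp_iff]
    exact fun i => (b' i).2.trans (by omega)) h
  exact funext fun i => Fin.ext (congrFun (List.ofFn_injective this) i)

/-- Invariant: the marks of the root are the codes of exactly those solutions that have not yet been
written. At the end all are written, and their number agrees with the count announced before. -/
theorem reaches_outPass (hL : D.Listing input ts) {s : RamState}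
    {m : ℕ → ℕ → ℕ} (hs : s.mem = layout P.bound input m)
    (ha : m (P.rank P.root) = ind (P.codes D P.root)) (ho : s.out = [(P.codes D P.root).ncard]) :
    Reaches (inputMagnitude input + 1) P.outPass s ((q.arity + 10) * (D.size + 1)) fun s' =>
      EncodesRelation (q.solutions D) s'.out := by
  classical
  have hfree : ∀ i, q.free i ∈ Set.range P.root.1.2 := fun i => by
    refine P.mem_of_mem_key _ _ ?_
    rw [P.key_root, List.mem_ofFn]
    exact ⟨i, rfl⟩
  have hlt : ∀ (t : Fin (σ.arity P.root.1.1) → Fin D.dom) i,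
      val P.root t (q.free i) < D.dom := fun t i => by
    obtain ⟨j, -, -, h⟩ := exists_pos P.root (hfree i)
    rw [h]
    exact (t j).2
  let b : (Fin (σ.arity P.root.1.1) → Fin D.dom) → Fin q.arity → Fin D.dom := fun t i =>
    ⟨val P.root t (q.free i), hlt t i⟩
  have hmap : ∀ t : Fin (σ.arity P.root.1.1) → Fin D.dom,
      (P.key P.root).map (val P.root t) = List.ofFn fun i => (b t i : ℕ) := fun t => by
    rw [P.key_root, List.map_ofFn]; rfl
  have hcode : ∀ t : Fin (σ.arity P.root.1.1) → Fin D.dom,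
      keyCode D (P.key P.root) (val P.root t) = solCode D (b t) := fun t => by
    rw [keyCode, hmap]; rfl
  have key := reaches_scan hL (R := P.root.1.1) (B := inputMagnitude input + 1)
    (T := q.arity + 3) (s := s)
    (body := .ite (.load (P.cellE P.root P.root))
      (.seq (.store (P.cellE P.root P.root) 0) (outAll P.root (P.key P.root))) .skip) (by omega)
    (fun i mem out _ => ∃ bs : List (Fin q.arity → Fin D.dom), bs.Nodup ∧
      (∀ b ∈ bs, b ∈ q.solutions D) ∧
      (∀ t ∈ (ts P.root.1.1).take i, b t ∈ q.solutions D → b t ∈ bs) ∧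
      mem = layout P.bound input (Function.update m (P.rank P.root)
        (ind (P.codes D P.root \ {x : ℕ | ∃ b ∈ bs, x = solCode D b}))) ∧
      out = (P.codes D P.root).ncard :: bs.flatMap fun a => List.ofFn fun i => (a i : ℕ))
    (fun i mem out n ⟨_, _, _, _, h, _⟩ x hx => by rw [h, layout_of_lt hx])
    ⟨[], List.nodup_nil, by simp, by simp, by
      rw [hs]; congr 1; rw [eq_comm, Function.update_eq_self_iff, ha]; simp, by simp [ho]⟩ ?_
  · refine key.mono le_rfl ?_
    rintro s' ⟨bs, h1, h2, h3, -, h4⟩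
    rw [List.take_length] at h3
    have hmem : ∀ x, x ∈ bs ↔ x ∈ q.solutions D := by
      refine fun x => ⟨h2 x, fun hx => ?_⟩
      have hx' := mem_codes_root (P := P).2 hx
      rw [codes_eq] at hx'
      obtain ⟨t, ht, -, hxt⟩ := hx'
      rw [hcode] at hxt
      have : x = b t := solCode_injective hxt
      rw [this] at hx ⊢
      exact h3 t ((hL.mem_iff _ _).2 ht) hx
    refine ⟨bs, h1, hmem, ?_⟩
    rw [h4]
    congr 1
    have : P.codes D P.root = (bs.map (solCode D)).toFinset := by
      ext x
      simp only [List.coe_toFinset, List.mem_map, Set.mem_ofPred_eq]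
      constructor
      · intro hx
        have hx' := hx
        rw [codes_eq] at hx
        obtain ⟨t, -, -, rfl⟩ := hx
        rw [hcode] at hx' ⊢
        exact ⟨b t, (hmem _).2 (mem_codes_root.1 hx'), rfl⟩
      · rintro ⟨y, hy, rfl⟩
        exact mem_codes_root.2 (h2 y hy)
    rw [this, Set.ncard_coe_finset, List.toFinset_card_of_nodup (h1.map solCode_injective),
      List.length_map]
  · rintro i s₁ hi ⟨bs, h1, h2, h3, h4, h5⟩ h0
    have hcell := eval_cellE hL h4 hi h0 (P.mem_of_mem_key P.root)
    have hload := eval_load_cellE hL h4 hi h0 (P.mem_of_mem_key P.root)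
    rw [Function.update_self] at hload
    have hcond : (Expr.load (P.cellE P.root P.root)).eval s₁ ≠ 0 ↔
        b (ts P.root.1.1)[i] ∈ q.solutions D ∧ b (ts P.root.1.1)[i] ∉ bs := by
      rw [hload, ind_ne_zero, hcode, Set.mem_sdiff, ← mem_codes_root (P := P)]
      refine and_congr_right fun _ => not_congr ⟨?_, fun h => ⟨_, h, rfl⟩⟩
      rintro ⟨y, hy, he⟩
      exact solCode_injective he ▸ hy
    rw [List.take_succ_eq_append_getElem hi]
    have hklen : (P.key P.root).length = q.arity := by rw [P.key_root, List.length_ofFn]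
    refine Reaches.ite (T := q.arity + 2) (fun hne => ?_) fun hz => ?_
    · obtain ⟨hsol, hnot⟩ := hcond.1 hne
      refine Reaches.mono (T := 1 + ((P.key P.root).length + 1))
        (Reaches.seq (Q₁ := fun s₂ => s₂.reg = s₁.reg ∧ s₂.out = s₁.out ∧
          s₂.mem = layout P.bound input (Function.update m (P.rank P.root)
            (ind ((P.codes D P.root \ {x : ℕ | ∃ b ∈ bs, x = solCode D b}) \
              {solCode D (b (ts P.root.1.1)[i])}))))
          (Reaches.store (by simp) ⟨rfl, rfl, ?_⟩) ?_) (by omega) fun _ h => h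
      · simp only [Expr.eval_zero]
        rw [hcell, h4, update_layout (P.rank_lt _), hcode]
        simp only [Function.update_self, Function.update_idem, update_ind_zero]
      · rintro s₂ ⟨e1, e2, e3⟩
        have hm₁ : ∀ i < input.length, s₁.mem i = input.getD i 0 := fun i hi => by
          rw [h4, layout_of_lt hi]
        have hm₂ : ∀ i < input.length, s₂.mem i = input.getD i 0 := fun i hi => by
          rw [e3, layout_of_lt hi]
        refine (reaches_outAll hL e3 hi (by rw [e1, h0, hL.relStart_congr hm₁ _ (Fin.is_le' ..),
          hL.relStart_congr hm₂ _ (Fin.is_le' ..)]) _ (P.mem_of_mem_key P.root)).mono le_rfl ?_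
        rintro s₃ ⟨f1, f2, f3⟩
        refine ⟨⟨bs ++ [b (ts P.root.1.1)[i]], ?_, ?_, ?_, ?_, ?_⟩, by rw [f2, e1], by rw [f2, e1]⟩
        · rw [List.nodup_append]
          simp only [List.nodup_singleton, List.mem_singleton]
          exact ⟨h1, trivial, by rintro x hx _ rfl rfl; exact hnot hx⟩
        · simp only [List.mem_append, List.mem_singleton]
          rintro x (hx | rfl)
          · exact h2 x hx
          · exact hsol
        · simp only [List.mem_append, List.mem_singleton]
          rintro t (ht | rfl) hb
          · exact .inl (h3 t ht hb)
          · exact .inr rfl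
        · rw [f1, e3, Set.sdiff_sdiff]
          congr 3
          ext x
          simp only [Set.mem_sdiff, Set.mem_union, Set.mem_ofPred_eq, Set.mem_singleton_iff,
            List.mem_append,
            List.mem_singleton, or_and_right, exists_or, exists_eq_left]
        · rw [f3, e2, h5, hmap]
          simp
    · refine (Reaches.skip ?_).mono (by omega) fun _ h => h
      refine ⟨⟨bs, h1, h2, ?_, h4, h5⟩, rfl, rfl⟩
      simp only [List.mem_append, List.mem_singleton]
      rintro t (ht | rfl) hb
      · exact h3 t ht hb
      · by_contra hnot
        exact hcond.2 ⟨hb, hnot⟩ hz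

/-- Children have larger rank than their parents, so they are finished when an atom is processed.
The root is left out, and its region stays clear, because it is marked by a final pass whose count
is written out. -/
theorem reaches_markPasses (hL : D.Listing input ts) (k : ℕ) :
    Reaches (inputMagnitude input + 1) (P.markPasses k) (.init input)
      ((10 * k + 1) * (D.size + 1)) fun s => s.out = [] ∧ ∃ m, s.mem = layout P.bound input m ∧
      (∀ a, a ≠ P.root → P.bound ≤ P.rank a + k → m (P.rank a) = ind (P.codes D a)) ∧
      ∀ a, a = P.root ∨ P.rank a + k < P.bound → m (P.rank a) = fun _ => 0 := by
  classical
  induction k with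
  | zero =>
    refine Reaches.mono (Reaches.skip ⟨rfl, fun _ _ => 0, layout_zero.symm, fun a _ h => ?_,
      fun _ _ => rfl⟩) (by omega) fun _ h => h
    have := P.rank_lt a
    omega
  | succ k ih =>
    refine (ih.seq (T₂ := 10 * (D.size + 1)) ?_).mono (by
      rw [← add_mul]; exact Nat.mul_le_mul_right _ (by omega)) fun _ h => h
    rintro s ⟨ho, m, hm, h1, h2⟩
    split_ifs with h
    · obtain ⟨har, hk⟩ := Classical.choose_spec h
      set a := Classical.choose h
      refine (reaches_markPass hL a hm (fun c hc hca => h1 c hc ?_) (h2 a (.inr (by omega)))).mono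
        le_rfl ?_
      · have := P.rooted.lt c hc
        rw [hca] at this
        omega
      rintro s' ⟨e1, -, e2⟩
      refine ⟨e2.trans ho, _, e1, fun c hc hck => ?_, fun c hc => ?_⟩
      · by_cases hca : c = a
        · rw [hca, Function.update_self]
        · have hne : P.rank c ≠ P.rank a := fun h => hca (P.rooted.inj h)
          rw [Function.update_of_ne hne]
          exact h1 c hc (by omega)
      · rw [Function.update_of_ne]
        · exact h2 c (hc.imp_right fun h => by omega)
        · intro he
          rcases hc with hc | hc
          · exact har ((P.rooted.inj he).symm.trans hc)
          · omega
    · refine (Reaches.skip ⟨ho, m, hm, fun c hc hck => h1 c hc ?_, fun c hc => h2 c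
        (hc.imp_right fun h => by omega)⟩).mono (by omega) fun _ h => h
      by_contra hlt
      exact h ⟨c, hc, by omega⟩

theorem reaches_program (hL : D.Listing input ts) :
    Reaches (inputMagnitude input + 1) P.program (.init input)
      ((10 * P.bound + q.arity + 22) * (D.size + 1))
      fun s => EncodesRelation (q.solutions D) s.out := by
  refine Reaches.mono (T := (10 * P.bound + 1) * (D.size + 1) + (10 * (D.size + 1) +
    (1 + (q.arity + 10) * (D.size + 1)))) ?_ (by nlinarith) fun _ h => h
  refine (reaches_markPasses hL P.bound).seq ?_
  rintro s₁ ⟨ho, m, hm, h1, h2⟩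
  refine (reaches_markPass hL P.root hm (fun c hc _ => h1 c hc (by omega))
    (h2 _ (.inl rfl))).seq ?_
  rintro s₂ ⟨e1, e2, e3⟩
  refine Reaches.seq (Q₁ := fun s₃ => s₃.mem = s₂.mem ∧ s₃.out = [(P.codes D P.root).ncard])
    (Reaches.out ⟨rfl, by simp [e2, e3, ho]⟩) ?_
  rintro s₃ ⟨f1, f2⟩
  exact reaches_outPass hL (f1.trans e1) (Function.update_self _ _ _) f2

end Plan

theorem IsAcyclic.evaluableInLinearTime {σ : Schema} {V : Type*} [Finite V]
    {q : ConjunctiveQuery σ V} (h : q.IsAcyclic)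
    (hq : q.arity = 0 ∨ q.arity = 1) : q.EvaluableInLinearTime := by
  obtain ⟨P⟩ := h.exists_plan hq
  refine ⟨P.program.code, (1 + 2) ^ P.program.deg + 1 * P.program.deg +
    P.program.cost * (10 * P.bound + q.arity + 22), fun D input hin => ?_⟩
  obtain ⟨ts, hL⟩ := hin.exists_listing
  exact Reaches.runs (C := 1) (B := inputMagnitude input + 1) (by simp)
    (fun i => (getD_le_inputMagnitude input i).trans (Nat.le_succ _)) (Plan.reaches_program hL)

end ConjunctiveQuery

/-! ## From hypergraphs to databases -/

/-- Append an element that is not there yet. -/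
noncomputable def appendNew {α : Type*} (l : List α) (a : α) : List α :=
  open Classical in if a ∈ l then l else l ++ [a]

section appendNew

variable {α : Type*}

theorem nodup_appendNew {l : List α} (h : l.Nodup) (a : α) : (appendNew l a).Nodup := by
  unfold appendNew
  split_ifs with ha
  · exact h
  · rw [List.nodup_append]
    refine ⟨h, List.nodup_singleton a, ?_⟩
    rintro x hx y hy rfl
    exact ha (List.mem_singleton.1 hy ▸ hx)

theorem mem_appendNew {l : List α} {a b : α} : b ∈ appendNew l a ↔ b ∈ l ∨ b = a := by
  unfold appendNew
  split_ifs with ha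
  · exact ⟨.inl, fun h => h.elim id fun h => h ▸ ha⟩
  · simp

theorem nodup_foldl_appendNew (l' l : List α) (h : l.Nodup) : (l'.foldl appendNew l).Nodup := by
  induction l' generalizing l with
  | nil => exact h
  | cons a l' ih => exact ih _ (nodup_appendNew h a)

theorem mem_foldl_appendNew (l' l : List α) {b : α} :
    b ∈ l'.foldl appendNew l ↔ b ∈ l ∨ b ∈ l' := by
  induction l' generalizing l with
  | nil => simp
  | cons a l' ih => rw [List.foldl_cons, ih, mem_appendNew, List.mem_cons, or_assoc]

theorem length_le_foldl_appendNew (l' l : List α) : l.length ≤ (l'.foldl appendNew l).length := by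
  induction l' generalizing l with
  | nil => simp
  | cons a l' ih =>
    refine le_trans ?_ (ih _)
    unfold appendNew
    split_ifs <;> simp

theorem length_foldl_appendNew_le (l' l : List α) :
    (l'.foldl appendNew l).length ≤ l.length + l'.length := by
  induction l' generalizing l with
  | nil => simp
  | cons a l' ih =>
    refine (ih _).trans ?_
    have : (appendNew l a).length ≤ l.length + 1 := by
      unfold appendNew
      split_ifs <;> simp
    rw [List.length_cons]
    omega

end appendNew

namespace ConjunctiveQuery

variable {σ : Schema} {V : Type*}

/-- A role map of the query, with a numbering of the variables. -/
structure RoleData (q : ConjunctiveQuery σ V) where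
  k : ℕ
  ρ : V → Option (Fin k)
  le_k : 3 ≤ k
  isRoleMap : IsRoleMap (fun a : {a // a ∈ q.atoms} => Set.range a.1.2) k ρ
  N : ℕ
  ix : V → Fin N
  ix_injective : Function.Injective ix

theorem exists_roleData [Finite V] {q : ConjunctiveQuery σ V} (h : ¬ q.IsAcyclic) :
    Nonempty q.RoleData := by
  obtain ⟨k, hk, ρ, hρ⟩ := q.hasRoleMap_of_not_isAcyclic h
  obtain ⟨N, ⟨e⟩⟩ := Finite.exists_equiv_fin V
  exact ⟨⟨k, ρ, hk, hρ, N, e, e.injective⟩⟩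

namespace RoleData

variable {q : ConjunctiveQuery σ V} (P : q.RoleData)

/-- An atom with relation symbol `R`, and a choice of nodes of a hyperedge for the roles. -/
structure Template (R : Fin σ.numRels) where
  vars : Fin (σ.arity R) → V
  mem : ⟨R, vars⟩ ∈ q.atoms
  node : Fin P.k → Fin (P.k - 1)
  -- Only roles that occur in the atom need distinct nodes. Every atom misses a role, so the `k - 1`
  -- nodes of a hyperedge are enough.
  inj : ∀ i ∈ Set.range vars, ∀ j ∈ Set.range vars, ∀ a b, P.ρ i = some a → P.ρ j = some b →
    node a = node b → a = b

theorem finite_template [Finite V] (R : Fin σ.numRels) : Finite (P.Template R) :=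
  Finite.of_injective (fun T => (T.vars, T.node)) fun T T' h => by
    cases T; cases T'; simp_all

noncomputable def templates [Finite V] (R : Fin σ.numRels) : List (P.Template R) :=
  have := P.finite_template R
  have := Fintype.ofFinite (P.Template R)
  Finset.univ.toList

theorem mem_templates [Finite V] {R : Fin σ.numRels} (T : P.Template R) : T ∈ P.templates R := by
  simp [templates]

variable {n : ℕ}

/-- The node of the hyperedge `e` that is chosen for a variable. -/
def nodeOf {R : Fin σ.numRels} (T : P.Template R) (e : List (Fin n)) (x : V) : ℕ :=
  -- Variables without a role always get `0`. To have this value also when `n = 0`, each tag is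
  -- given `n + 1` values.
  (P.ρ x).elim 0 fun j => (e.map Fin.val).getD (T.node j) 0

theorem getD_val_le (e : List (Fin n)) (i : ℕ) : (e.map Fin.val).getD i 0 ≤ n := by
  by_cases h : i < e.length
  · rw [List.getD_eq_getElem _ _ (by simpa using h), List.getElem_map]
    exact (e[i]).2.le
  · rw [List.getD_eq_default _ _ (by simpa using h)]
    exact Nat.zero_le _

theorem nodeOf_lt {R : Fin σ.numRels} (T : P.Template R) (e : List (Fin n)) (x : V) :
    P.nodeOf T e x < n + 1 := by
  unfold nodeOf
  cases P.ρ x with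
  | none => exact Nat.succ_pos _
  | some j => exact Nat.lt_succ_of_le (getD_val_le e _)

theorem pair_lt {a v n N : ℕ} (ha : a < N) (hv : v < n + 1) : a * (n + 1) + v < N * (n + 1) := by
  have : (a + 1) * (n + 1) ≤ N * (n + 1) := Nat.mul_le_mul_right _ ha
  rw [add_mul, one_mul] at this
  omega

/-- The fact for a template and a hyperedge. The domain elements are pairs of a variable and a
node. -/
def fact {R : Fin σ.numRels} (T : P.Template R) (e : List (Fin n)) (i : Fin (σ.arity R)) :
    Fin (P.N * (n + 1)) :=
  ⟨P.ix (T.vars i) * (n + 1) + P.nodeOf T e (T.vars i), pair_lt (P.ix _).2 (P.nodeOf_lt T e _)⟩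

variable [Finite V]

noncomputable def candidates (R : Fin σ.numRels) (es : List (List (Fin n))) :
    List (Fin (σ.arity R) → Fin (P.N * (n + 1))) :=
  es.flatMap fun e => (P.templates R).map fun T => P.fact T e

/-- The exact list, in the order in which the program writes it, so that it can be compared with the
memory contents cell by cell. -/
noncomputable def facts (R : Fin σ.numRels) (es : List (List (Fin n))) :
    List (Fin (σ.arity R) → Fin (P.N * (n + 1))) :=
  (P.candidates R es).foldl appendNew []

theorem mem_facts {R : Fin σ.numRels} {es : List (List (Fin n))} {t} :
    t ∈ P.facts R es ↔ ∃ e ∈ es, ∃ T : P.Template R, P.fact T e = t := by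
  rw [facts, mem_foldl_appendNew]
  simp [candidates, mem_templates]

theorem length_facts_le (R : Fin σ.numRels) (es : List (List (Fin n))) :
    (P.facts R es).length ≤ (P.templates R).length * es.length := by
  refine (length_foldl_appendNew_le _ _).trans ?_
  rw [List.length_nil, zero_add, candidates, List.length_flatMap]
  simp [mul_comm]

/-- The database that represents a hypergraph. -/
noncomputable def database (es : List (List (Fin n))) : Database σ where
  dom := P.N * (n + 1)
  rel := fun R => open Classical in (P.facts R es).toFinset

theorem mem_database_rel {es : List (List (Fin n))} {R : Fin σ.numRels}
    {t : Fin (σ.arity R) → Fin (P.N * (n + 1))} :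
    t ∈ (P.database es).rel R ↔ ∃ e ∈ es, ∃ T : P.Template R, P.fact T e = t :=
  open Classical in List.mem_toFinset.trans P.mem_facts

theorem listing_database (es : List (List (Fin n))) :
    (P.database es).Listing
      (P.N * (n + 1) :: (List.ofFn fun R => listing (P.facts R es)).flatten)
      fun R => P.facts R es where
  nodup _ := nodup_foldl_appendNew _ _ List.nodup_nil
  mem_iff _ _ := P.mem_facts.trans P.mem_database_rel.symm
  eq := rfl

/-- The number of templates depends only on the query and the role map, which makes the reduction
linear. -/
theorem size_database_le (es : List (List (Fin n))) :
    (P.database es).size ≤ (∑ R, (P.templates R).length) * es.length := by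
  classical
  rw [Database.size, Finset.sum_mul]
  refine Finset.sum_le_sum fun R _ => ?_
  refine le_trans ?_ (P.length_facts_le R es)
  exact List.toFinset_card_le _

/-! ### Solutions and hypercliques -/

/-- The solution assigns elements with the right tags to the free variables. -/
def Tagged (b : Fin q.arity → Fin (P.N * (n + 1))) : Prop :=
  ∀ i, (b i : ℕ) / (n + 1) = P.ix (q.free i)

/-- Number the clique by the roles and send each variable to itself paired with the node of its
role. An atom misses some role `i₀`, so its nodes lie in the hyperedge obtained by removing the node
of `i₀`, and the template reads off their positions in the listing of that hyperedge. -/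
theorem exists_tagged_of_hasHyperclique {E : Finset (Finset (Fin n))} {es : List (List (Fin n))}
    (hE : ∀ e ∈ E, e.card = P.k - 1) (hnodup : ∀ e ∈ es, e.Nodup)
    (hes : ∀ e, e ∈ es.map List.toFinset ↔ e ∈ E) (h : HasHyperclique P.k E) :
    ∃ b ∈ q.solutions (P.database es), P.Tagged b := by
  classical
  obtain ⟨S, hS, hSE⟩ := h
  let g : Fin P.k ≃ S := (finCongr hS.symm).trans S.equivFin.symm
  let f : V → ℕ := fun x => (P.ρ x).elim 0 fun j => ((g j).1 : ℕ)
  have hf : ∀ x, f x < n + 1 := by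
    intro x
    simp only [f]
    cases P.ρ x with
    | none => exact Nat.succ_pos _
    | some j => exact (g j).1.2.trans (Nat.lt_succ_self _)
  let μ : V → Fin (P.N * (n + 1)) := fun x => ⟨P.ix x * (n + 1) + f x, pair_lt (P.ix x).2 (hf x)⟩
  refine ⟨μ ∘ q.free, ⟨μ, ?_, rfl⟩, fun i => ?_⟩
  · rintro ⟨R, x⟩ ha
    refine P.mem_database_rel.2 ?_
    obtain ⟨i₀, hi₀⟩ := P.isRoleMap.miss ⟨_, ha⟩
    have he : S.erase (g i₀) ∈ E := hSE _ (Finset.erase_subset _ _) (by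
      rw [Finset.card_erase_of_mem (g i₀).2, hS])
    obtain ⟨e, hees, hee⟩ := List.mem_map.1 ((hes _).2 he)
    have hlen : e.length = P.k - 1 := by
      rw [← hE _ he, ← hee, List.toFinset_card_of_nodup (hnodup e hees)]
    have hk := P.le_k
    -- For the missing role any position will do; `0` exists because `k ≥ 3`.
    have hidx : ∀ j, ∃ m : Fin (P.k - 1), j ≠ i₀ → e[m]? = some (g j).1 := by
      intro j
      by_cases hj : j = i₀
      · exact ⟨⟨0, by omega⟩, fun h => absurd hj h⟩
      · have : (g j).1 ∈ e := by
          rw [← List.mem_toFinset, hee, Finset.mem_erase]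
          exact ⟨fun h => hj (g.injective (Subtype.ext h)), (g j).2⟩
        obtain ⟨m, hm⟩ := List.mem_iff_getElem?.1 this
        have hlt : m < e.length := by
          by_contra hge
          rw [List.getElem?_eq_none (by omega)] at hm
          cases hm
        exact ⟨⟨m, hlen ▸ hlt⟩, fun _ => hm⟩
    choose F hF using hidx
    have hmiss : ∀ y ∈ Set.range x, ∀ j, P.ρ y = some j → j ≠ i₀ := by
      rintro y hy j hj rfl
      exact hi₀ y hy hj
    refine ⟨e, hees, ⟨x, ha, F, ?_⟩, ?_⟩
    · intro y hy z hz a b hya hzb hab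
      have h1 := hF a (hmiss y hy a hya)
      have h2 := hF b (hmiss z hz b hzb)
      rw [hab, h2, Option.some.injEq] at h1
      exact (g.injective (Subtype.ext h1)).symm
    · funext i
      refine Fin.ext ?_
      simp only [fact, μ, nodeOf, f]
      congr 1
      cases hρ : P.ρ (x i) with
      | none => rfl
      | some j =>
        have := hF j (hmiss _ ⟨i, rfl⟩ j hρ)
        simp only [Option.elim_some, List.getD_eq_getElem?_getD, List.getElem?_map]
        erw [this]
        rfl
  · show (P.ix (q.free i) * (n + 1) + f (q.free i)) / (n + 1) = _
    rw [mul_comm, Nat.mul_add_div (Nat.succ_pos n), Nat.div_eq_of_lt (hf _), add_zero]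

/-- By minimality, a tagged solution can be turned into one that respects all tags. -/
theorem exists_assignment_of_tagged (hmin : q.IsMinimal) {es : List (List (Fin n))}
    {b : Fin q.arity → Fin (P.N * (n + 1))} (hb : b ∈ q.solutions (P.database es))
    (ht : P.Tagged b) : ∃ μ : V → Fin (P.N * (n + 1)), ∀ a ∈ q.atoms, ∃ e ∈ es,
      ∃ T : P.Template a.1, T.vars = a.2 ∧ P.fact T e = μ ∘ a.2 := by
  classical
  obtain ⟨(μ : V → Fin (P.N * (n + 1))), hμ, rfl⟩ := hb
  have htag : ∀ a ∈ q.atoms, ∃ e ∈ es, ∃ T : P.Template a.1, P.fact T e = μ ∘ a.2 := by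
    exact fun a ha => P.mem_database_rel.1 (hμ a ha)
  have hdiv : ∀ {R} (T : P.Template R) e i, (P.fact (n := n) T e i : ℕ) / (n + 1) = P.ix (T.vars i) := by
    intro R T e i
    show (_ * (n + 1) + _) / (n + 1) = _
    rw [mul_comm, Nat.mul_add_div (Nat.succ_pos n), Nat.div_eq_of_lt (P.nodeOf_lt T e _), add_zero]
  -- The tag of `μ x` is a variable `ν x`. Facts come from atoms, so `ν` preserves the atoms, and as
  -- `b` is tagged it fixes the free variables.
  have hν : ∀ x, ∃ y, (P.ix y : ℕ) = (μ x : ℕ) / (n + 1) := by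
    intro x
    obtain ⟨a, ha, i, rfl⟩ := q.occurs x
    obtain ⟨e, -, T, hT⟩ := htag a ha
    exact ⟨T.vars i, by rw [← hdiv T e i, hT]; rfl⟩
  choose ν hν using hν
  have hvars : ∀ a ∈ q.atoms, ∀ e, ∀ T : P.Template a.1, P.fact T e = μ ∘ a.2 →
      T.vars = ν ∘ a.2 := by
    intro a ha e T hT
    funext i
    refine P.ix_injective (Fin.ext ?_)
    rw [← hdiv T e i, hT, Function.comp_apply, Function.comp_apply, hν]
  have hend : q.IsEndomorphism ν := by
    intro a ha
    obtain ⟨e, -, T, hT⟩ := htag a ha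
    have := T.mem
    rwa [hvars a ha e T hT] at this
  have hinj := hmin ν hend fun i => P.ix_injective (Fin.ext (by rw [hν]; exact ht i))
  have hbij : Function.Bijective ν := Finite.injective_iff_bijective.1 hinj
  let φ := Equiv.ofBijective ν hbij
  -- An injective endomorphism permutes the finite set of atoms.
  have hsurj : ∀ a ∈ q.atoms, ∃ a' ∈ q.atoms, Atom.map ν a' = a := by
    have hmapinj : Function.Injective (Atom.map (σ := σ) ν) := by
      rintro ⟨R, x⟩ ⟨R', x'⟩ h
      simp only [Atom.map, Sigma.mk.injEq] at h
      obtain ⟨rfl, h⟩ := h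
      rw [Sigma.mk.injEq]
      exact ⟨rfl, heq_of_eq (hinj.comp_left (eq_of_heq h))⟩
    intro a ha
    have himg : q.atoms.image (Atom.map ν) = q.atoms :=
      Finset.eq_of_subset_of_card_le (Finset.image_subset_iff.2 hend)
        (Finset.card_image_of_injective _ hmapinj).ge
    rw [← himg, Finset.mem_image] at ha
    exact ha
  -- Each atom is the image under `ν` of an atom `a'`, and the fact used by `μ` for `a'` carries
  -- exactly its tags.
  refine ⟨μ ∘ φ.symm, fun a ha => ?_⟩
  obtain ⟨a', ha', rfl⟩ := hsurj a ha
  obtain ⟨e, he, T, hT⟩ := htag a' ha'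
  refine ⟨e, he, T, hvars a' ha' e T hT, hT.trans (funext fun i => ?_)⟩
  exact congrArg μ (φ.symm_apply_apply _).symm

/-- Let `g j` be the node at any variable of role `j`. For each role `i` an atom that sees all other
roles shows that their nodes are distinct and form a hyperedge. As `i` varies, these are all the
hyperedges that a hyperclique needs. -/
theorem hasHyperclique_of_tagged (hmin : q.IsMinimal) {E : Finset (Finset (Fin n))}
    {es : List (List (Fin n))} (hE : ∀ e ∈ E, e.card = P.k - 1) (hnodup : ∀ e ∈ es, e.Nodup)
    (hes : ∀ e, e ∈ es.map List.toFinset ↔ e ∈ E)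
    {b : Fin q.arity → Fin (P.N * (n + 1))} (hb : b ∈ q.solutions (P.database es))
    (ht : P.Tagged b) : HasHyperclique P.k E := by
  classical
  obtain ⟨μ, hμ⟩ := P.exists_assignment_of_tagged hmin hb ht
  have hk := P.le_k
  have hmod : ∀ {R} (T : P.Template R) e i,
      (P.fact (n := n) T e i : ℕ) % (n + 1) = P.nodeOf T e (T.vars i) := by
    intro R T e i
    show (_ * (n + 1) + _) % (n + 1) = _
    rw [mul_comm, Nat.mul_add_mod, Nat.mod_eq_of_lt (P.nodeOf_lt T e _)]
  have hlen : ∀ e ∈ es, e.length = P.k - 1 := fun e he => by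
    rw [← hE _ ((hes _).1 (List.mem_map_of_mem he)), List.toFinset_card_of_nodup (hnodup e he)]
  have hval : ∀ a ∈ q.atoms, ∃ e, ∃ (he : e ∈ es), ∃ T : P.Template a.1, T.vars = a.2 ∧
      ∀ x ∈ Set.range a.2, ∀ j, P.ρ x = some j →
        (μ x : ℕ) % (n + 1) = e[(T.node j : ℕ)]'(by rw [hlen e he]; exact (T.node j).2) := by
    intro a ha
    obtain ⟨e, he, T, hT, hf⟩ := hμ a ha
    refine ⟨e, he, T, hT, ?_⟩
    rintro _ ⟨i, rfl⟩ j hj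
    have h1 := hmod T e i
    rw [hf, hT, nodeOf, hj] at h1
    simp only [Function.comp_apply, Option.elim_some] at h1
    rw [h1, List.getD_eq_getElem _ _ (by rw [List.length_map, hlen e he]; exact (T.node j).2),
      List.getElem_map]
  -- Within one atom, variables of the same role get the same node; by connectedness of the roles
  -- this propagates through the query.
  have hconn := P.isRoleMap.connected (fun x => (μ x : ℕ) % (n + 1)) (by
    rintro ⟨a, ha⟩ x hx y hy j hxj hyj
    obtain ⟨e, he, T, -, h⟩ := hval a ha
    exact (h x hx j hxj).trans (h y hy j hyj).symm)
  have hcov : ∀ i, ∃ e, ∃ (he : e ∈ es), ∃ F : Fin P.k → Fin (P.k - 1),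
      (∀ a b, a ≠ i → b ≠ i → F a = F b → a = b) ∧ ∀ j, j ≠ i → ∀ x, P.ρ x = some j →
        (μ x : ℕ) % (n + 1) = e[(F j : ℕ)]'(by rw [hlen e he]; exact (F j).2) := by
    intro i
    obtain ⟨⟨a, ha⟩, hc⟩ := P.isRoleMap.cover i
    obtain ⟨e, he, T, hT, h⟩ := hval a ha
    refine ⟨e, he, T.node, fun c d hci hdi hcd => ?_, fun j hj x hx => ?_⟩
    · obtain ⟨x, hx, hxc⟩ := hc c hci
      obtain ⟨y, hy, hyd⟩ := hc d hdi
      exact T.inj x (hT ▸ hx) y (hT ▸ hy) c d hxc hyd hcd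
    · obtain ⟨y, hy, hyj⟩ := hc j hj
      rw [← h y hy j hyj]
      exact hconn x y j hx hyj
  have hrole : ∀ j, ∃ x, P.ρ x = some j := by
    intro j
    have : ∃ i : Fin P.k, j ≠ i := by
      by_cases h : j = ⟨0, by omega⟩
      · exact ⟨⟨1, by omega⟩, by rw [h]; simp⟩
      · exact ⟨_, h⟩
    obtain ⟨i, hi⟩ := this
    obtain ⟨a, ha⟩ := P.isRoleMap.cover i
    obtain ⟨x, -, hx⟩ := ha j hi
    exact ⟨x, hx⟩
  choose y hy using hrole
  have hlt : ∀ j, (μ (y j) : ℕ) % (n + 1) < n := by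
    intro j
    have : ∃ i : Fin P.k, j ≠ i := by
      by_cases h : j = ⟨0, by omega⟩
      · exact ⟨⟨1, by omega⟩, by rw [h]; simp⟩
      · exact ⟨_, h⟩
    obtain ⟨i, hi⟩ := this
    obtain ⟨e, he, F, -, h⟩ := hcov i
    rw [h j hi _ (hy j)]
    exact Fin.is_lt _
  let g : Fin P.k → Fin n := fun j => ⟨_, hlt j⟩
  have hedge : ∀ i, (Finset.univ.erase i).image g ∈ E ∧
      Set.InjOn g (Finset.univ.erase i : Finset (Fin P.k)) := by
    intro i
    obtain ⟨e, he, F, hF, h⟩ := hcov i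
    have hg : ∀ j, j ≠ i → g j = e[(F j : ℕ)]'(by rw [hlen e he]; exact (F j).2) := fun j hj =>
      Fin.ext (h j hj _ (hy j))
    have hinj : Set.InjOn g (Finset.univ.erase i : Finset (Fin P.k)) := by
      intro c hc d hd hcd
      simp only [Finset.coe_erase, Finset.coe_univ, Set.mem_sdiff, Set.mem_univ, true_and,
        Set.mem_singleton_iff] at hc hd
      rw [hg c hc, hg d hd, (hnodup e he).getElem_inj_iff] at hcd
      exact hF c d hc hd (Fin.ext hcd)
    refine ⟨?_, hinj⟩
    have hee := (hes _).1 (List.mem_map_of_mem he)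
    convert hee using 1
    refine Finset.eq_of_subset_of_card_le ?_ ?_
    · intro v hv
      obtain ⟨j, hj, rfl⟩ := Finset.mem_image.1 hv
      rw [hg j (Finset.ne_of_mem_erase hj), List.mem_toFinset]
      exact List.getElem_mem _
    · rw [hE _ hee, Finset.card_image_of_injOn hinj, Finset.card_erase_of_mem (Finset.mem_univ _),
        Finset.card_univ, Fintype.card_fin]
  -- Two roles avoid a third one because `k ≥ 3`, so they are separated by the hyperedge of that
  -- third role.
  have hinj : Function.Injective g := by
    intro c d hcd
    have : ∃ i : Fin P.k, c ≠ i ∧ d ≠ i := by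
      have hlt : ({c, d} : Finset (Fin P.k)).card < Fintype.card (Fin P.k) := by
        rw [Fintype.card_fin]
        exact Finset.card_le_two.trans_lt hk
      obtain ⟨i, hi⟩ := Finset.exists_mem_notMem_of_card_lt_card
        (s := {c, d}) (t := Finset.univ) (by rwa [Finset.card_univ])
      simp only [Finset.mem_insert, Finset.mem_singleton, not_or] at hi
      exact ⟨i, Ne.symm hi.2.1, Ne.symm hi.2.2⟩
    obtain ⟨i, hc, hd⟩ := this
    exact (hedge i).2 (by simp [hc]) (by simp [hd]) hcd
  refine ⟨Finset.univ.image g, ?_, fun e he hcard => ?_⟩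
  · rw [Finset.card_image_of_injective _ hinj, Finset.card_univ, Fintype.card_fin]
  · have hlt : e.card < (Finset.univ.image g).card := by
      rw [Finset.card_image_of_injective _ hinj, Finset.card_univ, Fintype.card_fin]
      omega
    obtain ⟨v, hv, hve⟩ := Finset.exists_mem_notMem_of_card_lt_card hlt
    obtain ⟨i, -, rfl⟩ := Finset.mem_image.1 hv
    have : e = (Finset.univ.erase i).image g := by
      refine Finset.eq_of_subset_of_card_le (fun v hv' => ?_) ?_
      · obtain ⟨j, -, rfl⟩ := Finset.mem_image.1 (he hv')
        exact Finset.mem_image_of_mem _ (Finset.mem_erase.2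
          ⟨by rintro rfl; exact hve hv', Finset.mem_univ _⟩)
      · rw [hcard, Finset.card_image_of_injective _ hinj,
          Finset.card_erase_of_mem (Finset.mem_univ _), Finset.card_univ, Fintype.card_fin]
    rw [this]
    exact (hedge i).1

end RoleData

end ConjunctiveQuery

/-! ## The program that writes the database -/

theorem List.update_getD_length (w : List ℕ) (v : ℕ) :
    (Function.update (fun i => w.getD i 0) w.length v) = fun i => (w ++ [v]).getD i 0 := by
  funext i
  rcases lt_trichotomy i w.length with h | rfl | h
  · rw [Function.update_of_ne h.ne, List.getD_append _ _ _ _ h]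
  · simp
  · rw [Function.update_of_ne h.ne', List.getD_eq_default _ _ h.le, List.getD_eq_default]
    simpa using h

theorem List.update_getD_append_cons (w l : List ℕ) (c v : ℕ) :
    (Function.update (fun i => (w ++ c :: l).getD i 0) w.length v) =
      fun i => (w ++ v :: l).getD i 0 := by
  funext i
  rcases lt_trichotomy i w.length with h | rfl | h
  · rw [Function.update_of_ne h.ne, List.getD_append _ _ _ _ h, List.getD_append _ _ _ _ h]
  · simp
  · rw [Function.update_of_ne h.ne', List.getD_append_right _ _ _ _ h.le,
      List.getD_append_right _ _ _ _ h.le]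
    obtain ⟨j, hj⟩ : ∃ j, i - w.length = j + 1 := ⟨i - w.length - 1, by omega⟩
    rw [hj, List.getD_cons_succ, List.getD_cons_succ]

namespace ConjunctiveQuery.RoleData

variable {σ : Schema} {V : Type*} {q : ConjunctiveQuery σ V} (P : q.RoleData)

/-- The length of the input. -/
def lenE : Expr := 2 + .const (P.k - 1) * .load 1

/-- The memory cell that stands for cell `e` of the simulated memory. -/
def simE (e : Expr) : Expr := P.lenE + (.const σ.numRels + .const (σ.numRels + 1) * e)

/-- Append a number to the listing of the database. Register `4` holds the length. -/
def push (e : Expr) : Stmt := .seq (.store (P.simE (.var 4)) e) (.assign 4 (.var 4 + 1))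

def pushAll : List Expr → Stmt
  | [] => .skip
  | e :: l => .seq (P.push e) (pushAll l)

/-- An element of a fact. Register `0` points to the current hyperedge. -/
def elemE {R : Fin σ.numRels} (T : P.Template R) (i : Fin (σ.arity R)) : Expr :=
  .const (P.ix (T.vars i)) * (.load 0 + 1) +
    (P.ρ (T.vars i)).elim 0 fun j => .load (.var 0 + .const (T.node j))

/-- The memory cell that marks the presence of a fact. -/
def markE {R : Fin σ.numRels} (T : P.Template R) : Expr :=
  P.lenE + (.const R + .const (σ.numRels + 1) *
    .ofDigits (.const P.N * (.load 0 + 1) + 2) ((List.finRange (σ.arity R)).map (P.elemE T)))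

/-- Append a fact, unless it is there, and count it. Register `6` points to the counter. -/
def addFact {R : Fin σ.numRels} (T : P.Template R) : Stmt :=
  .ite (.load (P.markE T)) .skip (.seq (.store (P.markE T) 1)
    (.seq (P.pushAll ((List.finRange (σ.arity R)).map (P.elemE T)))
      (.store (P.simE (.var 6)) (.load (P.simE (.var 6)) + 1))))

def addFacts {R : Fin σ.numRels} : List (P.Template R) → Stmt
  | [] => .skip
  | T :: l => .seq (P.addFact T) (addFacts l)

/-- The number of distinct facts is known only at the end, but precedes them in the listing. It is
therefore written as `0` and incremented in place, at the position kept in register `6`. -/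
noncomputable def addRel [Finite V] (R : Fin σ.numRels) : Stmt :=
  .seq (.seq (.assign 6 (.var 4)) (.seq (P.push 0) (.seq (.assign 0 2) (.assign 2 (.load 1)))))
    (.loop 2 (.seq (P.addFacts (P.templates R))
      (.seq (.assign 0 (.var 0 + .const (P.k - 1))) (.assign 2 (.var 2 - 1)))))

noncomputable def addRels [Finite V] : ℕ → Stmt
  | 0 => P.push (.const P.N * (.load 0 + 1))
  | j + 1 => .seq (addRels j) (if h : j < σ.numRels then P.addRel ⟨j, h⟩ else .skip)

/-- The listing `w` has been written. -/
structure Built (σ : Schema) (input : List ℕ) (s : RamState) (m : ℕ → ℕ → ℕ) (w : List ℕ) :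
    Prop where
  -- Region `R` below `σ.numRels` marks the facts of relation `R` already written; region
  -- `σ.numRels` receives the listing.
  mem : s.mem =
    layout (σ.numRels + 1) input (Function.update m σ.numRels fun i => w.getD i 0)
  ptr : s.reg 4 = w.length
  -- The simulation that follows needs zeros in the odd registers and in the registers `8` and `10`.
  reg : ∀ x, x ≠ 0 → x ≠ 2 → x ≠ 4 → x ≠ 6 → s.reg x = 0
  out : s.out = []

/-- `input` lists the hyperedges `es`. -/
structure EdgeListing {n : ℕ} (es : List (List (Fin n))) (input : List ℕ) : Prop where
  length_eq : ∀ e ∈ es, e.length = P.k - 1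
  eq : input = n :: es.length :: es.flatten.map Fin.val

/-! ### Correctness of the program that writes the database -/

section

variable {P} {n : ℕ} {es : List (List (Fin n))} {input : List ℕ} (hin : P.EdgeListing es input)

include hin

theorem EdgeListing.length_input : input.length = 2 + (P.k - 1) * es.length := by
  rw [hin.eq, List.length_cons, List.length_cons, ← List.flatMap_id, List.map_flatMap,
    List.length_flatMap_const (r := P.k - 1)]
  · omega
  · intro e he
    simpa using hin.length_eq e he

variable {s : RamState} {m : ℕ → ℕ → ℕ} {w : List ℕ}

theorem EdgeListing.mem_zero (hs : s.mem = layout (σ.numRels + 1) input m) : s.mem 0 = n := by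
  rw [hs, layout_of_lt (by rw [hin.length_input]; omega), hin.eq]
  rfl

theorem EdgeListing.mem_one (hs : s.mem = layout (σ.numRels + 1) input m) :
    s.mem 1 = es.length := by
  rw [hs, layout_of_lt (by rw [hin.length_input]; omega), hin.eq]
  rfl

theorem EdgeListing.mem_node (hs : s.mem = layout (σ.numRels + 1) input m) {i : ℕ}
    (hi : i < es.length) (j : Fin (P.k - 1)) :
    s.mem (2 + (P.k - 1) * i + j) = (es[i].map Fin.val).getD j 0 := by
  have hlt : (P.k - 1) * (i + 1) ≤ (P.k - 1) * es.length := Nat.mul_le_mul_left _ hi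
  rw [mul_add, mul_one] at hlt
  have hj := j.2
  rw [hs, layout_of_lt (by rw [hin.length_input]; omega), hin.eq,
    show 2 + (P.k - 1) * i + j = (P.k - 1) * i + j + 1 + 1 by omega, List.getD_cons_succ,
    List.getD_cons_succ, ← List.flatMap_id, List.map_flatMap,
    List.getD_flatMap (r := P.k - 1) _ _ _ hi hj]
  · rfl
  · intro e he
    simpa using hin.length_eq e he

theorem EdgeListing.eval_lenE (hs : s.mem = layout (σ.numRels + 1) input m) :
    P.lenE.eval s = input.length := by
  rw [hin.length_input]
  simp [lenE, hin.mem_one hs]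

theorem EdgeListing.eval_simE (hs : s.mem = layout (σ.numRels + 1) input m) (e : Expr) :
    (P.simE e).eval s = input.length + (σ.numRels + (σ.numRels + 1) * e.eval s) := by
  simp [simE, hin.eval_lenE hs]

theorem EdgeListing.eval_elemE (hs : s.mem = layout (σ.numRels + 1) input m) {i : ℕ}
    (hi : i < es.length) (h0 : s.reg 0 = 2 + (P.k - 1) * i) {R : Fin σ.numRels}
    (T : P.Template R) (j : Fin (σ.arity R)) :
    (P.elemE T j).eval s = P.fact T es[i] j := by
  simp only [elemE, fact, Expr.eval_add, Expr.eval_mul, Expr.eval_const, Expr.eval_load,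
    Expr.eval_zero, Expr.eval_one, hin.mem_zero hs, nodeOf]
  congr 1
  cases P.ρ (T.vars j) with
  | none => rfl
  | some a => simpa [h0] using hin.mem_node hs hi (T.node a)

/-- The code of a fact. -/
def factCode {r d : ℕ} (t : Fin r → Fin d) : ℕ :=
  Nat.ofDigits (d + 2) (List.ofFn fun i => (t i : ℕ))

omit hin in
theorem factCode_injective {r d : ℕ} : Function.Injective (factCode (r := r) (d := d)) := by
  intro t t' h
  have := Nat.ofDigits_inj_of_len_eq (b := d + 2) (by omega) (by simp) (by
    simp only [List.mem_ofFn, forall_exists_index, forall_apply_eq_imp_iff]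
    exact fun i => (t i).2.trans (by omega)) (by
    simp only [List.mem_ofFn, forall_exists_index, forall_apply_eq_imp_iff]
    exact fun i => (t' i).2.trans (by omega)) h
  exact funext fun i => Fin.ext (congrFun (List.ofFn_injective this) i)

def factCodes {r d : ℕ} (ts : List (Fin r → Fin d)) : Set ℕ := {c | ∃ t ∈ ts, c = factCode t}

theorem EdgeListing.eval_markE (hs : s.mem = layout (σ.numRels + 1) input m) {i : ℕ}
    (hi : i < es.length) (h0 : s.reg 0 = 2 + (P.k - 1) * i) {R : Fin σ.numRels}
    (T : P.Template R) : (P.markE T).eval s =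
      input.length + (R + (σ.numRels + 1) * factCode (P.fact T es[i])) := by
  have hmap : (List.finRange (σ.arity R)).map (Expr.eval s ∘ P.elemE T) =
      List.ofFn fun j => (P.fact T es[i] j : ℕ) := by
    rw [List.ofFn_eq_map]
    exact List.map_congr_left fun j _ => hin.eval_elemE hs hi h0 T j
  simp [markE, hin.eval_lenE hs, hin.mem_zero hs, hmap, factCode]

variable {B : ℕ}

theorem EdgeListing.reaches_push (hs : Built σ input s m w) {e : Expr} {v : ℕ} (hv : e.eval s = v)
    (hvB : v ≤ B) (hw : w.length + 1 ≤ B) :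
    Reaches B (P.push e) s 2 fun s' => Built σ input s' m (w ++ [v]) ∧ s'.reg 0 = s.reg 0 ∧
      s'.reg 2 = s.reg 2 ∧ s'.reg 6 = s.reg 6 := by
  refine Reaches.seq (T₁ := 1) (T₂ := 1) (Q₁ := fun s' => s'.reg = s.reg ∧ s'.out = s.out ∧
    s'.mem = layout (σ.numRels + 1) input (Function.update m σ.numRels
      fun i => (w ++ [v]).getD i 0)) (Reaches.store (hv ▸ hvB) ⟨rfl, rfl, ?_⟩) ?_
  · simp only [hv]
    rw [hin.eval_simE hs.mem, hs.mem, update_layout (by omega), Expr.eval_var, hs.ptr,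
      Function.update_self, Function.update_idem, List.update_getD_length]
  · rintro s₁ ⟨e1, e2, e3⟩
    refine Reaches.assign ?_ ⟨⟨e3, ?_, fun x h0 h2 h4 h6 => ?_, e2.trans hs.out⟩, ?_, ?_, ?_⟩
    · simpa [e1, hs.ptr] using hw
    · simp [e1, hs.ptr]
    · simp [h4, e1, hs.reg x h0 h2 h4 h6]
    all_goals simp [e1]

/-- Earlier pushes change the memory, so `hf` asks for the value of each expression in every state
that can arise on the way. -/
theorem EdgeListing.reaches_pushAll {α : Type*} (l : List α) (f : α → Expr) (val : α → ℕ)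
    (hs : Built σ input s m w) (hval : ∀ x ∈ l, val x ≤ B) (hw : w.length + l.length ≤ B)
    (hf : ∀ s' w', Built σ input s' m w' → s'.reg 0 = s.reg 0 → ∀ x ∈ l, (f x).eval s' = val x) :
    Reaches B (P.pushAll (l.map f)) s (2 * l.length + 1) fun s' =>
      Built σ input s' m (w ++ l.map val) ∧ s'.reg 0 = s.reg 0 ∧ s'.reg 2 = s.reg 2 ∧
      s'.reg 6 = s.reg 6 := by
  induction l generalizing s w with
  | nil => exact Reaches.skip ⟨by simpa using hs, rfl, rfl, rfl⟩
  | cons x l ih =>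
    rw [List.length_cons] at hw
    refine Reaches.mono (T := 2 + (2 * l.length + 1)) (Reaches.seq
      (hin.reaches_push hs (hf s w hs rfl x List.mem_cons_self) (hval x List.mem_cons_self)
        (by omega)) (Q := fun s' => Built σ input s' m (w ++ (x :: l).map val) ∧
          s'.reg 0 = s.reg 0 ∧ s'.reg 2 = s.reg 2 ∧ s'.reg 6 = s.reg 6) ?_)
      (by rw [List.length_cons]; omega) fun _ h => h
    rintro s₁ ⟨h1, e0, e2, e6⟩
    refine (ih h1 (fun y hy => hval y (List.mem_cons_of_mem _ hy)) (by simp; omega)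
      fun s' w' h' h0 y hy => hf s' w' h' (h0.trans e0) y (List.mem_cons_of_mem _ hy)).mono
      le_rfl ?_
    rintro s₂ ⟨f1, f0, f2, f6⟩
    exact ⟨by simpa using f1, f0.trans e0, f2.trans e2, f6.trans e6⟩

variable {R : Fin σ.numRels} {w₀ : List ℕ}

omit hin in
theorem factCodes_append {r d : ℕ} (ts : List (Fin r → Fin d)) (t) :
    factCodes (ts ++ [t]) = insert (factCode t) (factCodes ts) := by
  ext x
  simp only [factCodes, List.mem_append, List.mem_singleton, Set.mem_ofPred_eq, Set.mem_insert_iff,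
    or_and_right, exists_or, exists_eq_left]
  exact or_comm

/-- The mark of a fact tells in constant time whether it has been written. `M` bounds the final
number of facts, so that the length of the listing stays within `B`. -/
theorem EdgeListing.reaches_addFact {M : ℕ} (T : P.Template R)
    (ts : List (Fin (σ.arity R) → Fin (P.N * (n + 1)))) {i : ℕ} (hi : i < es.length)
    (hs : Built σ input s (Function.update m R (ind (factCodes ts))) (w₀ ++ listing ts))
    (h0 : s.reg 0 = 2 + (P.k - 1) * i) (h6 : s.reg 6 = w₀.length)
    (hM : (appendNew ts (P.fact T es[i])).length ≤ M)
    (hB : w₀.length + (1 + σ.arity R * M) ≤ B) (hMB : M ≤ B) (hd : P.N * (n + 1) ≤ B) :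
    Reaches B (P.addFact T) s (2 * σ.arity R + 4) fun s' =>
      Built σ input s' (Function.update m R (ind (factCodes (appendNew ts (P.fact T es[i])))))
        (w₀ ++ listing (appendNew ts (P.fact T es[i]))) ∧
      s'.reg 0 = s.reg 0 ∧ s'.reg 2 = s.reg 2 ∧ s'.reg 6 = s.reg 6 := by
  have hR : (R : ℕ) ≠ σ.numRels := R.2.ne
  have hcell := hin.eval_markE hs.mem hi h0 T
  have hload : (Expr.load (P.markE T)).eval s = ind (factCodes ts) (factCode (P.fact T es[i])) := by
    rw [Expr.eval_load, hcell, hs.mem, layout_region (by omega), Function.update_of_ne hR,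
      Function.update_self]
  have hiff : (Expr.load (P.markE T)).eval s ≠ 0 ↔ P.fact T es[i] ∈ ts := by
    rw [hload, ind_ne_zero]
    refine ⟨?_, fun h => ⟨_, h, rfl⟩⟩
    rintro ⟨t, ht, he⟩
    exact factCode_injective he ▸ ht
  refine Reaches.ite (T := 2 * σ.arity R + 3) (fun hne => ?_) fun hz => ?_
  · have : appendNew ts (P.fact T es[i]) = ts := if_pos (hiff.1 hne)
    rw [this]
    exact (Reaches.skip ⟨hs, rfl, rfl, rfl⟩).mono (by omega) fun _ h => h
  · have : appendNew ts (P.fact T es[i]) = ts ++ [P.fact T es[i]] :=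
      if_neg fun h => hiff.2 h hz
    rw [this] at hM ⊢
    rw [List.length_append, List.length_singleton] at hM
    set m' := Function.update m R (ind (factCodes (ts ++ [P.fact T es[i]])))
    have hmul : σ.arity R * (ts.length + 1) ≤ σ.arity R * M := Nat.mul_le_mul_left _ hM
    rw [mul_add, mul_one] at hmul
    refine Reaches.mono (T := 1 + ((2 * σ.arity R + 1) + 1)) (Reaches.seq
      (Q₁ := fun s' => Built σ input s' m' (w₀ ++ listing ts) ∧ s'.reg = s.reg)
      (Reaches.store (by rw [Expr.eval_one]; omega)
        ⟨⟨?_, hs.ptr, hs.reg, hs.out⟩, rfl⟩) ?_) (by omega) fun _ h => h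
    · simp only [Expr.eval_one]
      rw [hcell, hs.mem, update_layout (by omega), Function.update_of_ne hR, Function.update_self,
        update_ind_one, ← factCodes_append, Function.update_comm hR, Function.update_idem,
        Function.update_comm hR.symm]
    · rintro s₁ ⟨h1, e1⟩
      refine Reaches.seq (T₁ := 2 * σ.arity R + 1) (Q₁ := fun s' => Built σ input s' m'
        (w₀ ++ listing ts ++ List.ofFn fun j => (P.fact T es[i] j : ℕ)) ∧
        s'.reg 0 = s.reg 0 ∧ s'.reg 2 = s.reg 2 ∧ s'.reg 6 = s.reg 6) ?_ ?_
      · have := hin.reaches_pushAll (List.finRange (σ.arity R)) (P.elemE T)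
          (fun j => (P.fact T es[i] j : ℕ)) h1 (B := B) (fun j _ => (Fin.is_lt _).le.trans hd)
          (by rw [List.length_append, length_listing, List.length_finRange]; omega)
          (fun s' w' h' h0' j _ => hin.eval_elemE h'.mem hi (h0'.trans (e1 ▸ h0)) T j)
        rw [← List.ofFn_eq_map (f := fun j => (P.fact T es[i] j : ℕ)), List.length_finRange,
          e1] at this
        exact this
      · rintro s₂ ⟨h2, f0, f2, f6⟩
        -- At this moment the tuple is appended while the counter still shows the old number.
        have hw : w₀ ++ listing ts ++ (List.ofFn fun j => (P.fact T es[i] j : ℕ)) =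
            w₀ ++ ts.length :: (ts ++ [P.fact T es[i]]).flatMap fun a => List.ofFn fun i => (a i : ℕ) := by
          simp [listing]
        have hc : (P.simE (.var 6)).eval s₂ = _ := hin.eval_simE h2.mem _
        rw [Expr.eval_var, f6, h6] at hc
        have hv : (Expr.load (P.simE (.var 6)) + 1).eval s₂ = ts.length + 1 := by
          rw [Expr.eval_add, Expr.eval_load, hc, h2.mem, layout_region (by omega),
            Function.update_self, hw, Expr.eval_one]
          simp
        refine Reaches.store (by rw [hv]; omega) ⟨⟨?_, ?_, h2.reg, h2.out⟩, f0, f2, f6⟩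
        · simp only [hv]
          rw [hc, h2.mem, update_layout (by omega), Function.update_self, Function.update_idem, hw,
            List.update_getD_append_cons, listing, List.length_append, List.length_singleton]
        · rw [h2.ptr, hw]
          simp [listing]

theorem EdgeListing.reaches_addFacts {M : ℕ} (l : List (P.Template R))
    (ts : List (Fin (σ.arity R) → Fin (P.N * (n + 1)))) {i : ℕ} (hi : i < es.length)
    (hs : Built σ input s (Function.update m R (ind (factCodes ts))) (w₀ ++ listing ts))
    (h0 : s.reg 0 = 2 + (P.k - 1) * i) (h6 : s.reg 6 = w₀.length)
    (hM : ((l.map fun T => P.fact T es[i]).foldl appendNew ts).length ≤ M)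
    (hB : w₀.length + (1 + σ.arity R * M) ≤ B) (hMB : M ≤ B) (hd : P.N * (n + 1) ≤ B) :
    Reaches B (P.addFacts l) s (l.length * (2 * σ.arity R + 4) + 1) fun s' =>
      Built σ input s'
        (Function.update m R (ind (factCodes ((l.map fun T => P.fact T es[i]).foldl appendNew ts))))
        (w₀ ++ listing ((l.map fun T => P.fact T es[i]).foldl appendNew ts)) ∧
      s'.reg 0 = s.reg 0 ∧ s'.reg 2 = s.reg 2 ∧ s'.reg 6 = s.reg 6 := by
  induction l generalizing s ts with
  | nil => exact (Reaches.skip ⟨hs, rfl, rfl, rfl⟩).mono (by omega) fun _ h => h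
  | cons T l ih =>
    rw [List.map_cons, List.foldl_cons] at hM ⊢
    refine Reaches.mono (T := 2 * σ.arity R + 4 + (l.length * (2 * σ.arity R + 4) + 1))
      (Reaches.seq (hin.reaches_addFact T ts hi hs h0 h6
        ((length_le_foldl_appendNew _ _).trans hM) hB hMB hd) fun s₁ ⟨h1, e0, e2, e6⟩ =>
        (ih _ h1 (e0.trans h0) (e6.trans h6) hM).mono le_rfl fun s₂ ⟨h2, f0, f2, f6⟩ =>
          ⟨h2, f0.trans e0, f2.trans e2, f6.trans e6⟩)
      (by rw [List.length_cons, add_mul]; omega) fun _ h => h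

variable [Finite V]

theorem EdgeListing.reaches_addRel (hR : m R = fun _ => 0) (hs : Built σ input s m w₀)
    (hB : w₀.length + (1 + σ.arity R * (P.facts R es).length) ≤ B)
    (hMB : (P.facts R es).length ≤ B) (hd : P.N * (n + 1) ≤ B) (hlen : input.length ≤ B)
    (hes : es.length ≤ B) :
    Reaches B (P.addRel R) s
      (5 + (es.length * ((P.templates R).length * (2 * σ.arity R + 4) + 4) + 1)) fun s' =>
      Built σ input s' (Function.update m R (ind (factCodes (P.facts R es))))
        (w₀ ++ listing (P.facts R es)) := by
  have hlen' := hin.length_input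
  refine Reaches.seq (Q₁ := fun s' => Built σ input s' m (w₀ ++ [0]) ∧ s'.reg 6 = w₀.length ∧
    s'.reg 0 = 2 ∧ s'.reg 2 = es.length) ?_ ?_
  · refine Reaches.seq (T₁ := 1) (T₂ := 4) (Q₁ := fun s' => Built σ input s' m w₀ ∧
      s'.reg 6 = w₀.length) (Reaches.assign ?_ ⟨⟨hs.mem, ?_, fun x h0 h2 h4 h6 => ?_, hs.out⟩, ?_⟩) ?_
    · rw [Expr.eval_var, hs.ptr]; omega
    · simp [hs.ptr]
    · simp [h6, hs.reg x h0 h2 h4 h6]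
    · simp [hs.ptr]
    rintro s₁ ⟨h1, e6⟩
    refine Reaches.seq (T₁ := 2) (T₂ := 2) (hin.reaches_push h1 (e := 0) (v := 0) rfl
      (Nat.zero_le _) (by omega)) ?_
    rintro s₂ ⟨h2, -, -, f6⟩
    refine Reaches.seq (T₁ := 1) (T₂ := 1) (Q₁ := fun s' => Built σ input s' m (w₀ ++ [0]) ∧
      s'.reg 6 = w₀.length ∧ s'.reg 0 = 2) (Reaches.assign ?_
        ⟨⟨h2.mem, ?_, fun x h0 h2' h4 h6 => ?_, h2.out⟩, ?_, ?_⟩) ?_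
    · rw [Expr.eval_two]; omega
    · simpa using h2.ptr
    · simp [h0, h2.reg x h0 h2' h4 h6]
    · simp [f6, e6]
    · simp
    rintro s₃ ⟨h3, g6, g0⟩
    refine Reaches.assign ?_ ⟨⟨h3.mem, ?_, fun x h0 h2' h4 h6 => ?_, h3.out⟩, ?_, ?_, ?_⟩
    · rwa [Expr.eval_load, Expr.eval_one, hin.mem_one h3.mem]
    · simpa using h3.ptr
    · simp [h2', h3.reg x h0 h2' h4 h6]
    · simp [g6]
    · simp [g0]
    · simp [hin.mem_one h3.mem]
  · rintro s₁ ⟨h1, e6, e0, e2⟩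
    have hcand : ∀ i (hi : i < es.length), P.facts R (es.take (i + 1)) =
        ((P.templates R).map fun T => P.fact T es[i]).foldl appendNew (P.facts R (es.take i)) := by
      intro i hi
      rw [facts, facts, ← List.foldl_append, candidates, candidates,
        List.take_succ_eq_append_getElem hi, List.flatMap_append, List.flatMap_singleton]
    -- The list of facts only grows, so the bounds for the final list hold throughout.
    have hle : ∀ i, (P.facts R (es.take i)).length ≤ (P.facts R es).length := by
      intro i
      conv_rhs => rw [facts, ← List.take_append_drop i es, candidates, List.flatMap_append,
        List.foldl_append]
      exact length_le_foldl_appendNew _ _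
    have hloop := Reaches.loop (B := B) (x := 2) (s := s₁) (N := es.length)
      (T := (P.templates R).length * (2 * σ.arity R + 4) + 1 + (1 + 1))
      (p := .seq (P.addFacts (P.templates R))
        (.seq (.assign 0 (.var 0 + .const (P.k - 1))) (.assign 2 (.var 2 - 1))))
      (fun i s => Built σ input s
        (Function.update m R (ind (factCodes (P.facts R (es.take i)))))
        (w₀ ++ listing (P.facts R (es.take i))) ∧ s.reg 6 = w₀.length ∧
        s.reg 0 = 2 + (P.k - 1) * i ∧ s.reg 2 = es.length - i)
      (fun i s _ h => h.2.2.2) ?_ ?_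
    · refine hloop.mono (by rw [Nat.add_assoc]) fun s' h => ?_
      rw [List.take_length] at h
      exact h.1
    · rintro i s₂ hi ⟨h2, f6, f0, f2⟩
      have hmul : (P.k - 1) * (i + 1) ≤ (P.k - 1) * es.length := Nat.mul_le_mul_left _ hi
      rw [mul_add, mul_one] at hmul
      refine Reaches.seq (hin.reaches_addFacts (P.templates R) _ hi h2 f0 f6 (hcand i hi ▸ hle (i + 1)) hB hMB hd) ?_
      rintro s₃ ⟨h3, g0, g2, g6⟩
      rw [← hcand i hi] at h3
      refine Reaches.seq (Q₁ := fun s' => Built σ input s'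
        (Function.update m R (ind (factCodes (P.facts R (es.take (i + 1))))))
        (w₀ ++ listing (P.facts R (es.take (i + 1)))) ∧ s'.reg 6 = w₀.length ∧
        s'.reg 0 = 2 + (P.k - 1) * (i + 1) ∧ s'.reg 2 = es.length - i) (Reaches.assign ?_
          ⟨⟨h3.mem, ?_, fun x h0 h2' h4 h6 => ?_, h3.out⟩, ?_, ?_, ?_⟩) ?_
      · simp only [Expr.eval_add, Expr.eval_var, Expr.eval_const, g0, f0]; omega
      · simpa using h3.ptr
      · simp [h0, h3.reg x h0 h2' h4 h6]
      · simp [g6, f6]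
      · simp [g0, f0, mul_add, add_assoc]
      · simp [g2, f2]
      rintro s₄ ⟨h4, k6, k0, k2⟩
      refine Reaches.assign ?_ ⟨⟨h4.mem, ?_, fun x h0 h2' h4' h6 => ?_, h4.out⟩, ?_, ?_, ?_⟩
      · simp only [Expr.eval_sub, Expr.eval_var, Expr.eval_one, k2]; omega
      · simpa using h4.ptr
      · simp [h2', h4.reg x h0 h2' h4' h6]
      · simp [k6]
      · simp [k0]
      · simp [k2]; omega
    · have : P.facts R (es.take 0) = [] := rfl
      refine ⟨?_, e6, e0, e2⟩
      rw [this, show factCodes (r := σ.arity R) (d := P.N * (n + 1)) [] = ∅ by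
        ext; simp [factCodes], ind_empty, ← hR, Function.update_eq_self]
      exact h1

/-- The listing of the relations up to `j`. -/
noncomputable def prefixListing (P : q.RoleData) (es : List (List (Fin n))) (j : ℕ) : List ℕ :=
  P.N * (n + 1) :: ((List.ofFn fun R => listing (P.facts R es)).take j).flatten

omit hin in
theorem prefixListing_succ (R : Fin σ.numRels) : prefixListing P es (R + 1) =
    prefixListing P es R ++ listing (P.facts R es) := by
  rw [prefixListing, prefixListing, List.take_succ_eq_append_getElem (by simp)]
  simp

omit hin in
theorem prefixListing_length_mono {j j' : ℕ} (h : j ≤ j') :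
    (prefixListing P es j).length ≤ (prefixListing P es j').length := by
  rw [prefixListing, prefixListing, List.length_cons, List.length_cons]
  refine Nat.succ_le_succ (List.Sublist.length_le ?_)
  exact List.Sublist.flatten (List.take_sublist_take_left h)

theorem EdgeListing.reaches_addRels
    (hB : (prefixListing P es σ.numRels).length ≤ B)
    (hMB : ∀ R, (P.facts R es).length ≤ B) (hd : P.N * (n + 1) ≤ B) (hlen : input.length ≤ B)
    (hes : es.length ≤ B) {c : ℕ}
    (hc : ∀ R, (P.templates R).length * (2 * σ.arity R + 4) + 10 ≤ c) (j : ℕ)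
    (hj : j ≤ σ.numRels) :
    Reaches B (P.addRels j) (.init input) ((c * j + 2) * (es.length + 1)) fun s' =>
      ∃ m, (∀ R < σ.numRels, j ≤ R → m R = fun _ => 0) ∧
      Built σ input s' m (prefixListing P es j) := by
  induction j with
  | zero =>
    have h0 : Built σ input (.init input) (fun _ _ => 0) [] := by
      refine ⟨?_, rfl, fun _ _ _ _ _ => rfl, rfl⟩
      rw [← layout_zero (K := σ.numRels + 1)]
      congr 1
      simp
    refine (hin.reaches_push h0 ?_ hd ?_).mono (by omega) fun s' h => ?_
    · simp [hin.mem_zero h0.mem]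
    · exact (Nat.succ_le_of_lt (Nat.succ_pos _)).trans hB
    · exact ⟨_, fun _ _ _ => rfl, h.1⟩
  | succ j ih =>
    refine Reaches.mono (T := (c * j + 2) * (es.length + 1) + c * (es.length + 1))
      (Reaches.seq (ih (by omega)) ?_) (by rw [← add_mul]; exact Nat.mul_le_mul_right _ (by
        rw [mul_add]; omega)) fun _ h => h
    rintro s ⟨m, hm, hs⟩
    rw [dif_pos (show j < σ.numRels from hj)]
    have hsucc := prefixListing_succ (P := P) (es := es) ⟨j, hj⟩
    have hle := prefixListing_length_mono (P := P) (es := es) hj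
    simp only at hsucc
    refine (hin.reaches_addRel (R := ⟨j, hj⟩) (hm j hj le_rfl) hs ?_ (hMB _) hd hlen hes).mono ?_
      fun s' h => ⟨_, fun R hR hjR => ?_, hsucc ▸ h⟩
    · refine le_trans ?_ (hle.trans hB)
      rw [hsucc, List.length_append, length_listing]
    · nlinarith [hc ⟨j, hj⟩, Nat.mul_le_mul_right es.length (hc ⟨j, hj⟩)]
    · rw [Function.update_of_ne (by simp only; omega)]
      exact hm R hR (by omega)

end

end ConjunctiveQuery.RoleData

/-! ## Simulating a program inside a region of the memory -/

/-- Run a program with its registers in the odd variables, its memory cells in the places given by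
`cell`, and its output consumed by `handler`. -/
def Prog.sim (cell : Expr → Expr) (handler : Expr → Stmt) : Prog → Stmt
  | .skip => .skip
  | .instr i => match i with
    | .const r n => .assign (2 * r + 1) (.const n)
    | .add r a b => .assign (2 * r + 1) (.var (2 * a + 1) + .var (2 * b + 1))
    | .sub r a b => .assign (2 * r + 1) (.var (2 * a + 1) - .var (2 * b + 1))
    | .mul r a b => .assign (2 * r + 1) (.var (2 * a + 1) * .var (2 * b + 1))
    | .load r a => .assign (2 * r + 1) (.load (cell (.var (2 * a + 1))))
    | .store a b => .store (cell (.var (2 * a + 1))) (.var (2 * b + 1))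
    | .out a => handler (.var (2 * a + 1))
  | .seq p₁ p₂ => .seq (p₁.sim cell handler) (p₂.sim cell handler)
  | .ite a p₁ p₂ => .ite (.var (2 * a + 1)) (p₁.sim cell handler) (p₂.sim cell handler)
  | .loop a p => .loop (2 * a + 1) (p.sim cell handler)

/-- A property of outputs: the first entry satisfies `T₀` or a later one satisfies `T₁`. -/
def Answer (T₀ T₁ : ℕ → Prop) : List ℕ → Prop
  | [] => False
  | a :: l => T₀ a ∨ ∃ x ∈ l, T₁ x

theorem answer_append {T₀ T₁ : ℕ → Prop} {l : List ℕ} {x : ℕ} :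
    Answer T₀ T₁ (l ++ [x]) ↔ Answer T₀ T₁ l ∨ (l = [] ∧ T₀ x) ∨ (l ≠ [] ∧ T₁ x) := by
  cases l with
  | nil => simp [Answer]
  | cons a l => simp [Answer, or_and_right, exists_or, or_assoc]

/-- Register `8` records whether the output so far has the property, register `10` whether there is
any output. -/
def answerHandler (test₀ test₁ : Expr → Expr) (e : Expr) : Stmt :=
  -- The outer `1 - (1 - _)` turns any positive number into `1`. Register `10` selects the test for
  -- the first or for a later entry.
  .seq (.assign 8 (1 - (1 - (.var 8 + ((1 - .var 10) * test₀ e + .var 10 * test₁ e)))))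
    (.assign 10 1)

/-- `h` simulates `s` in region `j` of the memory. -/
structure Simulates (K j : ℕ) (input : List ℕ) (m : ℕ → ℕ → ℕ) (T₀ T₁ : ℕ → Prop)
    (s h : RamState) : Prop where
  reg : ∀ a, h.reg (2 * a + 1) = s.reg a
  mem : h.mem = layout K input (Function.update m j s.mem)
  flag_le : h.reg 8 ≤ 1
  flag : h.reg 8 ≠ 0 ↔ Answer T₀ T₁ s.out
  seen_le : h.reg 10 ≤ 1
  seen : h.reg 10 ≠ 0 ↔ s.out ≠ []
  out : h.out = []

theorem Simulates.assign {K j : ℕ} {input : List ℕ} {m : ℕ → ℕ → ℕ} {T₀ T₁ : ℕ → Prop}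
    {s h : RamState} (hs : Simulates K j input m T₀ T₁ s h) (r v : ℕ) :
    Simulates K j input m T₀ T₁ { s with reg := Function.update s.reg r v }
      { h with reg := Function.update h.reg (2 * r + 1) v } := by
  have h8 : 8 ≠ 2 * r + 1 := by omega
  have h10 : 10 ≠ 2 * r + 1 := by omega
  refine ⟨fun a => ?_, hs.mem, ?_, ?_, ?_, ?_, hs.out⟩
  · by_cases ha : a = r
    · subst ha; simp
    · have : 2 * a + 1 ≠ 2 * r + 1 := by omega
      simpa [ha] using hs.reg a
  · simpa [h8] using hs.flag_le
  · simpa [h8] using hs.flag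
  · simpa [h10] using hs.seen_le
  · simpa [h10] using hs.seen

/-- Simulated registers are odd and those of the host even, so they do not interfere. Output is
tested as it appears and never stored. Each instruction becomes one assignment or store, or the two
assignments of the handler, hence the factor `2`. -/
theorem Exec.sim {K j : ℕ} {input : List ℕ} {m : ℕ → ℕ → ℕ} {T₀ T₁ : ℕ → Prop} (hj : j < K)
    {cell : Expr → Expr} {test₀ test₁ : Expr → Expr}
    (hcell : ∀ (h : RamState) m e, h.mem = layout K input m →
      (cell e).eval h = input.length + (j + K * e.eval h))
    (htest₀ : ∀ (h : RamState) m e, h.mem = layout K input m →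
      ((test₀ e).eval h ≠ 0 ↔ T₀ (e.eval h)))
    (htest₁ : ∀ (h : RamState) m e, h.mem = layout K input m →
      ((test₁ e).eval h ≠ 0 ↔ T₁ (e.eval h)))
    {W B : ℕ} (hWB : W ≤ B) (hB : 1 ≤ B) {p : Prog} {s s' : RamState} {t : ℕ}
    (he : Exec W p s t s') (h : RamState) (hs : Simulates K j input m T₀ T₁ s h) :
    ∃ t' h', Steps B (p.sim cell (answerHandler test₀ test₁)) h t' h' ∧ t' ≤ 2 * t ∧
      Simulates K j input m T₀ T₁ s' h' := by
  induction he generalizing h with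
  | skip => exact ⟨1, h, .skip h, by omega, hs⟩
  | instr i s hv =>
    have hassign : ∀ r e, e.eval h = i.value s →
        i.run s = { s with reg := Function.update s.reg r (i.value s) } →
        ∃ t' h', Steps B (.assign (2 * r + 1) e) h t' h' ∧ t' ≤ 2 * 1 ∧
          Simulates K j input m T₀ T₁ (i.run s) h' := by
      intro r e he hrun
      refine ⟨1, _, .assign _ _ _ (he ▸ hv.trans hWB), by omega, ?_⟩
      rw [hrun, he]
      exact hs.assign r _
    cases i with
    | const r n => exact hassign r _ rfl rfl
    | add r a b => exact hassign r _ (by simp [Instr.value, hs.reg]) rfl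
    | sub r a b => exact hassign r _ (by simp [Instr.value, hs.reg]) rfl
    | mul r a b => exact hassign r _ (by simp [Instr.value, hs.reg]) rfl
    | load r a =>
      refine hassign r _ ?_ rfl
      rw [Expr.eval_load, hcell h _ _ hs.mem, hs.mem, layout_region hj, Function.update_self,
        Expr.eval_var, hs.reg]
      rfl
    | store a b =>
      have hb : (Expr.var (2 * b + 1)).eval h = s.reg b := hs.reg b
      refine ⟨1, _, .store _ _ _ (hb ▸ hv.trans hWB), by omega, ?_⟩
      refine ⟨hs.reg, ?_, hs.flag_le, hs.flag, hs.seen_le, hs.seen, hs.out⟩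
      simp only [hb]
      rw [hcell h _ _ hs.mem, hs.mem, update_layout hj, Function.update_self, Function.update_idem,
        Expr.eval_var, hs.reg]
      rfl
    | out a =>
      have ha : (Expr.var (2 * a + 1)).eval h = s.reg a := hs.reg a
      set e : Expr := 1 - (1 - (.var 8 + ((1 - .var 10) * test₀ (.var (2 * a + 1)) +
        .var 10 * test₁ (.var (2 * a + 1))))) with he
      have h₀ := htest₀ h _ (.var (2 * a + 1)) hs.mem
      have h₁ := htest₁ h _ (.var (2 * a + 1)) hs.mem
      rw [ha] at h₀ h₁
      have hle : e.eval h ≤ 1 := by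
        simp only [he, Expr.eval_sub, Expr.eval_one]; omega
      have hne : e.eval h ≠ 0 ↔ Answer T₀ T₁ (s.out ++ [s.reg a]) := by
        rw [answer_append, ← hs.flag, ← h₀, ← h₁, ← hs.seen]
        have hnil : s.out = [] ↔ h.reg 10 = 0 := (not_iff_not.1 hs.seen).symm
        rw [hnil]
        simp only [he, Expr.eval_sub, Expr.eval_one, Expr.eval_add, Expr.eval_mul, Expr.eval_var]
        rcases Nat.le_one_iff_eq_zero_or_eq_one.1 hs.seen_le with hx | hx
        · simp [hx]
          omega
        · simp [hx]
          omega
      refine ⟨1 + 1, _, .seq (.assign _ _ _ (hle.trans hB)) (.assign _ _ _ hB), by omega, ?_⟩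
      refine ⟨fun b => ?_, hs.mem, ?_, ?_, ?_, ?_, hs.out⟩
      · have h8 : 2 * b + 1 ≠ 8 := by omega
        have h10 : 2 * b + 1 ≠ 10 := by omega
        simpa [h8, h10, Instr.run] using hs.reg b
      · exact hle
      · exact hne
      · simp
      · simp [Instr.run]
  | seq _ _ ih₁ ih₂ =>
    obtain ⟨u₁, h₁, hx₁, hu₁, hs₁⟩ := ih₁ h hs
    obtain ⟨u₂, h₂, hx₂, hu₂, hs₂⟩ := ih₂ h₁ hs₁
    exact ⟨_, _, .seq hx₁ hx₂, by omega, hs₂⟩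
  | ite_true ha _ ih =>
    obtain ⟨u, h₁, hx, hu, hs₁⟩ := ih h hs
    exact ⟨_, _, .ite_true (by rwa [Expr.eval_var, hs.reg]) hx, by omega, hs₁⟩
  | ite_false ha _ ih =>
    obtain ⟨u, h₁, hx, hu, hs₁⟩ := ih h hs
    exact ⟨_, _, .ite_false (by rwa [Expr.eval_var, hs.reg]) hx, by omega, hs₁⟩
  | loop_stop ha => exact ⟨_, _, .loop_halt (by rwa [hs.reg]), by omega, hs⟩
  | loop_step ha _ _ ih₁ ih₂ =>
    obtain ⟨u₁, h₁, hx₁, hu₁, hs₁⟩ := ih₁ h hs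
    obtain ⟨u₂, h₂, hx₂, hu₂, hs₂⟩ := ih₂ h₁ hs₁
    exact ⟨_, _, .loop_step (by rwa [hs.reg]) hx₁ hx₂, by omega, hs₂⟩

/-! ## Deciding the existence of hypercliques -/

theorem inputMagnitude_le {l : List ℕ} {a b : ℕ} (ha : l.length ≤ a) (hb : ∀ x ∈ l, x ≤ b) :
    inputMagnitude l ≤ a + b := by
  refine Nat.add_le_add ha ?_
  clear ha
  induction l with
  | nil => exact Nat.zero_le _
  | cons x l ih =>
    exact max_le (hb x List.mem_cons_self) (ih fun y hy => hb y (List.mem_cons_of_mem _ hy))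

namespace ConjunctiveQuery.RoleData

variable {σ : Schema} {V : Type*} {q : ConjunctiveQuery σ V} (P : q.RoleData)

/-- Conditions on the first and the later entries of a listing of solutions, which together say
that there is a tagged solution. -/
structure Tests (n : ℕ) (T₀ T₁ : ℕ → Prop) : Prop where
  answer : ∀ o, ∀ S : Set (Fin q.arity → Fin (P.N * (n + 1))), EncodesRelation S o →
    (Answer T₀ T₁ o ↔ ∃ b ∈ S, P.Tagged b)

/-- Without free variables every solution is tagged, so only the count at the head of the listing
matters. With one free variable the entries after the count are the solutions, and one of them must
carry the right tag. -/
theorem exists_tests (hq : q.arity = 0 ∨ q.arity = 1) :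
    ∃ (test₀ test₁ : Expr → Expr) (T₀ T₁ : ℕ → ℕ → Prop), (∀ n, P.Tests n (T₀ n) (T₁ n)) ∧
      ∀ (h : RamState) e n, h.mem 0 = n → ((test₀ e).eval h ≠ 0 ↔ T₀ n (e.eval h)) ∧
        ((test₁ e).eval h ≠ 0 ↔ T₁ n (e.eval h)) := by
  rcases hq with hq | hq
  · refine ⟨id, fun _ => 0, fun _ x => x ≠ 0, fun _ _ => False, fun n => ⟨?_⟩, fun h e n _ => ?_⟩
    · rintro _ S ⟨ts, -, hts, rfl⟩
      simp only [Answer, and_false, exists_false, or_false]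
      rw [← Nat.pos_iff_ne_zero, List.length_pos_iff_exists_mem]
      refine exists_congr fun b => ?_
      rw [hts]
      exact ⟨fun h => ⟨h, fun i => absurd i.2 (by omega)⟩, fun h => h.1⟩
    · simp
  · let x := q.free ⟨0, by omega⟩
    -- The quotient by `n + 1` is tested without division: the two truncated differences are both
    -- positive exactly on the interval of values with this tag.
    refine ⟨fun _ => 0, fun e => (e + 1 - .const (P.ix x) * (.load 0 + 1)) *
      ((.const (P.ix x) + 1) * (.load 0 + 1) - e), fun _ _ => False,
      fun n v => v / (n + 1) = P.ix x, fun n => ⟨?_⟩, fun h e n hn => ⟨by simp, ?_⟩⟩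
    · rintro _ S ⟨ts, -, hts, rfl⟩
      simp only [Answer, false_or, List.mem_flatMap, List.mem_ofFn]
      constructor
      · rintro ⟨_, ⟨b, hb, i, rfl⟩, h⟩
        refine ⟨b, (hts b).1 hb, fun j => ?_⟩
        obtain rfl : i = j := Fin.ext (by have := i.2; have := j.2; omega)
        rw [h]
        exact congrArg (fun k => (P.ix (q.free k) : ℕ))
          (Fin.ext (by have := i.2; show 0 = (i : ℕ); omega))
      · rintro ⟨b, hb, ht⟩
        exact ⟨_, ⟨b, (hts b).2 hb, ⟨0, by omega⟩, rfl⟩, ht _⟩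
    · beta_reduce
      rw [Nat.div_eq_iff (show 0 < n + 1 from n.succ_pos)]
      simp only [Expr.eval_mul, Expr.eval_sub, Expr.eval_add, Expr.eval_const, Expr.eval_load,
        Expr.eval_zero, Expr.eval_one, hn, Nat.mul_ne_zero_iff]
      rw [add_mul, one_mul]
      omega

variable [Finite V]

/-- Write the database, run the given program on it, and report whether there is a tagged
solution. -/
noncomputable def hypercliqueProgram (p : Prog) (test₀ test₁ : Expr → Expr) : Stmt :=
  .seq (P.addRels σ.numRels) (.seq (p.sim P.simE (answerHandler test₀ test₁))
    (.ite (.var 8) (.out 1) (.out 0)))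

variable {P} {n : ℕ} {es : List (List (Fin n))} {input : List ℕ}

theorem prefixListing_numRels : prefixListing P es σ.numRels =
    P.N * (n + 1) :: (List.ofFn fun R => listing (P.facts R es)).flatten := by
  rw [prefixListing, List.take_of_length_le (by simp)]

theorem EdgeListing.reaches_hypercliqueProgram (hin : P.EdgeListing es input)
    {p : Prog} {test₀ test₁ : Expr → Expr} {T₀ T₁ : ℕ → Prop}
    (htest : ∀ (h : RamState) e, h.mem 0 = n → ((test₀ e).eval h ≠ 0 ↔ T₀ (e.eval h)) ∧
        ((test₁ e).eval h ≠ 0 ↔ T₁ (e.eval h))) {W B t : ℕ} {s : RamState}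
    (hp : Exec W p (.init (prefixListing P es σ.numRels)) t s) (hW : W ≤ B)
    (hB : inputMagnitude (prefixListing P es σ.numRels) ≤ B) (hB' : inputMagnitude input ≤ B)
    {c : ℕ} (hc : ∀ R, (P.templates R).length * (2 * σ.arity R + 4) + 10 ≤ c) :
    Reaches B (P.hypercliqueProgram p test₀ test₁) (.init input)
      ((c * σ.numRels + 2) * (es.length + 1) + (2 * t + 2)) fun h =>
        (Answer T₀ T₁ s.out ∧ h.out = [1]) ∨ (¬ Answer T₀ T₁ s.out ∧ h.out = [0]) := by
  have hL := P.listing_database es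
  rw [← prefixListing_numRels] at hL
  have hlen : (prefixListing P es σ.numRels).length ≤ inputMagnitude _ := Nat.le_add_right _ _
  have hlen' : input.length ≤ inputMagnitude input := Nat.le_add_right _ _
  have hes : es.length ≤ inputMagnitude input := by
    have := getD_le_inputMagnitude input 1
    rwa [hin.eq] at this ⊢
  refine Reaches.seq (hin.reaches_addRels (hlen.trans hB)
    (fun R => (hL.length_le_magnitude R).trans hB) ?_ (hlen'.trans hB') (hes.trans hB') hc _ le_rfl)
    ?_
  · have := getD_le_inputMagnitude (prefixListing P es σ.numRels) 0
    exact this.trans hB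
  rintro h₁ ⟨m, -, hb⟩
  have h1 : 1 ≤ B := by
    have : 0 < input.length := by rw [hin.length_input]; omega
    omega
  have hsim : Simulates (σ.numRels + 1) σ.numRels input m T₀ T₁
      (.init (prefixListing P es σ.numRels)) h₁ := by
    -- Writing the database has left the odd registers and both flags at zero, which is the initial
    -- configuration of the simulated program.
    refine ⟨fun a => hb.reg _ ?_ ?_ ?_ ?_, hb.mem, ?_, ?_, ?_, ?_, hb.out⟩
    any_goals omega
    · rw [hb.reg 8] <;> decide
    · rw [hb.reg 8] <;> simp [RamState.init, Answer]
    · rw [hb.reg 10] <;> decide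
    · rw [hb.reg 10] <;> simp [RamState.init]
  obtain ⟨t', h₂, hx, ht', hs⟩ := hp.sim (Nat.lt_succ_self _)
    (fun h m e hm => hin.eval_simE hm e)
    (fun h m e hm => (htest h e (hin.mem_zero hm)).1)
    (fun h m e hm => (htest h e (hin.mem_zero hm)).2) hW h1 h₁ hsim
  refine Reaches.seq (Q₁ := fun h => h = h₂) ⟨t', h₂, hx, ht', rfl⟩ ?_
  rintro _ rfl
  refine Reaches.ite (T := 1) (fun h => Reaches.out (.inl ⟨hs.flag.1 h, ?_⟩))
    fun h => Reaches.out (.inr ⟨fun ha => hs.flag.2 ha h, ?_⟩)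
  · rw [hs.out]; rfl
  · rw [hs.out]; rfl

/-- Numbers polynomial in the magnitude of the written database are then polynomial in that of the
hypergraph, so the simulated program keeps to words of logarithmic length. -/
theorem EdgeListing.inputMagnitude_prefixListing_le (hin : P.EdgeListing es input) :
    inputMagnitude (prefixListing P es σ.numRels) ≤
      (1 + σ.numRels + ∑ R, σ.arity R * (P.templates R).length + P.N +
        ∑ R, (P.templates R).length) * (inputMagnitude input + 1) := by
  have hn : n ≤ inputMagnitude input := by
    have := getD_le_inputMagnitude input 0
    rwa [hin.eq] at this ⊢
  have hes : es.length ≤ inputMagnitude input := by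
    have := getD_le_inputMagnitude input 1
    rwa [hin.eq] at this ⊢
  set X := inputMagnitude input + 1
  have hlen : (prefixListing P es σ.numRels).length ≤
      (1 + σ.numRels + ∑ R, σ.arity R * (P.templates R).length) * X := by
    rw [prefixListing_numRels, List.length_cons, List.length_flatten, List.map_ofFn, List.sum_ofFn]
    have : ∑ R, (List.length ∘ fun R => listing (P.facts R es)) R ≤
        ∑ R, (1 + σ.arity R * (P.templates R).length * X) := by
      refine Finset.sum_le_sum fun R _ => ?_
      rw [Function.comp_apply, length_listing, mul_assoc]
      refine Nat.add_le_add_left (Nat.mul_le_mul_left _ ((P.length_facts_le R es).trans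
        (Nat.mul_le_mul_left _ (by omega)))) 1
    rw [Finset.sum_add_distrib, ← Finset.sum_mul] at this
    simp only [Finset.sum_const, Finset.card_univ, Fintype.card_fin, smul_eq_mul, mul_one] at this
    have hX : 1 ≤ X := by omega
    nlinarith [Nat.mul_le_mul_left (1 + σ.numRels) hX]
  have hsum : ∀ R, (P.templates R).length ≤ ∑ R, (P.templates R).length := fun R =>
    Finset.single_le_sum (f := fun R => (P.templates R).length) (fun _ _ => Nat.zero_le _)
      (Finset.mem_univ R)
  refine (inputMagnitude_le hlen (b := (P.N + ∑ R, (P.templates R).length) * X) ?_).trans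
    (le_of_eq (by ring))
  have hd : P.N * (n + 1) ≤ (P.N + ∑ R, (P.templates R).length) * X :=
    Nat.mul_le_mul (by omega) (by omega)
  rw [prefixListing_numRels]
  intro x hx
  rcases List.mem_cons.1 hx with rfl | hx
  · exact hd
  · rw [List.mem_flatten] at hx
    obtain ⟨l, hl, hx⟩ := hx
    rw [List.mem_ofFn] at hl
    obtain ⟨R, rfl⟩ := hl
    rcases List.mem_cons.1 hx with rfl | hx
    · exact (P.length_facts_le R es).trans (Nat.mul_le_mul ((hsum R).trans (by omega)) (by omega))
    · rw [List.mem_flatMap] at hx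
      obtain ⟨t, -, hx⟩ := hx
      rw [List.mem_ofFn] at hx
      obtain ⟨i, rfl⟩ := hx
      exact (t i).2.le.trans hd

end ConjunctiveQuery.RoleData

/-! ### The reduction and its running time -/

namespace ConjunctiveQuery

variable {σ : Schema} {V : Type*} {q : ConjunctiveQuery σ V}

theorem EvaluableInLinearTime.hypercliqueInLinearTime [Finite V] (P : q.RoleData)
    (hmin : q.IsMinimal) (hq : q.arity = 0 ∨ q.arity = 1) (h : q.EvaluableInLinearTime) :
    HypercliqueInLinearTime P.k := by
  obtain ⟨p, c, hp⟩ := h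
  obtain ⟨test₀, test₁, T₀, T₁, hT, htest⟩ := P.exists_tests hq
  set S := ∑ R, (P.templates R).length
  set C₂ := 1 + σ.numRels + ∑ R, σ.arity R * (P.templates R).length + P.N + S
  set c₁ := ∑ R, ((P.templates R).length * (2 * σ.arity R + 4) + 10)
  have hc₁ : ∀ R, (P.templates R).length * (2 * σ.arity R + 4) + 10 ≤ c₁ := fun R =>
    Finset.single_le_sum (f := fun R => (P.templates R).length * (2 * σ.arity R + 4) + 10)
      (fun _ _ => Nat.zero_le _) (Finset.mem_univ R)
  -- The summands are the coefficients needed for the three parts of `B`; adding `c` also makes `C`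
  -- a sufficient exponent.
  set C := c * (C₂ + 1) ^ c + C₂ + c + 1
  set pr := P.hypercliqueProgram p test₀ test₁
  -- The cost of writing the database, then twice the running time on it, which is linear since its
  -- size is at most `S * es.length`, and the final answer.
  set T := c₁ * σ.numRels + 2 + (2 * (c * (S + 1)) + 2)
  refine ⟨pr.code, (C + 2) ^ pr.deg + C * pr.deg + pr.cost * T, ?_⟩
  rintro n E hE input ⟨es, hnodup, hnodup', hes, hinput⟩
  have hin : P.EdgeListing es input := by
    refine ⟨fun e he => ?_, hinput⟩
    rw [← hE _ ((hes _).1 (List.mem_map_of_mem he)), List.toFinset_card_of_nodup (hnodup e he)]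
  have hcard : E.card = es.length := by
    rw [← List.length_map (f := List.toFinset), ← List.toFinset_card_of_nodup hnodup']
    congr 1
    ext e
    rw [List.mem_toFinset, hes]
  have henc : (P.database es).Encodes (RoleData.prefixListing P es σ.numRels) := by
    refine ⟨fun R => listing (P.facts R es), fun R => ⟨P.facts R es,
      (P.listing_database es).nodup R, (P.listing_database es).mem_iff R, rfl⟩, ?_⟩
    exact RoleData.prefixListing_numRels
  obtain ⟨t, s, hx, ht, hgood⟩ := hp _ _ henc
  set M := inputMagnitude (RoleData.prefixListing P es σ.numRels)
  have hM : M ≤ C₂ * (inputMagnitude input + 1) := hin.inputMagnitude_prefixListing_le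
  set X := inputMagnitude input + 1 with hX
  -- One bound for the words of the simulated program, for the database it is given, and for the
  -- hypergraph.
  set B := c * (M + 1) ^ c + M + X
  have hX1 : 1 ≤ X := by omega
  have hXC : X ≤ X ^ C := Nat.le_self_pow (by omega) X
  have hBC : B ≤ C * X ^ C := by
    have h1 : c * (M + 1) ^ c ≤ c * (C₂ + 1) ^ c * X ^ C := by
      calc c * (M + 1) ^ c ≤ c * ((C₂ + 1) * X) ^ c :=
            Nat.mul_le_mul_left _ (Nat.pow_le_pow_left (by rw [add_mul]; omega) _)
        _ = c * (C₂ + 1) ^ c * X ^ c := by rw [mul_pow, mul_assoc]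
        _ ≤ c * (C₂ + 1) ^ c * X ^ C :=
            Nat.mul_le_mul_left _ (Nat.pow_le_pow_right hX1 (by omega))
    have h2 : M ≤ C₂ * X ^ C := hM.trans (Nat.mul_le_mul_left _ hXC)
    have h3 : C * X ^ C = c * (C₂ + 1) ^ c * X ^ C + C₂ * X ^ C + c * X ^ C + X ^ C := by
      simp only [C]; ring
    rw [h3]
    omega
  have hreach := hin.reaches_hypercliqueProgram (fun h e hn => htest h e n hn) hx
    (B := B) (by omega) (by omega) (by omega) hc₁
  have hans := (hT n).answer s.out _ hgood
  refine Reaches.runs hBC (fun i => (getD_le_inputMagnitude input i).trans (by omega))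
    (hreach.mono ?_ ?_)
  · have hsize : (P.database es).size ≤ S * es.length := P.size_database_le es
    rw [hcard]
    have h1 : t ≤ c * (S + 1) * (es.length + 1) := by
      refine ht.trans ?_
      rw [mul_assoc]
      refine Nat.mul_le_mul_left _ ?_
      nlinarith
    have h2 : T * (es.length + 1) = (c₁ * σ.numRels + 2) * (es.length + 1) +
        (2 * (c * (S + 1) * (es.length + 1)) + 2 * (es.length + 1)) := by
      simp only [T]; ring
    rw [h2]
    omega
  · have hiff : Answer (T₀ n) (T₁ n) s.out ↔ HasHyperclique P.k E := by
      rw [hans]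
      refine ⟨fun ⟨b, hb, ht⟩ => ?_, fun h => ?_⟩
      · exact P.hasHyperclique_of_tagged hmin hE hnodup hes hb ht
      · exact P.exists_tagged_of_hasHyperclique hE hnodup hes h
    intro h
    rw [hiff]
    exact id

theorem EvaluableInLinearTime.isAcyclic [Finite V] (hmin : q.IsMinimal)
    (hq : q.arity = 0 ∨ q.arity = 1) (hconj : SHyperclique) (h : q.EvaluableInLinearTime) :
    q.IsAcyclic := by
  by_contra hcyc
  obtain ⟨P⟩ := exists_roleData hcyc
  exact hconj P.k P.le_k (h.hypercliqueInLinearTime P hmin hq)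

end ConjunctiveQuery

theorem mainTheorem1 (σ : Schema) {V : Type*} [Finite V] (q : ConjunctiveQuery σ V)
    (hmin : q.IsMinimal) (harity : q.arity = 0 ∨ q.arity = 1) (hconj : SHyperclique) :
    q.EvaluableInLinearTime ↔ q.IsAcyclic :=
  ⟨fun h => h.isAcyclic hmin harity hconj, fun h => h.evaluableInLinearTime harity⟩
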